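/- **Theories.** $\mathsf{EA}^*$ is the first-order theory with equality whose language has a unary relation $\mathrm{Dom}$, a binary relation $\in$, a constant $\varnothing$, unary function symbols $\mathrm P$ (power set), $\bigcup$ (sum set), $\mathrm R$ (rank), a binary function symbol $\{\cdot,\cdot\}$ (pair set) and, for every bounded quantifier formula $\phi(u,\vec x)$ of this same language, a function symbol $\{u\in y:\phi(u,\vec x)\}$ of the arguments $\vec x,y$ (quantifiers in bounded quantifier formulas have the form $\forall u\in t$ or $\exists u\in t$, with $t$ a term in which $u$ does not occur). Its axioms are $\forall x\,\mathrm{Dom}(x)$, Extensionality, Empty Set, Pair Set, Sum Set, Power Set, Foundation, Separation $z\in\{u\in y:\phi(u,\vec x)\}\leftrightarrow z\in y\wedge\phi(z,\vec x)$ for bounded quantifier formulas $\phi$, Dedekind Finiteness (every one-one $f:x\to x$ is onto), and the Weak Hierarchy Principle: $x\in\mathrm R(x)$, $\mathrm R(x)$ is a level, and $\mathrm R(x)\subseteq y$ for every level $y$ with $x\in y$. Here $S$ is a *level* if there is a linear ordering $[V_0,\dots,V_n]$ of subsets of $S$ with $V_0=\varnothing$, $V_n=S$ and $V_{k+1}=\mathrm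 P(V_k)$. Orderings are reflexive, i.e. sets of ordered pairs $\langle a,b\rangle$ with $a\le b$. $\mathsf{I}\Delta_0+\mathsf{exp}$ is the theory in the language $\mathrm{Dom},0,S,+,\cdot,\mathrm{Exp},<$ (with $\mathrm{Exp}(x,y)=x^y$) with axioms $\forall x\,\mathrm{Dom}(x)$; $S(x)\neq 0$; $S(x)=S(y)\to x=y$; $x+0=x$; $x+S(y)=S(x+y)$; $x\cdot 0=0$; $x\cdot S(y)=x\cdot y+x$; $\mathrm{Exp}(x,0)=S(0)$; $\mathrm{Exp}(x,S(y))=\mathrm{Exp}(x,y)\cdot x$; $\neg\, x<0$; $x<S(y)\leftrightarrow x<y\vee x=y$; and induction for all bounded quantifier formulas of this language (with parameters). **Definitions in $\mathsf{EA}^*$.** For a linear ordering $L$, $\mathrm{Lex}(L)$ is the ordering of the power set of $\mathrm{Field}(L)$ in which $X$ precedes $Y$ iff the $L$-greatest element of $X\bigtriangleup Y$ is in $Y$. For a level $V_n$ with chain $[V_0,\dots,V_n]$ let $\mathrm{Ack}(V_0)$ be the empty ordering and $\mathrm{Ack}(V_{k+1})=\mathrm{Lex}(\mathrm{Ack}(V_k))$.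 Put - $x<_{\mathrm a}y$ iff $\mathrm R(x)\subseteq\mathrm R(y)$ and $x$ strictly precedes $y$ in $\mathrm{Ack}(\mathrm R(y))$; - $0_{\mathrm a}=\varnothing$, and $S_{\mathrm a}(x)$ is the element immediately following $x$ in $\mathrm{Ack}(\mathrm P(\mathrm R(x)))$; - writing $m$ for the $<_{\mathrm a}$-greater of $x,y$, and $|w|_L$ for the field of the segment $[\{\varnothing\},\dots,w]_L$ (all $v$ with $\{\varnothing\}\le_L v\le_L w$): $x+_{\mathrm a}y$, respectively $x\times_{\mathrm a}y$, is the unique $z$ in the field of $L=\mathrm{Ack}(\mathrm P(\mathrm R(m)))$ such that $|z|_L$ is equinumerous (injections both ways) with the disjoint union $(|x|_L\times\{\varnothing\})\cup(|y|_L\times\{\{\varnothing\}\})$, respectively with $|x|_L\times|y|_L$; and $\mathrm{Exp}_{\mathrm a}(x,y)$ is the unique $z$ in the field of $L=\mathrm{Ack}(\mathrm P(\mathrm P(\mathrm R(m))))$ such that $|z|_L$ is equinumerous with the set of functions from $|y|_L$ to $|x|_L$. **Theorem.** In every model $V$ of $\mathsf{EA}^*$: for each level $s$ the ordering $\mathrm{Ack}(s)$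 exists, is unique, and is a linear ordering with field $s$; $<_{\mathrm a}$ is a strict total order of the universe; $S_{\mathrm a},+_{\mathrm a},\times_{\mathrm a},\mathrm{Exp}_{\mathrm a}$ are well-defined total functions; and $$\langle V,0_{\mathrm a},<_{\mathrm a},S_{\mathrm a},+_{\mathrm a},\times_{\mathrm a},\mathrm{Exp}_{\mathrm a}\rangle\models\mathsf{I}\Delta_0+\mathsf{exp}.$$ Moreover there is a mapping $\mathfrak d$ that sends $\mathrm{Dom}(x)$ to $\mathrm{Dom}(x)$, $x=y$ to $x=y$, $0$ to $\varnothing$, $x<y$ to a formula defining $x<_{\mathrm a}y$, and $S(x),x+y,x\cdot y,\mathrm{Exp}(x,y)$ to terms of $\mathsf{EA}^*$ denoting $S_{\mathrm a}(x),x+_{\mathrm a}y,x\times_{\mathrm a}y,\mathrm{Exp}_{\mathrm a}(x,y)$ in every model of $\mathsf{EA}^*$; and every such $\mathfrak d$ defines an interpretation of $\mathsf{I}\Delta_0+\mathsf{exp}$ in $\mathsf{EA}^*$: $\mathsf{EA}^*$ proves that the translated domain is non-empty, and proves $\sigma^{\mathfrak d}$ for each axiom $\sigma$ of $\mathsf{I}\Delta_0+\mathsf{exp}$,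 where $\sigma^{\mathfrak d}$ is obtained by replacing the symbols by their images and relativizing quantifiers to the translation of $\mathrm{Dom}$. -/

import Mathlib

open FirstOrder FirstOrder.Language

namespace BoundedTheories

section General

variable {L : FirstOrder.Language} {α : Type} {n : ℕ}

/-- Weakening of a term to a context with one more bound variable. -/
def up (t : L.Term (α ⊕ Fin n)) : L.Term (α ⊕ Fin (n + 1)) :=
  t.relabel (Sum.map id Fin.castSucc)

/-- The variable bound by the innermost quantifier. -/
def newest : L.Term (α ⊕ Fin (n + 1)) :=
  Term.var (Sum.inr (Fin.last n))

/-- Simultaneous substitution of the terms `σ` for the free variables of `φ`. -/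
def inst {k : ℕ} (φ : L.Formula (Fin k)) (σ : Fin k → L.Term (α ⊕ Fin n)) :
    L.BoundedFormula α n :=
  BoundedFormula.relabel (n := n) (k := 0) id (BoundedFormula.subst φ σ)

@[simp]
theorem realize_up {M : Type*} [L.Structure M] (t : L.Term (α ⊕ Fin n)) (v : α → M)
    (xs : Fin n → M) (a : M) :
    (up t).realize (Sum.elim v (Fin.snoc xs a)) = t.realize (Sum.elim v xs) := by
  rw [up, Term.realize_relabel]
  congr 1
  funext i
  rcases i with i | i <;> simp

@[simp]
theorem realize_newest {M : Type*} [L.Structure M] (v : α → M) (xs : Fin n → M) (a : M) :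
    (newest : L.Term (α ⊕ Fin (n + 1))).realize (Sum.elim v (Fin.snoc xs a)) = a := by
  simp [newest]

@[simp]
theorem realize_inst {M : Type*} [L.Structure M] {k : ℕ} (φ : L.Formula (Fin k))
    (σ : Fin k → L.Term (α ⊕ Fin n)) (v : α → M) (xs : Fin n → M) :
    (inst φ σ).Realize v xs ↔ φ.Realize fun i => (σ i).realize (Sum.elim v xs) := by
  unfold inst
  refine BoundedFormula.realize_relabel.trans ?_
  rw [BoundedFormula.realize_subst, Formula.Realize]
  simp only [Fin.castAdd_zero, Fin.cast_refl, Function.comp_id]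
  exact iff_of_eq (congrArg _ (Subsingleton.elim _ _))

end General

/-! ### Languages with a domain predicate and interpretations -/

/-- Every language considered has a unary relation symbol `Dom`. -/
class HasDom (L : FirstOrder.Language) where
  dom : L.Relations 1

/-- The formula `Dom(t)`. -/
def domF {L : FirstOrder.Language} [HasDom L] {α : Type} {n : ℕ} (t : L.Term (α ⊕ Fin n)) :
    L.BoundedFormula α n :=
  (HasDom.dom : L.Relations 1).boundedFormula₁ t

/-- The sentence `∀ x, Dom(x)`. -/
def domAxiom (L : FirstOrder.Language) [HasDom L] : L.Sentence :=
  ∀' domF newest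

/-- An atomic interpretation mapping: function symbols go to terms, and relation symbols (equality
included) go to formulas, in the same free variables. -/
structure AtomicInterpretation (L₁ L₂ : FirstOrder.Language.{0, 0}) where
  func : ∀ {k : ℕ}, L₁.Functions k → L₂.Term (Fin k)
  rel : ∀ {k : ℕ}, L₁.Relations k → L₂.Formula (Fin k)
  eq : L₂.Formula (Fin 2)

namespace AtomicInterpretation

variable {L₁ L₂ : FirstOrder.Language.{0, 0}} (𝔦 : AtomicInterpretation L₁ L₂)

/-- The translation of terms. -/
def term {α : Type} : L₁.Term α → L₂.Term α
  | Term.var a => Term.var a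
  | Term.func f ts => (𝔦.func f).subst fun i => term (ts i)

/-- The translation of formulas; quantifiers are relativized to the translation of `Dom`. -/
def formula [HasDom L₁] {α : Type} : ∀ {n : ℕ}, L₁.BoundedFormula α n → L₂.BoundedFormula α n
  | _, BoundedFormula.falsum => ⊥
  | _, BoundedFormula.equal t s => inst 𝔦.eq ![𝔦.term t, 𝔦.term s]
  | _, BoundedFormula.rel R ts => inst (𝔦.rel R) fun i => 𝔦.term (ts i)
  | _, BoundedFormula.imp φ ψ => formula φ ⟹ formula ψ
  | _, BoundedFormula.all φ =>
      ∀' (inst (𝔦.rel (HasDom.dom : L₁.Relations 1)) ![newest] ⟹ formula φ)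

/-- `𝔦` defines an interpretation of `T₁` in `T₂`: the theory `T₂` proves that the translated domain
is not empty, and proves the translation of each axiom of `T₁`. By Gödel's completeness theorem
provability from `T₂` is truth in all models of `T₂`, which is Mathlib's `⊨ᵇ`. -/
def DefinesInterpretation [HasDom L₁] (T₁ : L₁.Theory) (T₂ : L₂.Theory) : Prop :=
  T₂ ⊨ᵇ (∃' inst (𝔦.rel (HasDom.dom : L₁.Relations 1)) ![newest] : L₂.Sentence) ∧
    ∀ σ ∈ T₁, T₂ ⊨ᵇ (𝔦.formula σ : L₂.Sentence)

end AtomicInterpretation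

/-! ### Bounded arithmetic with exponentiation -/

/-- Function symbols of arithmetic; `exp` is the binary `x ^ y`. -/
inductive ArithFun : ℕ → Type
  | zero : ArithFun 0
  | succ : ArithFun 1
  | add : ArithFun 2
  | mul : ArithFun 2
  | exp : ArithFun 2

inductive ArithRel : ℕ → Type
  | dom : ArithRel 1
  | lt : ArithRel 2

def arithLang : FirstOrder.Language.{0, 0} := ⟨ArithFun, ArithRel⟩

instance : HasDom arithLang := ⟨ArithRel.dom⟩

section Arithmetic

variable {α : Type} {n : ℕ}

def zeroT : arithLang.Term α := Constants.term (L := arithLang) ArithFun.zero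

def succT (t : arithLang.Term α) : arithLang.Term α :=
  Functions.apply₁ (L := arithLang) ArithFun.succ t

def addT (t s : arithLang.Term α) : arithLang.Term α :=
  Functions.apply₂ (L := arithLang) ArithFun.add t s

def mulT (t s : arithLang.Term α) : arithLang.Term α :=
  Functions.apply₂ (L := arithLang) ArithFun.mul t s

def expT (t s : arithLang.Term α) : arithLang.Term α :=
  Functions.apply₂ (L := arithLang) ArithFun.exp t s

def ltF (t s : arithLang.Term (α ⊕ Fin n)) : arithLang.BoundedFormula α n :=
  Relations.boundedFormula₂ (L := arithLang) ArithRel.lt t s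

/-- Bounded quantifier formulas: every quantifier occurs as `∀ y (y < t → φ)` or `∃ y (y < t ∧ φ)`,
where `t` is a term in which `y` does not occur. -/
inductive IsDelta0 : ∀ {n : ℕ}, arithLang.BoundedFormula α n → Prop
  | falsum {n : ℕ} : IsDelta0 (BoundedFormula.falsum (n := n))
  | equal {n : ℕ} (t s : arithLang.Term (α ⊕ Fin n)) : IsDelta0 (BoundedFormula.equal t s)
  | rel {n k : ℕ} (R : arithLang.Relations k) (ts : Fin k → arithLang.Term (α ⊕ Fin n)) :
      IsDelta0 (BoundedFormula.rel R ts)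
  | imp {n : ℕ} {φ ψ : arithLang.BoundedFormula α n} :
      IsDelta0 φ → IsDelta0 ψ → IsDelta0 (φ ⟹ ψ)
  | ball {n : ℕ} (t : arithLang.Term (α ⊕ Fin n)) {φ : arithLang.BoundedFormula α (n + 1)} :
      IsDelta0 φ → IsDelta0 (∀' (ltF newest (up t) ⟹ φ))
  | bex {n : ℕ} (t : arithLang.Term (α ⊕ Fin n)) {φ : arithLang.BoundedFormula α (n + 1)} :
      IsDelta0 φ → IsDelta0 (∃' (ltF newest (up t) ⊓ φ))

/-- The universal closure of `φ(x⃗, 0) ∧ ∀ y (φ(x⃗, y) → φ(x⃗, S y)) → ∀ y φ(x⃗, y)`. The last free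
variable of `φ` is the induction variable, the others are the parameters `x⃗`. -/
def inductionAxiom {k : ℕ} (φ : arithLang.Formula (Fin (k + 1))) : arithLang.Sentence :=
  BoundedFormula.alls
    (inst φ (Fin.snoc (α := fun _ => arithLang.Term (Empty ⊕ Fin k))
        (fun i => Term.var (Sum.inr i)) zeroT) ⊓
      (∀' (inst φ (fun i => Term.var (Sum.inr i)) ⟹
        inst φ (Fin.snoc (α := fun _ => arithLang.Term (Empty ⊕ Fin (k + 1)))
          (fun i => Term.var (Sum.inr i.castSucc)) (succT newest)))) ⟹
      ∀' inst φ fun i => Term.var (Sum.inr i))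

/-- The axioms of `IΔ₀ + exp`: the domain axiom, the defining equations of the operations, the
recursive axioms for the order, and induction for bounded quantifier formulas. -/
inductive IDelta0ExpAxiom : arithLang.Sentence → Prop
  | dom : IDelta0ExpAxiom (domAxiom arithLang)
  | succ_ne_zero : IDelta0ExpAxiom (∀' ∼(succT &0 =' zeroT))
  | succ_inj : IDelta0ExpAxiom (∀' ∀' ((succT &0 =' succT &1) ⟹ (&0 =' &1)))
  | add_zero : IDelta0ExpAxiom (∀' (addT &0 zeroT =' &0))
  | add_succ : IDelta0ExpAxiom (∀' ∀' (addT &0 (succT &1) =' succT (addT &0 &1)))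
  | mul_zero : IDelta0ExpAxiom (∀' (mulT &0 zeroT =' zeroT))
  | mul_succ : IDelta0ExpAxiom (∀' ∀' (mulT &0 (succT &1) =' addT (mulT &0 &1) &0))
  | exp_zero : IDelta0ExpAxiom (∀' (expT &0 zeroT =' succT zeroT))
  | exp_succ : IDelta0ExpAxiom (∀' ∀' (expT &0 (succT &1) =' mulT (expT &0 &1) &0))
  | not_lt_zero : IDelta0ExpAxiom (∀' ∼(ltF &0 zeroT))
  | lt_succ : IDelta0ExpAxiom (∀' ∀' (ltF &0 (succT &1) ⇔ (ltF &0 &1 ⊔ (&0 =' &1))))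
  | induction {k : ℕ} (φ : arithLang.Formula (Fin (k + 1))) (hφ : IsDelta0 φ) :
      IDelta0ExpAxiom (inductionAxiom φ)

/-- The theory `IΔ₀ + exp`. -/
def IDelta0Exp : arithLang.Theory := {σ | IDelta0ExpAxiom σ}

end Arithmetic

/-! ### The language of bounded set theory

The function symbols, the terms and the bounded quantifier formulas are defined together, because
every bounded quantifier formula gives rise to a separation symbol. `SetTerm n` and `SetForm n`
have their variables among the `n` variables `0, …, n - 1`; a quantifier in `SetForm n` binds
variable `n`. -/

inductive SetRel : ℕ → Type
  | dom : SetRel 1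
  | mem : SetRel 2

mutual

/-- Function symbols: `∅`, power set, sum set, rank, pair set, and for each bounded quantifier
formula `φ(x⃗, u)` the symbol `{u ∈ y : φ(x⃗, u)}` with arguments `x⃗, y`. -/
inductive SetFun : ℕ → Type
  | empty : SetFun 0
  | pow : SetFun 1
  | sUnion : SetFun 1
  | rank : SetFun 1
  | pair : SetFun 2
  | sep {k : ℕ} (φ : SetForm (k + 1)) : SetFun (k + 1)

inductive SetTerm : ℕ → Type
  | var {n : ℕ} (i : Fin n) : SetTerm n
  | app {n k : ℕ} (f : SetFun k) (ts : Fin k → SetTerm n) : SetTerm n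

/-- Bounded quantifier formulas; `ball t φ` is `∀ y (y ∈ t → φ)` and `bex t φ` is
`∃ y (y ∈ t ∧ φ)`, where `y` does not occur in `t`. -/
inductive SetForm : ℕ → Type
  | falsum {n : ℕ} : SetForm n
  | dom {n : ℕ} (t : SetTerm n) : SetForm n
  | mem {n : ℕ} (t s : SetTerm n) : SetForm n
  | equal {n : ℕ} (t s : SetTerm n) : SetForm n
  | imp {n : ℕ} (φ ψ : SetForm n) : SetForm n
  | ball {n : ℕ} (t : SetTerm n) (φ : SetForm (n + 1)) : SetForm n
  | bex {n : ℕ} (t : SetTerm n) (φ : SetForm (n + 1)) : SetForm n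

end

def setLang : FirstOrder.Language.{0, 0} := ⟨SetFun, SetRel⟩

instance : HasDom setLang := ⟨SetRel.dom⟩

section SetSyntax

variable {α : Type} {n : ℕ}

def emptyT : setLang.Term α := Constants.term (L := setLang) SetFun.empty

def powT (t : setLang.Term α) : setLang.Term α :=
  Functions.apply₁ (L := setLang) SetFun.pow t

def sUnionT (t : setLang.Term α) : setLang.Term α :=
  Functions.apply₁ (L := setLang) SetFun.sUnion t

def rankT (t : setLang.Term α) : setLang.Term α :=
  Functions.apply₁ (L := setLang) SetFun.rank t

def pairT (t s : setLang.Term α) : setLang.Term α :=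
  Functions.apply₂ (L := setLang) SetFun.pair t s

/-- The ordered pair `⟨t, s⟩ = {{t}, {t, s}}`. -/
def opairT (t s : setLang.Term α) : setLang.Term α :=
  pairT (pairT t t) (pairT t s)

def sepT {k : ℕ} (φ : SetForm (k + 1)) (ts : Fin (k + 1) → setLang.Term α) : setLang.Term α :=
  Term.func (L := setLang) (SetFun.sep φ) ts

def memF (t s : setLang.Term (α ⊕ Fin n)) : setLang.BoundedFormula α n :=
  Relations.boundedFormula₂ (L := setLang) SetRel.mem t s

/-- The result of substituting `σ` for the variables, as a term of `setLang`. -/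
def SetTerm.subst {k : ℕ} : SetTerm k → (Fin k → setLang.Term α) → setLang.Term α
  | SetTerm.var i, σ => σ i
  | SetTerm.app f ts, σ => Term.func (L := setLang) f fun i => (ts i).subst σ

/-- The result of substituting `σ` for the variables, as a formula of `setLang`. -/
def SetForm.subst : ∀ {k : ℕ}, SetForm k →
    ∀ {n : ℕ}, (Fin k → setLang.Term (α ⊕ Fin n)) → setLang.BoundedFormula α n
  | _, SetForm.falsum, _, _ => ⊥
  | _, SetForm.dom t, _, σ => domF (t.subst σ)
  | _, SetForm.mem t s, _, σ => memF (t.subst σ) (s.subst σ)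
  | _, SetForm.equal t s, _, σ => t.subst σ =' s.subst σ
  | _, SetForm.imp φ ψ, _, σ => φ.subst σ ⟹ ψ.subst σ
  | k, SetForm.ball t φ, n, σ =>
      ∀' (memF newest (up (t.subst σ)) ⟹
        φ.subst (Fin.snoc (α := fun _ : Fin (k + 1) => setLang.Term (α ⊕ Fin (n + 1)))
          (fun i => up (σ i)) newest))
  | k, SetForm.bex t φ, n, σ =>
      ∃' (memF newest (up (t.subst σ)) ⊓
        φ.subst (Fin.snoc (α := fun _ : Fin (k + 1) => setLang.Term (α ⊕ Fin (n + 1)))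
          (fun i => up (σ i)) newest))

/-- `t ⊆ s`. -/
def subsetF (t s : setLang.Term (α ⊕ Fin n)) : setLang.BoundedFormula α n :=
  ∀' (memF newest (up t) ⟹ memF newest (up s))

/-- `f` is a function from `a` to `b`. -/
def funF (f a b : setLang.Term (α ⊕ Fin n)) : setLang.BoundedFormula α n :=
  (∀' (memF newest (up f) ⟹ ∃' ∃' (memF (up newest) (up (up (up a))) ⊓
      (memF newest (up (up (up b))) ⊓ (up (up newest) =' opairT (up newest) newest))))) ⊓
    ∀' (memF newest (up a) ⟹ ∃' (memF (opairT (up newest) newest) (up (up f)) ⊓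
      ∀' (memF (opairT (up (up newest)) newest) (up (up (up f))) ⟹ (newest =' up newest))))

/-- The function `f` is one-one. -/
def oneOneF (f : setLang.Term (α ⊕ Fin n)) : setLang.BoundedFormula α n :=
  ∀' ∀' ∀' (memF (opairT (up (up newest)) newest) (up (up (up f))) ⟹
    (memF (opairT (up newest) newest) (up (up (up f))) ⟹ (up (up newest) =' up newest)))

/-- The function `f` is onto `b`. -/
def ontoF (f b : setLang.Term (α ⊕ Fin n)) : setLang.BoundedFormula α n :=
  ∀' (memF newest (up b) ⟹ ∃' memF (opairT newest (up newest)) (up (up f)))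

/-- `a` precedes or equals `b` in the ordering `l`. -/
def leF (l a b : setLang.Term (α ⊕ Fin n)) : setLang.BoundedFormula α n :=
  memF (opairT a b) l

/-- `b` follows immediately after `a` in the ordering `l`. -/
def nextF (l a b : setLang.Term (α ⊕ Fin n)) : setLang.BoundedFormula α n :=
  leF l a b ⊓ (∼(a =' b) ⊓ ∀' (leF (up l) (up a) newest ⟹ (leF (up l) newest (up b) ⟹
    ((newest =' up a) ⊔ (newest =' up b)))))

/-- `l` is a (reflexive) linear ordering: a set of ordered pairs that is reflexive on its field,
antisymmetric, transitive and total on its field. -/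
def linOrdF (l : setLang.Term (α ⊕ Fin n)) : setLang.BoundedFormula α n :=
  (∀' (memF newest (up l) ⟹ ∃' ∃' (up (up newest) =' opairT (up newest) newest))) ⊓
  ((∀' ∀' (leF (up (up l)) (up newest) newest ⟹
    (leF (up (up l)) (up newest) (up newest) ⊓ leF (up (up l)) newest newest))) ⊓
  ((∀' ∀' (leF (up (up l)) (up newest) newest ⟹
    (leF (up (up l)) newest (up newest) ⟹ (up newest =' newest)))) ⊓
  ((∀' ∀' ∀' (leF (up (up (up l))) (up (up newest)) (up newest) ⟹
    (leF (up (up (up l))) (up newest) newest ⟹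
      leF (up (up (up l))) (up (up newest)) newest))) ⊓
  ∀' ∀' (leF (up (up l)) (up newest) (up newest) ⟹ (leF (up (up l)) newest newest ⟹
    (leF (up (up l)) (up newest) newest ⊔ leF (up (up l)) newest (up newest)))))))

/-- `l` is a linear ordering `[V₀, …, Vₙ]` of subsets of `s` with `V₀ = ∅`, `Vₙ = s`, in which the
immediate successor of `V` is the power set of `V`. -/
def levelChainF (l s : setLang.Term (α ⊕ Fin n)) : setLang.BoundedFormula α n :=
  linOrdF l ⊓
  ((∀' (leF (up l) newest newest ⟹ subsetF newest (up s))) ⊓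
  ((leF l emptyT emptyT ⊓ ∀' (leF (up l) newest newest ⟹ leF (up l) emptyT newest)) ⊓
  ((leF l s s ⊓ ∀' (leF (up l) newest newest ⟹ leF (up l) newest (up s))) ⊓
  ∀' ∀' (nextF (up (up l)) (up newest) newest ⟹ (newest =' powT (up newest))))))

/-- `s` is a level in the cumulative hierarchy. -/
def levelF (s : setLang.Term (α ⊕ Fin n)) : setLang.BoundedFormula α n :=
  ∃' levelChainF newest (up s)

/-- The universal closure of `z ∈ {u ∈ y : φ(x⃗, u)} ↔ z ∈ y ∧ φ(x⃗, z)`. In the matrix, the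
variables `x⃗` are the first `k` ones, `y` is number `k` and `z` is number `k + 1`. -/
def separationAxiom {k : ℕ} (φ : SetForm (k + 1)) : setLang.Sentence :=
  BoundedFormula.alls (n := k) (∀' ∀'
    (memF newest (sepT φ (Fin.snoc (α := fun _ => setLang.Term (Empty ⊕ Fin (k + 1 + 1)))
        (fun i => Term.var (Sum.inr i.castSucc.castSucc)) (up newest))) ⇔
      (memF newest (up newest) ⊓
        φ.subst (Fin.snoc (α := fun _ => setLang.Term (Empty ⊕ Fin (k + 1 + 1)))
          (fun i => Term.var (Sum.inr i.castSucc.castSucc)) newest))))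

/-- The axioms of `EA*`. -/
inductive EAstarAxiom : setLang.Sentence → Prop
  | dom : EAstarAxiom (domAxiom setLang)
  | extensionality : EAstarAxiom (∀' ∀' ((∀' (memF &2 &0 ⇔ memF &2 &1)) ⟹ (&0 =' &1)))
  | empty : EAstarAxiom (∀' ∼(memF &0 emptyT))
  | pair : EAstarAxiom (∀' ∀' ∀' (memF &2 (pairT &0 &1) ⇔ ((&2 =' &0) ⊔ (&2 =' &1))))
  | sUnion : EAstarAxiom (∀' ∀' (memF &1 (sUnionT &0) ⇔ ∃' (memF &2 &0 ⊓ memF &1 &2)))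
  | pow : EAstarAxiom (∀' ∀' (memF &1 (powT &0) ⇔ subsetF &1 &0))
  | foundation : EAstarAxiom (∀' ((∃' memF &1 &0) ⟹
      ∃' (memF &1 &0 ⊓ ∀' (memF &2 &1 ⟹ ∼(memF &2 &0)))))
  | separation {k : ℕ} (φ : SetForm (k + 1)) : EAstarAxiom (separationAxiom φ)
  | dedekindFiniteness : EAstarAxiom (∀' ∀' ((funF &1 &0 &0 ⊓ oneOneF &1) ⟹ ontoF &1 &0))
  | weakHierarchy : EAstarAxiom (∀' (memF &0 (rankT &0) ⊓ (levelF (rankT &0) ⊓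
      ∀' ((memF &0 &1 ⊓ levelF &1) ⟹ subsetF (rankT &0) &1))))

/-- The theory `EA*`. -/
def EAstar : setLang.Theory := {σ | EAstarAxiom σ}

end SetSyntax

/-! ### Notions inside a structure for the language of sets

Everything below is internal: it only speaks about elements of `M` and its membership relation. -/

section Semantics

variable {M : Type*} [setLang.Structure M]

def Mem (a b : M) : Prop := Structure.RelMap (L := setLang) SetRel.mem ![a, b]

variable (M) in
def emp : M := Structure.funMap (L := setLang) SetFun.empty ![]

/-- The power set of `a`. -/
def pow (a : M) : M := Structure.funMap (L := setLang) SetFun.pow ![a]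

/-- The first level of the cumulative hierarchy at which `a` occurs. -/
def rk (a : M) : M := Structure.funMap (L := setLang) SetFun.rank ![a]

/-- The pair set `{a, b}`. -/
def upair (a b : M) : M := Structure.funMap (L := setLang) SetFun.pair ![a, b]

/-- The ordered pair `⟨a, b⟩`. -/
def opair (a b : M) : M := upair (upair a a) (upair a b)

def Sub (a b : M) : Prop := ∀ z, Mem z a → Mem z b

/-- `a` precedes or equals `b` in the ordering `l`. -/
def Le (l a b : M) : Prop := Mem (opair a b) l

/-- `a` belongs to the field of the (reflexive) ordering `l`. -/
def InField (l a : M) : Prop := Le l a a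

/-- `b` follows immediately after `a` in the ordering `l`. -/
def Next (l a b : M) : Prop := Le l a b ∧ a ≠ b ∧ ∀ c, Le l a c → Le l c b → c = a ∨ c = b

/-- `l` is a linear ordering. -/
structure IsLinOrd (l : M) : Prop where
  pairs : ∀ p, Mem p l → ∃ a b, p = opair a b
  field : ∀ a b, Le l a b → InField l a ∧ InField l b
  antisymm : ∀ a b, Le l a b → Le l b a → a = b
  trans : ∀ a b c, Le l a b → Le l b c → Le l a c
  total : ∀ a b, InField l a → InField l b → Le l a b ∨ Le l b a

/-- `l` is a linear ordering `[V₀, …, Vₙ]` witnessing that `s` is a level. -/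
structure IsLevelChain (l s : M) : Prop where
  linOrd : IsLinOrd l
  sub : ∀ a, InField l a → Sub a s
  first : InField l (emp M) ∧ ∀ a, InField l a → Le l (emp M) a
  last : InField l s ∧ ∀ a, InField l a → Le l a s
  next : ∀ a b, Next l a b → b = pow a

/-- `s` is a level in the cumulative hierarchy. -/
def IsLevel (s : M) : Prop := ∃ l, IsLevelChain l s

/-- `l'` is the lexicographical ordering `Lex(l)` of the power set of the field of `l`: for
`X, Y ⊆ Field(l)`, `X` comes before `Y` iff the `l`-greatest element of the symmetric difference
of `X` and `Y` is in `Y`. -/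
def IsLex (l l' : M) : Prop :=
  (∀ p, Mem p l' → ∃ X Y, p = opair X Y) ∧
    ∀ X Y, Le l' X Y ↔
      (∀ z, Mem z X → InField l z) ∧ (∀ z, Mem z Y → InField l z) ∧
        (X = Y ∨ ∃ m, Mem m Y ∧ ¬ Mem m X ∧ ∀ c, ¬ (Mem c X ↔ Mem c Y) → Le l c m)

/-- `A` is the local function `Ack` along the chain `c = [V₀, …, s]`: its values are linear
orderings contained in `s × s`, the value at `V₀` is the empty ordering, and the value at `Vₖ₊₁` is
`Lex` of the value at `Vₖ`. -/
structure IsAckFun (c s A : M) : Prop where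
  pairs : ∀ p, Mem p A → ∃ V l, p = opair V l
  dom : ∀ V, InField c V ↔ ∃ l, Mem (opair V l) A
  unique : ∀ V l l', Mem (opair V l) A → Mem (opair V l') A → l = l'
  values : ∀ V l, Mem (opair V l) A → IsLinOrd l ∧ ∀ a, InField l a → Mem a s
  zero : Mem (opair (emp M) (emp M)) A
  succ : ∀ V W l l', Next c V W → Mem (opair V l) A → Mem (opair W l') A → IsLex l l'

/-- `l = Ack(s)`, where `s` is a level. -/
def IsAck (s l : M) : Prop := ∃ c A, IsLevelChain c s ∧ IsAckFun c s A ∧ Mem (opair s l) A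

/-- The relation `x <ₐ y`: `R(x) ⊆ R(y)` and `x` strictly precedes `y` in `Ack(R(y))`. -/
def LtA (x y : M) : Prop := Sub (rk x) (rk y) ∧ ∃ l, IsAck (rk y) l ∧ Le l x y ∧ x ≠ y

/-- `z` is the element of `Ack(P(R(x)))` that follows immediately after `x`. -/
def IsSuccA (x z : M) : Prop := ∃ l, IsAck (pow (rk x)) l ∧ Next l x z

/-- `f` is a function from `a` to `b`. -/
def IsFun (f a b : M) : Prop :=
  (∀ p, Mem p f → ∃ u v, Mem u a ∧ Mem v b ∧ p = opair u v) ∧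
    ∀ u, Mem u a → ∃ v, Mem (opair u v) f ∧ ∀ w, Mem (opair u w) f → w = v

def IsOneOne (f : M) : Prop :=
  ∀ u u' v, Mem (opair u v) f → Mem (opair u' v) f → u = u'

def IsOnto (f b : M) : Prop := ∀ v, Mem v b → ∃ u, Mem (opair u v) f

/-- `a ≤_c b`: there is an injection from `a` into `b`. -/
def CardLe (a b : M) : Prop := ∃ f, IsFun f a b ∧ IsOneOne f

/-- `a ≃_c b`. -/
def CardEq (a b : M) : Prop := CardLe a b ∧ CardLe b a

/-- `d = (a × {∅}) ∪ (b × {{∅}})`. -/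
def IsCardSum (a b d : M) : Prop :=
  ∀ p, Mem p d ↔ (∃ u, Mem u a ∧ p = opair u (emp M)) ∨
    ∃ u, Mem u b ∧ p = opair u (upair (emp M) (emp M))

/-- `d = a × b`. -/
def IsCardProd (a b d : M) : Prop :=
  ∀ p, Mem p d ↔ ∃ u v, Mem u a ∧ Mem v b ∧ p = opair u v

/-- `d` is the set of all functions from `b` to `a`. -/
def IsCardExp (a b d : M) : Prop := ∀ f, Mem f d ↔ IsFun f b a

/-- `s` is the field of the segment `[{∅}, …, x]` of the ordering `l`. -/
def IsSegment (l x s : M) : Prop :=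
  ∀ w, Mem w s ↔ Le l (upair (emp M) (emp M)) w ∧ Le l w x

/-- `m` is the greater of `x` and `y` with respect to `<ₐ`. -/
def IsMaxA (x y m : M) : Prop := (m = y ∧ (LtA x y ∨ x = y)) ∨ (m = x ∧ LtA y x)

/-- `z` is an element of `Ack(s)` for which the segment `[{∅}, …, z]` has the cardinality that the
cardinal operation `op` assigns to the segments `[{∅}, …, x]` and `[{∅}, …, y]` of `Ack(s)`. -/
def IsCardOpA (op : M → M → M → Prop) (s x y z : M) : Prop :=
  ∃ l, IsAck s l ∧ InField l z ∧ ∃ sx sy sz d,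
    IsSegment l x sx ∧ IsSegment l y sy ∧ IsSegment l z sz ∧ op sx sy d ∧ CardEq d sz

/-- `z = x +ₐ y`, computed in `Ack(P(R(max(x, y))))`. -/
def IsAddA (x y z : M) : Prop :=
  ∃ m, IsMaxA x y m ∧ IsCardOpA IsCardSum (pow (rk m)) x y z

/-- `z = x ×ₐ y`, computed in `Ack(P(R(max(x, y))))`. -/
def IsMulA (x y z : M) : Prop :=
  ∃ m, IsMaxA x y m ∧ IsCardOpA IsCardProd (pow (rk m)) x y z

/-- `z = Expₐ(x, y)`, computed in `Ack(P(P(R(max(x, y)))))`; one more power set is taken because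
`x ^ y` need not lie below the end of `Ack(P(R(max(x, y))))`. -/
def IsExpA (x y z : M) : Prop :=
  ∃ m, IsMaxA x y m ∧ IsCardOpA IsCardExp (pow (pow (rk m))) x y z

/-- The element satisfying `p`, when there is a unique one. -/
noncomputable def the (p : M → Prop) : M := @Classical.epsilon M ⟨emp M⟩ p

variable (M) in
/-- The structure `⟨V, 0ₐ, <ₐ, Sₐ, +ₐ, ×ₐ, Expₐ⟩` for the language of arithmetic. -/
@[reducible] noncomputable def ackStructure : arithLang.Structure M where
  funMap := fun {_} f => match f with
    | ArithFun.zero => fun _ => emp M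
    | ArithFun.succ => fun a => the (IsSuccA (a 0))
    | ArithFun.add => fun a => the (IsAddA (a 0) (a 1))
    | ArithFun.mul => fun a => the (IsMulA (a 0) (a 1))
    | ArithFun.exp => fun a => the (IsExpA (a 0) (a 1))
  RelMap := fun {_} R => match R with
    | ArithRel.dom => fun a => Structure.RelMap (L := setLang) SetRel.dom a
    | ArithRel.lt => fun a => LtA (a 0) (a 1)

end Semantics

/-- `𝔡` is the interpretation mapping that sends `Dom(x)` to `Dom(x)`, `x = y` to `x = y`, `0` to
`∅`, `x < y` to a formula for `x <ₐ y`, and `S(x)`, `x + y`, `x · y`, `Exp(x, y)` to terms for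
`Sₐ(x)`, `x +ₐ y`, `x ×ₐ y`, `Expₐ(x, y)`. The formula and the terms are identified by what they
denote in the models of `EA*`, that is, up to provable equivalence in `EA*`. -/
structure IsMappingD (𝔡 : AtomicInterpretation arithLang setLang) : Prop where
  dom : 𝔡.rel ArithRel.dom = Relations.formula₁ (L := setLang) SetRel.dom (Term.var 0)
  eq : 𝔡.eq = Term.equal (Term.var 0) (Term.var 1)
  zero : 𝔡.func ArithFun.zero = emptyT
  lt : ∀ (M : Type) [setLang.Structure M] [M ⊨ EAstar] (x y : M),
    (𝔡.rel ArithRel.lt).Realize ![x, y] ↔ LtA x y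
  succ : ∀ (M : Type) [setLang.Structure M] [M ⊨ EAstar] (x : M),
    IsSuccA x ((𝔡.func ArithFun.succ).realize ![x])
  add : ∀ (M : Type) [setLang.Structure M] [M ⊨ EAstar] (x y : M),
    IsAddA x y ((𝔡.func ArithFun.add).realize ![x, y])
  mul : ∀ (M : Type) [setLang.Structure M] [M ⊨ EAstar] (x y : M),
    IsMulA x y ((𝔡.func ArithFun.mul).realize ![x, y])
  exp : ∀ (M : Type) [setLang.Structure M] [M ⊨ EAstar] (x y : M),
    IsExpA x y ((𝔡.func ArithFun.exp).realize ![x, y])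

end BoundedTheories

open BoundedTheories

/-!
The axioms of `EA*` allow separation for bounded quantifier formulas only, so every set formed in the
proof has to be cut out of a given set by a bounded formula. The type classes `BddFun` and `BddRel`
record which functions and relations on a model are given by terms and by bounded quantifier
formulas, with parameters; instance resolution verifies this for each set that is formed.

The first step turns Dedekind finiteness into induction over finite sets (`fin_induction`). If a set
`X` could not be reached from `∅` by adjoining elements of `X` one at a time, then adjoining one more
element would be a one-one map from the set of equinumerosity classes of the reachable subsets of `X`
to itself, and it would miss the class of `∅`. This needs no choice. It follows that bounded total
preorders have greatest and least elements on every nonempty set (`exists_greatest`). Hence chains of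
levels can be used for induction, levels are transitive, and any two levels are comparable.

The second step replaces the recursion that defines `Ack` by a fixed point property: on a level `s`,
`Ack(s)` is the only relation `l` on `s` for which `X ≤ Y` holds iff `X = Y` or the `l`-greatest element
of the symmetric difference is in `Y` (`IsAckOrd`). Existence, uniqueness and linearity are proved by
induction on levels. By uniqueness the orderings of the levels are restrictions of a single ordering
`LeA` of the universe, in which every level is an initial segment (`LeA.mem_level`); `isAck_iff` says
that `Ack(s)` is its restriction to `s`. The relation `LeA` is bounded since it can be evaluated in
`R({x, y})`.

The third step identifies the elements of this ordering with cardinals. The segment of the nonempty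
sets up to `x` is written `seg x`. By finiteness `x` is determined by the cardinality of `seg x`
(`seg_inj`), and every set that injects into the nonempty elements of a level has the cardinality of
some `seg z` (`exists_cardEq_seg`). Explicit injections into the next level, or the second next one
for powers, show that the operations are total; their recursion equations are the corresponding
equinumerosities of disjoint unions, products and sets of functions. A bounded quantifier formula of
arithmetic defines a bounded relation, because what lies below `t` belongs to `R(t)`
(`IsDelta0.bddRel`), and induction for it holds because a set of counterexamples has a least element
(`ack_induction`).

All definitions are given by terms and formulas that do not depend on the model, which yields the
mapping `ackMapping`. For any admissible mapping, the translation of a sentence holds in a model of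
`EA*` iff the sentence holds in the arithmetical structure of that model
(`IsMappingD.realize_formula`).
-/

namespace BoundedTheories

universe u

/-! ### Semantics of the bounded language -/

section SyntaxSemantics

/-- The extension of a renaming to one more variable, which is fixed. -/
def liftRen {n m : ℕ} (ρ : Fin n → Fin m) : Fin (n + 1) → Fin (m + 1) :=
  Fin.snoc (α := fun _ => Fin (m + 1)) (fun i => (ρ i).castSucc) (Fin.last m)

theorem snoc_comp_liftRen {M : Type*} {n m : ℕ} (ρ : Fin n → Fin m) (v : Fin m → M) (y : M) :
    Fin.snoc (α := fun _ => M) v y ∘ liftRen ρ = Fin.snoc (α := fun _ => M) (v ∘ ρ) y := by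
  funext i
  refine Fin.lastCases ?_ (fun i => ?_) i <;> simp [liftRen]

variable {M : Type*} [setLang.Structure M]

/-- The value of a set-theoretic term under an assignment. -/
def SetTerm.ev : ∀ {n : ℕ}, SetTerm n → (Fin n → M) → M
  | _, SetTerm.var i, v => v i
  | _, SetTerm.app f ts, v => Structure.funMap (L := setLang) f fun i => (ts i).ev v

/-- Satisfaction of a bounded quantifier formula under an assignment. -/
def SetForm.Real : ∀ {n : ℕ}, SetForm n → (Fin n → M) → Prop
  | _, SetForm.falsum, _ => False
  | _, SetForm.dom t, v => Structure.RelMap (L := setLang) SetRel.dom ![t.ev v]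
  | _, SetForm.mem t s, v => Mem (t.ev v) (s.ev v)
  | _, SetForm.equal t s, v => t.ev v = s.ev v
  | _, SetForm.imp φ ψ, v => φ.Real v → ψ.Real v
  | _, SetForm.ball t φ, v => ∀ y, Mem y (t.ev v) → φ.Real (Fin.snoc (α := fun _ => M) v y)
  | _, SetForm.bex t φ, v => ∃ y, Mem y (t.ev v) ∧ φ.Real (Fin.snoc (α := fun _ => M) v y)

theorem SetTerm.realize_subst {α : Type} (w : α → M) :
    ∀ {k : ℕ} (t : SetTerm k) (σ : Fin k → setLang.Term α),
      (t.subst σ).realize w = t.ev fun i => (σ i).realize w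
  | _, SetTerm.var _, _ => rfl
  | _, SetTerm.app f ts, σ => by
      simp only [SetTerm.subst, Term.realize, SetTerm.ev]
      congr 1
      funext i
      exact (ts i).realize_subst w σ

theorem realize_domF {α : Type} {n : ℕ} (t : setLang.Term (α ⊕ Fin n)) (v : α → M)
    (xs : Fin n → M) : (domF t).Realize v xs ↔
      Structure.RelMap (L := setLang) SetRel.dom ![t.realize (Sum.elim v xs)] :=
  BoundedFormula.realize_rel₁

@[simp]
theorem realize_memF {α : Type} {n : ℕ} (t s : setLang.Term (α ⊕ Fin n)) (v : α → M)
    (xs : Fin n → M) : (memF t s).Realize v xs ↔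
      Mem (t.realize (Sum.elim v xs)) (s.realize (Sum.elim v xs)) :=
  BoundedFormula.realize_rel₂

theorem snoc_realize {α : Type} {k n : ℕ} (σ : Fin k → setLang.Term (α ⊕ Fin n)) (v : α → M)
    (xs : Fin n → M) (y : M) :
    (fun i => Term.realize (Sum.elim v (Fin.snoc xs y))
      (Fin.snoc (α := fun _ : Fin (k + 1) => setLang.Term (α ⊕ Fin (n + 1)))
        (fun i => up (σ i)) newest i)) =
    Fin.snoc (α := fun _ => M) (fun i => (σ i).realize (Sum.elim v xs)) y := by
  funext i
  refine Fin.lastCases ?_ (fun i => ?_) i <;> simp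

theorem SetForm.realize_subst {α : Type} (v : α → M) :
    ∀ {k : ℕ} (φ : SetForm k) {n : ℕ} (σ : Fin k → setLang.Term (α ⊕ Fin n)) (xs : Fin n → M),
      (φ.subst σ).Realize v xs ↔ φ.Real fun i => (σ i).realize (Sum.elim v xs)
  | _, SetForm.falsum, _, _, _ => Iff.rfl
  | _, SetForm.dom t, _, σ, xs => by
      simp only [SetForm.subst, SetForm.Real, realize_domF, SetTerm.realize_subst]
  | _, SetForm.mem t s, _, σ, xs => by
      simp only [SetForm.subst, SetForm.Real, realize_memF, SetTerm.realize_subst]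
  | _, SetForm.equal t s, _, σ, xs => by
      simp only [SetForm.subst, SetForm.Real, BoundedFormula.realize_bdEqual,
        SetTerm.realize_subst]
  | _, SetForm.imp φ ψ, _, σ, xs => by
      simp only [SetForm.subst, SetForm.Real, BoundedFormula.realize_imp,
        φ.realize_subst v σ xs, ψ.realize_subst v σ xs]
  | _, SetForm.ball t φ, _, σ, xs => by
      simp only [SetForm.subst, SetForm.Real, BoundedFormula.realize_all,
        BoundedFormula.realize_imp, realize_memF, realize_newest, realize_up,
        SetTerm.realize_subst, φ.realize_subst v, snoc_realize]
  | _, SetForm.bex t φ, _, σ, xs => by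
      simp only [SetForm.subst, SetForm.Real, BoundedFormula.realize_ex,
        BoundedFormula.realize_inf, realize_memF, realize_newest, realize_up,
        SetTerm.realize_subst, φ.realize_subst v, snoc_realize]

/-- Weakening of a term to a context with one more variable. -/
def SetTerm.wk : ∀ {n : ℕ}, SetTerm n → SetTerm (n + 1)
  | _, SetTerm.var i => SetTerm.var i.castSucc
  | _, SetTerm.app f ts => SetTerm.app f fun i => (ts i).wk

@[simp]
theorem SetTerm.ev_wk : ∀ {n : ℕ} (t : SetTerm n) (v : Fin n → M) (y : M),
    t.wk.ev (Fin.snoc (α := fun _ => M) v y) = t.ev v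
  | _, SetTerm.var i, v, y => by simp [SetTerm.wk, SetTerm.ev]
  | _, SetTerm.app f ts, v, y => by
      simp only [SetTerm.wk, SetTerm.ev]
      congr 1
      funext i
      exact (ts i).ev_wk v y

/-- Renaming of the variables of a term. -/
def SetTerm.ren {m : ℕ} : ∀ {n : ℕ}, SetTerm n → (Fin n → Fin m) → SetTerm m
  | _, SetTerm.var i, ρ => SetTerm.var (ρ i)
  | _, SetTerm.app f ts, ρ => SetTerm.app f fun i => (ts i).ren ρ

theorem SetTerm.ev_ren {m : ℕ} : ∀ {n : ℕ} (t : SetTerm n) (ρ : Fin n → Fin m) (v : Fin m → M),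
    (t.ren ρ).ev v = t.ev (v ∘ ρ)
  | _, SetTerm.var i, ρ, v => rfl
  | _, SetTerm.app f ts, ρ, v => by
      simp only [SetTerm.ren, SetTerm.ev]
      congr 1
      funext i
      exact (ts i).ev_ren ρ v

/-- Renaming of the free variables of a bounded quantifier formula. -/
def SetForm.ren : ∀ {n m : ℕ}, SetForm n → (Fin n → Fin m) → SetForm m
  | _, _, SetForm.falsum, _ => SetForm.falsum
  | _, _, SetForm.dom t, ρ => SetForm.dom (t.ren ρ)
  | _, _, SetForm.mem t s, ρ => SetForm.mem (t.ren ρ) (s.ren ρ)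
  | _, _, SetForm.equal t s, ρ => SetForm.equal (t.ren ρ) (s.ren ρ)
  | _, _, SetForm.imp φ ψ, ρ => SetForm.imp (φ.ren ρ) (ψ.ren ρ)
  | _, _, SetForm.ball t φ, ρ => SetForm.ball (t.ren ρ) (φ.ren (liftRen ρ))
  | _, _, SetForm.bex t φ, ρ => SetForm.bex (t.ren ρ) (φ.ren (liftRen ρ))

theorem SetForm.real_ren : ∀ {n m : ℕ} (φ : SetForm n) (ρ : Fin n → Fin m) (v : Fin m → M),
    (φ.ren ρ).Real v ↔ φ.Real (v ∘ ρ)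
  | _, _, SetForm.falsum, _, _ => Iff.rfl
  | _, _, SetForm.dom t, ρ, v => by simp only [SetForm.ren, SetForm.Real, SetTerm.ev_ren]
  | _, _, SetForm.mem t s, ρ, v => by simp only [SetForm.ren, SetForm.Real, SetTerm.ev_ren]
  | _, _, SetForm.equal t s, ρ, v => by simp only [SetForm.ren, SetForm.Real, SetTerm.ev_ren]
  | _, _, SetForm.imp φ ψ, ρ, v => by
      simp only [SetForm.ren, SetForm.Real, φ.real_ren ρ v, ψ.real_ren ρ v]
  | _, _, SetForm.ball t φ, ρ, v => by
      simp only [SetForm.ren, SetForm.Real, SetTerm.ev_ren, φ.real_ren, snoc_comp_liftRen]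
  | _, _, SetForm.bex t φ, ρ, v => by
      simp only [SetForm.ren, SetForm.Real, SetTerm.ev_ren, φ.real_ren, snoc_comp_liftRen]

end SyntaxSemantics

/-! ### The axioms of `EA*` in a model -/

section Axioms

variable {M : Type*} [setLang.Structure M]

infix:50 " ε " => Mem

/-- The sum set of `a`. -/
def sUn (a : M) : M := Structure.funMap (L := setLang) SetFun.sUnion ![a]

section RealizeTerms

variable {α : Type} (w : α → M)

@[simp] theorem realize_emptyT : (emptyT : setLang.Term α).realize w = emp M :=
  (Term.realize_constants (L := setLang)).trans
    (congrArg (Structure.funMap (L := setLang) SetFun.empty) (Subsingleton.elim _ _))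
@[simp] theorem realize_powT (t : setLang.Term α) : (powT t).realize w = pow (t.realize w) :=
  Term.realize_functions_apply₁
@[simp] theorem realize_sUnionT (t : setLang.Term α) :
    (sUnionT t).realize w = sUn (t.realize w) :=
  Term.realize_functions_apply₁
@[simp] theorem realize_rankT (t : setLang.Term α) : (rankT t).realize w = rk (t.realize w) :=
  Term.realize_functions_apply₁
@[simp] theorem realize_pairT (t s : setLang.Term α) :
    (pairT t s).realize w = upair (t.realize w) (s.realize w) :=
  Term.realize_functions_apply₂
@[simp] theorem realize_opairT (t s : setLang.Term α) :
    (opairT t s).realize w = opair (t.realize w) (s.realize w) := by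
  simp [opairT, opair]

end RealizeTerms

section RealizeFormulas

variable {α : Type} {n : ℕ} (v : α → M) (xs : Fin n → M)

@[simp] theorem realize_subsetF (t s : setLang.Term (α ⊕ Fin n)) :
    (subsetF t s).Realize v xs ↔
      Sub (t.realize (Sum.elim v xs)) (s.realize (Sum.elim v xs)) := by
  simp [subsetF, Sub]

@[simp] theorem realize_funF (f a b : setLang.Term (α ⊕ Fin n)) :
    (funF f a b).Realize v xs ↔ IsFun (f.realize (Sum.elim v xs)) (a.realize (Sum.elim v xs))
      (b.realize (Sum.elim v xs)) := by
  simp [funF, IsFun]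

@[simp] theorem realize_oneOneF (f : setLang.Term (α ⊕ Fin n)) :
    (oneOneF f).Realize v xs ↔ IsOneOne (f.realize (Sum.elim v xs)) := by
  simp [oneOneF, IsOneOne]

@[simp] theorem realize_ontoF (f b : setLang.Term (α ⊕ Fin n)) :
    (ontoF f b).Realize v xs ↔
      IsOnto (f.realize (Sum.elim v xs)) (b.realize (Sum.elim v xs)) := by
  simp [ontoF, IsOnto]

@[simp] theorem realize_leF (l a b : setLang.Term (α ⊕ Fin n)) :
    (leF l a b).Realize v xs ↔ Le (l.realize (Sum.elim v xs)) (a.realize (Sum.elim v xs))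
      (b.realize (Sum.elim v xs)) := by
  simp [leF, Le]

@[simp] theorem realize_nextF (l a b : setLang.Term (α ⊕ Fin n)) :
    (nextF l a b).Realize v xs ↔ Next (l.realize (Sum.elim v xs)) (a.realize (Sum.elim v xs))
      (b.realize (Sum.elim v xs)) := by
  simp [nextF, Next]

@[simp] theorem realize_linOrdF (l : setLang.Term (α ⊕ Fin n)) :
    (linOrdF l).Realize v xs ↔ IsLinOrd (l.realize (Sum.elim v xs)) := by
  simp only [linOrdF, BoundedFormula.realize_inf, BoundedFormula.realize_all,
    BoundedFormula.realize_imp, BoundedFormula.realize_ex, BoundedFormula.realize_sup,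
    realize_memF, realize_newest, realize_up, realize_leF, realize_opairT,
    BoundedFormula.realize_bdEqual]
  exact ⟨fun ⟨h1, h2, h3, h4, h5⟩ => ⟨h1, h2, h3, h4, h5⟩,
    fun ⟨h1, h2, h3, h4, h5⟩ => ⟨h1, h2, h3, h4, h5⟩⟩

@[simp] theorem realize_levelF (s : setLang.Term (α ⊕ Fin n)) :
    (levelF s).Realize v xs ↔ IsLevel (s.realize (Sum.elim v xs)) := by
  simp only [levelF, levelChainF, BoundedFormula.realize_inf, BoundedFormula.realize_all,
    BoundedFormula.realize_imp, BoundedFormula.realize_ex, realize_linOrdF, realize_subsetF,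
    realize_newest, realize_up, realize_leF, realize_nextF, realize_powT, realize_emptyT,
    BoundedFormula.realize_bdEqual]
  exact ⟨fun ⟨c, h1, h2, h3, h4, h5⟩ => ⟨c, h1, h2, h3, h4, h5⟩,
    fun ⟨c, h1, h2, h3, h4, h5⟩ => ⟨c, h1, h2, h3, h4, h5⟩⟩

end RealizeFormulas

variable [M ⊨ EAstar]

theorem realize_axiom {σ : setLang.Sentence} (h : EAstarAxiom σ) :
    BoundedFormula.Realize σ (default : Empty → M) default :=
  Theory.realize_sentence_of_mem EAstar h

theorem dom_all (x : M) : Structure.RelMap (L := setLang) SetRel.dom ![x] := by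
  have h := realize_axiom (M := M) EAstarAxiom.dom
  simp only [domAxiom, BoundedFormula.realize_all] at h
  simpa using (realize_domF _ _ _).1 (h x)

theorem set_ext {a b : M} (h : ∀ z, z ε a ↔ z ε b) : a = b := by
  have H := realize_axiom (M := M) EAstarAxiom.extensionality
  simp [Fin.snoc] at H
  exact H a b h

@[simp] theorem not_mem_emp (a : M) : ¬ a ε emp M := by
  have H := realize_axiom (M := M) EAstarAxiom.empty
  simp [Fin.snoc] at H
  exact H a

@[simp] theorem mem_upair {z a b : M} : z ε upair a b ↔ z = a ∨ z = b := by
  have H := realize_axiom (M := M) EAstarAxiom.pair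
  simp [Fin.snoc] at H
  exact H a b z

@[simp] theorem mem_sUn {z a : M} : z ε sUn a ↔ ∃ y, y ε a ∧ z ε y := by
  have H := realize_axiom (M := M) EAstarAxiom.sUnion
  simp [Fin.snoc] at H
  exact H a z

@[simp] theorem mem_pow {z a : M} : z ε pow a ↔ Sub z a := by
  have H := realize_axiom (M := M) EAstarAxiom.pow
  simp [Fin.snoc] at H
  exact H a z

theorem foundation {x : M} (h : ∃ y, y ε x) : ∃ y, y ε x ∧ ∀ z, z ε y → ¬ z ε x := by
  have H := realize_axiom (M := M) EAstarAxiom.foundation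
  simp [Fin.snoc] at H
  obtain ⟨y, hy⟩ := h
  exact H x y hy

theorem dedekind {f x : M} (h : IsFun f x x) (h1 : IsOneOne f) : IsOnto f x := by
  have H := realize_axiom (M := M) EAstarAxiom.dedekindFiniteness
  simp [Fin.snoc] at H
  exact H x f h h1

theorem mem_rk (x : M) : x ε rk x := by
  have H := realize_axiom (M := M) EAstarAxiom.weakHierarchy
  simp [Fin.snoc] at H
  exact (H x).1

theorem isLevel_rk (x : M) : IsLevel (rk x) := by
  have H := realize_axiom (M := M) EAstarAxiom.weakHierarchy
  simp [Fin.snoc] at H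
  exact (H x).2.1

theorem rk_sub {x s : M} (hx : x ε s) (hs : IsLevel s) : Sub (rk x) s := by
  have H := realize_axiom (M := M) EAstarAxiom.weakHierarchy
  simp [Fin.snoc] at H
  exact (H x).2.2 s hx hs

/-- The term `{u ∈ y : φ(x⃗, u)}`, where `x⃗` are all the variables of the context. -/
def SetTerm.sep {n : ℕ} (y : SetTerm n) (φ : SetForm (n + 1)) : SetTerm n :=
  SetTerm.app (SetFun.sep φ) (Fin.snoc (α := fun _ => SetTerm n) SetTerm.var y)

@[simp] theorem mem_ev_sep {n : ℕ} {y : SetTerm n} {φ : SetForm (n + 1)} {v : Fin n → M} {z : M} :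
    z ε (y.sep φ).ev v ↔ z ε y.ev v ∧ φ.Real (Fin.snoc (α := fun _ => M) v z) := by
  have H := BoundedFormula.realize_alls.1 (realize_axiom (M := M) (EAstarAxiom.separation φ))
  simp only [BoundedFormula.realize_all,
    BoundedFormula.realize_iff, BoundedFormula.realize_inf, realize_memF, realize_newest,
    realize_up, SetForm.realize_subst] at H
  convert H v (y.ev v) z using 2
  · simp only [SetTerm.sep, SetTerm.ev, sepT, Term.realize]
    congr 1
    funext i
    refine Fin.lastCases ?_ (fun i => ?_) i <;> simp [SetTerm.ev]
  · refine iff_of_eq (congrArg _ (funext fun i => ?_))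
    refine Fin.lastCases ?_ (fun i => ?_) i <;> simp

end Axioms

/-! ### Functions and relations defined by terms and bounded formulas with parameters -/


section Bounded

/-- A context of finitely many variables ranging over `M`. Contexts are built from `PUnit` by
adjoining variables on the right, so that binding a variable is passing from `Γ` to `Γ × M`. -/
class Ctx (M Γ : Type u) where
  n : ℕ
  val : Γ → Fin n → M

instance (M : Type u) : Ctx M PUnit.{u + 1} := ⟨0, fun _ => Fin.elim0⟩

instance (M Γ : Type u) [c : Ctx M Γ] : Ctx M (Γ × M) :=
  ⟨c.n + 1, fun p => Fin.snoc (α := fun _ => M) (c.val p.1) p.2⟩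

variable {M : Type u} [setLang.Structure M] {Γ : Type u} [Ctx M Γ]

/-- `f` is given by a term with the parameters `c`. -/
def FunCode {k : ℕ} (c : Fin k → M) (f : Γ → M) : Prop :=
  ∃ t : SetTerm (k + Ctx.n M Γ), ∀ g, f g = t.ev (Fin.append c (Ctx.val g))

/-- `P` is given by a bounded quantifier formula with the parameters `c`. -/
def RelCode {k : ℕ} (c : Fin k → M) (P : Γ → Prop) : Prop :=
  ∃ φ : SetForm (k + Ctx.n M Γ), ∀ g, P g ↔ φ.Real (Fin.append c (Ctx.val g))

/-- `f` is given by a term with parameters from `M`. -/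
class BddFun (f : Γ → M) : Prop where
  out : ∃ (k : ℕ) (c : Fin k → M), FunCode c f

variable (M) in
/-- `P` is given by a bounded quantifier formula with parameters from `M`. -/
class BddRel (P : Γ → Prop) : Prop where
  out : ∃ (k : ℕ) (c : Fin k → M), RelCode c P

theorem append_comp_append {M : Type*} {k l m : ℕ} (c : Fin k → M) (d : Fin l → M) (v : Fin m → M)
    (ρ : Fin k → Fin l) (h : d ∘ ρ = c) :
    Fin.append d v ∘ Fin.append (fun i => Fin.castAdd m (ρ i)) (Fin.natAdd l) =
      Fin.append c v := by
  subst h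
  funext i
  refine Fin.addCases (fun i => ?_) (fun i => ?_) i <;> simp

theorem FunCode.ren {k l : ℕ} {c : Fin k → M} {d : Fin l → M} {f : Γ → M} (h : FunCode c f)
    (ρ : Fin k → Fin l) (hρ : d ∘ ρ = c) : FunCode d f := by
  obtain ⟨t, ht⟩ := h
  refine ⟨t.ren (Fin.append (fun i => Fin.castAdd _ (ρ i)) (Fin.natAdd l)), fun g => ?_⟩
  rw [SetTerm.ev_ren, append_comp_append c d _ ρ hρ, ht]

theorem RelCode.ren {k l : ℕ} {c : Fin k → M} {d : Fin l → M} {P : Γ → Prop} (h : RelCode c P)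
    (ρ : Fin k → Fin l) (hρ : d ∘ ρ = c) : RelCode d P := by
  obtain ⟨t, ht⟩ := h
  refine ⟨t.ren (Fin.append (fun i => Fin.castAdd _ (ρ i)) (Fin.natAdd l)), fun g => ?_⟩
  rw [SetForm.real_ren, append_comp_append c d _ ρ hρ, ht]

theorem append_left_comp {M : Type*} {k l : ℕ} (c : Fin k → M) (d : Fin l → M) :
    Fin.append c d ∘ Fin.castAdd l = c := by
  funext i; simp

theorem append_right_comp {M : Type*} {k l : ℕ} (c : Fin k → M) (d : Fin l → M) :
    Fin.append c d ∘ Fin.natAdd k = d := by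
  funext i; simp

variable {Δ : Type u} [Ctx M Δ]

theorem BddFun.common {f : Γ → M} {h : Δ → M} (hf : BddFun f) (hh : BddFun h) :
    ∃ (k : ℕ) (c : Fin k → M), FunCode c f ∧ FunCode c h := by
  obtain ⟨k, c, hc⟩ := hf.out
  obtain ⟨l, d, hd⟩ := hh.out
  exact ⟨k + l, Fin.append c d, hc.ren _ (append_left_comp c d), hd.ren _ (append_right_comp c d)⟩

theorem BddFun.common_rel {f : Γ → M} {P : Δ → Prop} (hf : BddFun f) (hP : BddRel M P) :
    ∃ (k : ℕ) (c : Fin k → M), FunCode c f ∧ RelCode c P := by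
  obtain ⟨k, c, hc⟩ := hf.out
  obtain ⟨l, d, hd⟩ := hP.out
  exact ⟨k + l, Fin.append c d, hc.ren _ (append_left_comp c d), hd.ren _ (append_right_comp c d)⟩

theorem BddRel.common {P : Γ → Prop} {Q : Δ → Prop} (hP : BddRel M P) (hQ : BddRel M Q) :
    ∃ (k : ℕ) (c : Fin k → M), RelCode c P ∧ RelCode c Q := by
  obtain ⟨k, c, hc⟩ := hP.out
  obtain ⟨l, d, hd⟩ := hQ.out
  exact ⟨k + l, Fin.append c d, hc.ren _ (append_left_comp c d), hd.ren _ (append_right_comp c d)⟩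

theorem BddRel.congr {P Q : Γ → Prop} (hQ : BddRel M Q) (h : ∀ g, P g ↔ Q g) : BddRel M P := by
  rwa [show P = Q from funext fun g => propext (h g)]

instance (priority := 2000) BddFun.const (a : M) : BddFun (fun _ : Γ => a) :=
  ⟨1, fun _ => a, SetTerm.var (Fin.castAdd _ 0), fun g => by simp [SetTerm.ev]⟩

theorem FunCode.weaken {k : ℕ} {c : Fin k → M} {f : Γ → M} (h : FunCode c f) :
    FunCode c (fun p : Γ × M => f p.1) := by
  obtain ⟨t, ht⟩ := h
  refine ⟨t.wk, fun g => (ht g.1).trans ?_⟩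
  exact (congrArg t.wk.ev (Fin.append_snoc c (Ctx.val g.1) g.2)).trans (SetTerm.ev_wk t _ _) |>.symm

theorem BddFun.weaken {f : Γ → M} (h : BddFun f) : BddFun (fun p : Γ × M => f p.1) := by
  obtain ⟨k, c, hc⟩ := h.out
  exact ⟨k, c, hc.weaken⟩

/-! Instance resolution does not solve `f p.1.1 = ?f p.1` for `?f`, so weakening and the variables
are listed by depth. -/

instance (priority := 100) BddFun.weaken₁ {f : Γ → M} [h : BddFun f] :
    BddFun (fun p : Γ × M => f p.1) := h.weaken
instance (priority := 100) BddFun.weaken₂ {f : Γ → M} [h : BddFun f] :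
    BddFun (fun p : (Γ × M) × M => f p.1.1) := h.weaken.weaken
instance (priority := 100) BddFun.weaken₃ {f : Γ → M} [h : BddFun f] :
    BddFun (fun p : ((Γ × M) × M) × M => f p.1.1.1) := h.weaken.weaken.weaken

instance (priority := 1500) BddFun.var0 : BddFun (fun p : Γ × M => p.2) :=
  ⟨0, Fin.elim0, SetTerm.var (Fin.natAdd 0 (Fin.last _)), fun g => by
    rw [SetTerm.ev, Fin.append_right]; exact (Fin.snoc_last (α := fun _ => M) _ _).symm⟩
instance (priority := 1500) BddFun.var1 : BddFun (fun p : (Γ × M) × M => p.1.2) :=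
  BddFun.var0.weaken
instance (priority := 1500) BddFun.var2 : BddFun (fun p : ((Γ × M) × M) × M => p.1.1.2) :=
  BddFun.var1.weaken
instance (priority := 1500) BddFun.var3 :
    BddFun (fun p : (((Γ × M) × M) × M) × M => p.1.1.1.2) := BddFun.var2.weaken
instance (priority := 1500) BddFun.var4 :
    BddFun (fun p : ((((Γ × M) × M) × M) × M) × M => p.1.1.1.1.2) := BddFun.var3.weaken

section Functions

variable {f h l : Γ → M}

theorem BddFun.app₁ (s : SetFun 1) (hf : BddFun f) :
    BddFun (fun g => Structure.funMap (L := setLang) s ![f g]) := by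
  obtain ⟨k, c, t, ht⟩ := hf.out
  refine ⟨k, c, SetTerm.app s ![t], fun g => ?_⟩
  rw [SetTerm.ev]
  beta_reduce
  rw [ht]
  congr 1
  funext i
  fin_cases i
  rfl

theorem BddFun.app₂ (s : SetFun 2) (hf : BddFun f) (hh : BddFun h) :
    BddFun (fun g => Structure.funMap (L := setLang) s ![f g, h g]) := by
  obtain ⟨k, c, ⟨t, ht⟩, t', ht'⟩ := hf.common hh
  refine ⟨k, c, SetTerm.app s ![t, t'], fun g => ?_⟩
  rw [SetTerm.ev]
  beta_reduce
  rw [ht, ht']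
  congr 1
  funext i
  fin_cases i <;> rfl

instance [hf : BddFun f] : BddFun (fun g => pow (f g)) := hf.app₁ SetFun.pow
instance [hf : BddFun f] : BddFun (fun g => sUn (f g)) := hf.app₁ SetFun.sUnion
instance [hf : BddFun f] : BddFun (fun g => rk (f g)) := hf.app₁ SetFun.rank
instance [hf : BddFun f] [hh : BddFun h] : BddFun (fun g => upair (f g) (h g)) :=
  hf.app₂ SetFun.pair hh
instance [hf : BddFun f] [hh : BddFun h] : BddFun (fun g => opair (f g) (h g)) :=
  inferInstanceAs (BddFun fun g => upair (upair (f g) (f g)) (upair (f g) (h g)))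

end Functions

section Relations

variable {f h l : Γ → M} {P Q : Γ → Prop}

instance [hf : BddFun f] [hh : BddFun h] : BddRel M (fun g => f g ε h g) := by
  obtain ⟨k, c, ⟨t, ht⟩, t', ht'⟩ := hf.common hh
  exact ⟨k, c, SetForm.mem t t', fun g => by
    rw [SetForm.Real]; beta_reduce; rw [ht, ht']⟩

instance [hf : BddFun f] [hh : BddFun h] : BddRel M (fun g => f g = h g) := by
  obtain ⟨k, c, ⟨t, ht⟩, t', ht'⟩ := hf.common hh
  exact ⟨k, c, SetForm.equal t t', fun g => by
    rw [SetForm.Real]; beta_reduce; rw [ht, ht']⟩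

instance BddRel.imp [hP : BddRel M P] [hQ : BddRel M Q] : BddRel M (fun g => P g → Q g) := by
  obtain ⟨k, c, ⟨t, ht⟩, t', ht'⟩ := hP.common hQ
  exact ⟨k, c, SetForm.imp t t', fun g => by
    rw [SetForm.Real]; beta_reduce; rw [ht, ht']⟩

theorem BddRel.false : BddRel M (fun _ : Γ => False) :=
  ⟨0, Fin.elim0, SetForm.falsum, fun _ => Iff.rfl⟩

instance BddRel.not [BddRel M P] : BddRel M (fun g => ¬ P g) :=
  have := BddRel.false (M := M) (Γ := Γ)
  inferInstanceAs (BddRel M fun g => P g → False)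

instance (priority := 2000) BddRel.const (p : Prop) : BddRel M (fun _ : Γ => p) := by
  by_cases hp : p
  · have := BddRel.false (M := M) (Γ := Γ)
    exact (inferInstance : BddRel M fun _ : Γ => ¬ False).congr (by simp [hp])
  · exact BddRel.false.congr (by simp [hp])

instance [BddFun f] [BddFun h] : BddRel M (fun g => f g ≠ h g) :=
  inferInstanceAs (BddRel M fun g => ¬ (f g = h g))

instance BddRel.or [BddRel M P] [BddRel M Q] : BddRel M (fun g => P g ∨ Q g) :=
  (inferInstance : BddRel M fun g => ¬ P g → Q g).congr fun _ => by tauto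

instance BddRel.and [BddRel M P] [BddRel M Q] : BddRel M (fun g => P g ∧ Q g) :=
  (inferInstance : BddRel M fun g => ¬ (P g → ¬ Q g)).congr fun _ => by tauto

instance BddRel.iff [BddRel M P] [BddRel M Q] : BddRel M (fun g => P g ↔ Q g) :=
  (inferInstance : BddRel M fun g => (P g → Q g) ∧ (Q g → P g)).congr fun _ => by tauto

/-- Bounded relations are closed under bounded quantifiers; the quantified variable is adjoined to the
context. -/
instance BddRel.ball {R : Γ → M → Prop} [hf : BddFun f]
    [hR : BddRel M (fun p : Γ × M => R p.1 p.2)] : BddRel M (fun g => ∀ y, y ε f g → R g y) := by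
  obtain ⟨k, c, ⟨t, ht⟩, φ, hφ⟩ := hf.common_rel hR
  refine ⟨k, c, SetForm.ball t φ, fun g => ?_⟩
  rw [SetForm.Real]
  beta_reduce
  rw [ht]
  refine forall_congr' fun y => imp_congr_right fun _ => ?_
  exact (hφ (g, y)).trans (iff_of_eq (congrArg φ.Real (Fin.append_snoc c (Ctx.val g) y)))

instance BddRel.bex {R : Γ → M → Prop} [hf : BddFun f]
    [hR : BddRel M (fun p : Γ × M => R p.1 p.2)] : BddRel M (fun g => ∃ y, y ε f g ∧ R g y) :=
  (inferInstance : BddRel M fun g => ¬ ∀ y, y ε f g → ¬ R g y).congr fun _ => by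
    push Not; rfl

instance BddRel.sub [BddFun f] [BddFun h] : BddRel M (fun g => Sub (f g) (h g)) :=
  BddRel.ball (R := fun g z => z ε h g)

instance BddRel.le [BddFun f] [BddFun h] [BddFun l] : BddRel M (fun g => Le (f g) (h g) (l g)) :=
  inferInstanceAs (BddRel M fun g => opair (h g) (l g) ε f g)

instance BddRel.inField [BddFun f] [BddFun h] : BddRel M (fun g => InField (f g) (h g)) :=
  inferInstanceAs (BddRel M fun g => Le (f g) (h g) (h g))

end Relations

variable (M) in
/-- `P` is a unary bounded relation. -/
abbrev BddRel₁ (P : M → Prop) : Prop := BddRel M (fun p : PUnit.{u + 1} × M => P p.2)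

variable (M) in
/-- `R` is a binary bounded relation. -/
abbrev BddRel₂ (R : M → M → Prop) : Prop :=
  BddRel M (fun p : (PUnit.{u + 1} × M) × M => R p.1.2 p.2)

section Substitution

variable {f h : Γ → M}

/-- Substitution of bounded functions in a bounded relation of two variables: `R (f g) (h g)` holds
iff `∃ a ∈ {f g}, ∃ b ∈ {h g}, R a b`. -/
theorem BddRel.comp₂ [M ⊨ EAstar] {R : M → M → Prop} (hR : BddRel₂ M R) (hf : BddFun f)
    (hh : BddFun h) : BddRel M (fun g => R (f g) (h g)) := by
  have key : BddRel M (fun p : (Γ × M) × M => R p.1.2 p.2) := by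
    obtain ⟨k, c, φ, hφ⟩ := hR.out
    refine ⟨k, c, φ.ren (Fin.append (Fin.castAdd _)
      ![Fin.natAdd k (Fin.last _).castSucc, Fin.natAdd k (Fin.last _)]), fun g => ?_⟩
    refine (hφ ((PUnit.unit, g.1.2), g.2)).trans ?_
    rw [SetForm.real_ren]
    refine iff_of_eq (congrArg φ.Real (funext fun i => ?_))
    refine Fin.addCases (fun i => ?_) (fun i => ?_) i
    · simp
    · simp only [Fin.append_right, Function.comp_apply]
      refine Fin.lastCases ?_ (fun i => Fin.lastCases ?_ (fun i => i.elim0) i) i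
      · exact (Fin.snoc_last (α := fun _ => M) _ _).trans ((Fin.append_right c _ _).trans
          (Fin.snoc_last (α := fun _ => M) _ _)).symm
      · refine ((Fin.snoc_castSucc (α := fun _ => M) _ _ _).trans
          (Fin.snoc_last (α := fun _ => M) _ _)).trans ((Fin.append_right c _ _).trans
          ((Fin.snoc_castSucc (α := fun _ => M) _ _ _).trans
          (Fin.snoc_last (α := fun _ => M) _ _))).symm
  refine (inferInstance : BddRel M fun g => ∃ a, a ε upair (f g) (f g) ∧
    ∃ b, b ε upair (h g) (h g) ∧ R a b).congr fun g => ?_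
  simp

instance (priority := 50) BddRel.inst_comp₂ [M ⊨ EAstar] {R : M → M → Prop} [hR : BddRel₂ M R]
    [hf : BddFun f] [hh : BddFun h] : BddRel M (fun g => R (f g) (h g)) := hR.comp₂ hf hh

end Substitution

theorem RelCode.exists_sep [M ⊨ EAstar] {k : ℕ} {c : Fin k → M} {f : Γ → M} {R : Γ → M → Prop}
    (hf : FunCode c f) (hR : RelCode c (fun p : Γ × M => R p.1 p.2)) :
    ∃ t : SetTerm (k + Ctx.n M Γ), ∀ g z,
      z ε t.ev (Fin.append c (Ctx.val g)) ↔ z ε f g ∧ R g z := by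
  obtain ⟨t, ht⟩ := hf
  obtain ⟨φ, hφ⟩ := hR
  refine ⟨t.sep φ, fun g z => ?_⟩
  rw [mem_ev_sep, ht]
  exact and_congr_right fun _ =>
    (iff_of_eq (congrArg φ.Real (Fin.append_snoc c (Ctx.val g) z).symm)).trans (hφ (g, z)).symm

open Classical in
/-- The set of the elements of `b` that satisfy `P`, if there is such a set, and `b` otherwise. -/
noncomputable def compr (b : M) (P : M → Prop) : M :=
  if h : ∃ a : M, ∀ z, z ε a ↔ z ε b ∧ P z then h.choose else b

theorem mem_compr_of_exists {b : M} {P : M → Prop} (h : ∃ a : M, ∀ z, z ε a ↔ z ε b ∧ P z)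
    (z : M) : z ε compr b P ↔ z ε b ∧ P z := by
  rw [compr, dif_pos h]
  exact h.choose_spec z

@[simp]
theorem mem_compr [M ⊨ EAstar] {b : M} {P : M → Prop} [hP : BddRel₁ M P] {z : M} :
    z ε compr b P ↔ z ε b ∧ P z := by
  refine mem_compr_of_exists ?_ z
  obtain ⟨k, c, hf, hR⟩ := (BddFun.const (Γ := PUnit) b).common_rel hP
  obtain ⟨t, ht⟩ := RelCode.exists_sep (R := fun _ z => P z) hf hR
  exact ⟨_, ht PUnit.unit⟩

instance BddFun.compr [M ⊨ EAstar] {f : Γ → M} {R : Γ → M → Prop} [hf : BddFun f]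
    [hR : BddRel M (fun p : Γ × M => R p.1 p.2)] : BddFun (fun g => compr (f g) (R g)) := by
  obtain ⟨k, c, hf, hR⟩ := hf.common_rel hR
  obtain ⟨t, ht⟩ := RelCode.exists_sep hf hR
  exact ⟨k, c, t, fun g => set_ext fun z =>
    (mem_compr_of_exists ⟨_, ht g⟩ z).trans (ht g z).symm⟩

end Bounded

/-! ### Elementary set theory and cardinal comparison -/

section Basics

variable {M : Type u} [setLang.Structure M]

/-- The union of two sets. -/
def un (a b : M) : M := sUn (upair a b)

/-- `a ∪ {x}`. -/
def adj (a x : M) : M := un a (upair x x)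

variable {Γ : Type u} [Ctx M Γ] {f h l : Γ → M}

instance [BddFun f] [BddFun h] : BddFun (fun g => un (f g) (h g)) :=
  inferInstanceAs (BddFun fun g => sUn (upair (f g) (h g)))

instance [BddFun f] [BddFun h] : BddFun (fun g => adj (f g) (h g)) :=
  inferInstanceAs (BddFun fun g => un (f g) (upair (h g) (h g)))

variable [M ⊨ EAstar]

@[simp] theorem mem_un {z a b : M} : z ε un a b ↔ z ε a ∨ z ε b := by
  simp [un]

@[simp] theorem mem_adj {z a x : M} : z ε adj a x ↔ z ε a ∨ z = x := by
  simp [adj]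

theorem Sub.antisymm {a b : M} (h : Sub a b) (h' : Sub b a) : a = b :=
  set_ext fun z => ⟨h z, h' z⟩

theorem Sub.refl {M : Type*} [setLang.Structure M] (a : M) : Sub a a := fun _ => id

theorem Sub.trans {M : Type*} [setLang.Structure M] {a b c : M} (h : Sub a b) (h' : Sub b c) :
    Sub a c := fun z hz => h' z (h z hz)

theorem emp_sub (a : M) : Sub (emp M) a := fun z hz => (not_mem_emp z hz).elim

theorem ne_emp_iff {a : M} : a ≠ emp M ↔ ∃ z, z ε a := by
  constructor
  · intro h
    by_contra! h'
    exact h (set_ext fun z => by simp [h' z])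
  · rintro ⟨z, hz⟩ rfl
    exact not_mem_emp z hz

theorem upair_self_inj {a b : M} : upair a a = upair b b ↔ a = b := by
  refine ⟨fun h => ?_, fun h => by rw [h]⟩
  have : a ε upair b b := h ▸ mem_upair.2 (Or.inl rfl)
  simpa using this

@[simp] theorem opair_inj {a b c d : M} : opair a b = opair c d ↔ a = c ∧ b = d := by
  refine ⟨fun h => ?_, fun ⟨h, h'⟩ => by rw [h, h']⟩
  have key : ∀ z, (z = upair a a ∨ z = upair a b) ↔ (z = upair c c ∨ z = upair c d) := fun z => by
    simpa [opair] using iff_of_eq (congrArg (z ε ·) h)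
  have hup : ∀ {p q r s : M}, upair p q = upair r s → ∀ z, (z = p ∨ z = q) ↔ (z = r ∨ z = s) :=
    fun h z => by simpa using iff_of_eq (congrArg (z ε ·) h)
  have hac : a = c := by
    rcases (key (upair a a)).1 (Or.inl rfl) with h | h
    · exact upair_self_inj.1 h
    · have := (hup h c).2 (Or.inl rfl)
      exact (by simpa using this : c = a).symm
  subst hac
  refine ⟨rfl, ?_⟩
  rcases (key (upair a b)).1 (Or.inr rfl) with h | h
  · have hb : b = a := by simpa using (hup h b).1 (Or.inr rfl)
    rcases (key (upair a d)).2 (Or.inr rfl) with h' | h'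
    · have hd : d = a := by simpa using (hup h' d).1 (Or.inr rfl)
      rw [hb, hd]
    · rcases (hup h' d).1 (Or.inr rfl) with h'' | h''
      · rw [hb, h'']
      · exact h''.symm
  · rcases (hup h b).1 (Or.inr rfl) with h' | h'
    · rcases (hup h d).2 (Or.inr rfl) with h'' | h''
      · rw [h', h'']
      · exact h''.symm
    · exact h'

theorem opair_mem_pow {a b s : M} (ha : a ε s) (hb : b ε s) : opair a b ε pow (pow s) := by
  simp only [mem_pow, Sub, opair, mem_upair]
  rintro z (rfl | rfl) w hw <;> simp at hw
  · exact hw ▸ ha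
  · rcases hw with rfl | rfl <;> assumption

/-- A bounded form of the definition of functions. -/
theorem isFun_iff {f a b : M} : IsFun f a b ↔
    (∀ p, p ε f → ∃ u, u ε a ∧ ∃ v, v ε b ∧ p = opair u v) ∧
    ∀ u, u ε a → ∃ v, v ε b ∧ (opair u v ε f ∧ ∀ w, w ε b → opair u w ε f → w = v) := by
  constructor
  · rintro ⟨h1, h2⟩
    refine ⟨fun p hp => ?_, fun u hu => ?_⟩
    · obtain ⟨u, v, hu, hv, e⟩ := h1 p hp
      exact ⟨u, hu, v, hv, e⟩
    · obtain ⟨v, hv, hw⟩ := h2 u hu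
      obtain ⟨u', v', -, hv', e⟩ := h1 _ hv
      obtain ⟨rfl, rfl⟩ := opair_inj.1 e
      exact ⟨v, hv', hv, fun w _ h => hw w h⟩
  · rintro ⟨h1, h2⟩
    refine ⟨fun p hp => ?_, fun u hu => ?_⟩
    · obtain ⟨u, hu, v, hv, e⟩ := h1 p hp
      exact ⟨u, v, hu, hv, e⟩
    · obtain ⟨v, hv, hp, hw⟩ := h2 u hu
      refine ⟨v, hp, fun w hpw => hw w ?_ hpw⟩
      obtain ⟨u', hu', v', hv', e⟩ := h1 _ hpw
      obtain ⟨rfl, rfl⟩ := opair_inj.1 e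
      exact hv'

instance BddRel.isFun [BddFun f] [BddFun h] [BddFun l] :
    BddRel M (fun g => IsFun (f g) (h g) (l g)) :=
  (inferInstance : BddRel M fun g =>
    (∀ p, p ε f g → ∃ u, u ε h g ∧ ∃ v, v ε l g ∧ p = opair u v) ∧
    ∀ u, u ε h g → ∃ v, v ε l g ∧ (opair u v ε f g ∧ ∀ w, w ε l g → opair u w ε f g → w = v)).congr
      fun _ => isFun_iff

theorem IsFun.mem {f a b u v : M} (hf : IsFun f a b) (h : opair u v ε f) : u ε a ∧ v ε b := by
  obtain ⟨u', v', hu, hv, e⟩ := hf.1 _ h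
  obtain ⟨rfl, rfl⟩ := opair_inj.1 e
  exact ⟨hu, hv⟩

theorem IsFun.unique {f a b u v w : M} (hf : IsFun f a b) (h : opair u v ε f)
    (h' : opair u w ε f) : v = w := by
  obtain ⟨x, _, hx⟩ := hf.2 u (hf.mem h).1
  rw [hx v h, hx w h']

theorem IsFun.mem_pow {f a b : M} (hf : IsFun f a b) : f ε pow (pow (pow (un a b))) := by
  refine BoundedTheories.mem_pow.2 fun p hp => ?_
  obtain ⟨u, v, hu, hv, rfl⟩ := hf.1 p hp
  exact opair_mem_pow (mem_un.2 (Or.inl hu)) (mem_un.2 (Or.inr hv))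

theorem IsFun.ext {f h a b b' : M} (hf : IsFun f a b) (hh : IsFun h a b')
    (H : ∀ u v, opair u v ε f → opair u v ε h) : f = h := by
  refine set_ext fun p => ⟨fun hp => ?_, fun hp => ?_⟩
  · obtain ⟨u, v, -, -, rfl⟩ := hf.1 p hp
    exact H u v hp
  · obtain ⟨u, v, hu, -, rfl⟩ := hh.1 p hp
    obtain ⟨w, hw, -⟩ := hf.2 u hu
    rwa [hh.unique hp (H u w hw)]

/-- The part of the graph of the relation `R` in `a × b`. -/
noncomputable def graph (a b : M) (R : M → M → Prop) : M :=
  compr (pow (pow (un a b))) fun p => ∃ u, u ε a ∧ ∃ v, v ε b ∧ p = opair u v ∧ R u v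

theorem mem_graph {a b p : M} {R : M → M → Prop} [BddRel₂ M R] :
    p ε graph a b R ↔ ∃ u, u ε a ∧ ∃ v, v ε b ∧ p = opair u v ∧ R u v := by
  rw [graph, mem_compr, and_iff_right_of_imp]
  rintro ⟨u, hu, v, hv, rfl, -⟩
  exact opair_mem_pow (mem_un.2 (Or.inl hu)) (mem_un.2 (Or.inr hv))

@[simp]
theorem opair_mem_graph {a b u v : M} {R : M → M → Prop} [BddRel₂ M R] :
    opair u v ε graph a b R ↔ u ε a ∧ v ε b ∧ R u v := by
  rw [mem_graph]
  constructor
  · rintro ⟨u, hu, v, hv, e, h⟩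
    obtain ⟨rfl, rfl⟩ := opair_inj.1 e
    exact ⟨hu, hv, h⟩
  · rintro ⟨hu, hv, h⟩
    exact ⟨u, hu, v, hv, rfl, h⟩

theorem isFun_graph {a b : M} {R : M → M → Prop} [BddRel₂ M R]
    (hex : ∀ u, u ε a → ∃ v, v ε b ∧ R u v)
    (huniq : ∀ u v w, u ε a → R u v → R u w → v = w) : IsFun (graph a b R) a b := by
  refine ⟨fun p hp => ?_, fun u hu => ?_⟩
  · obtain ⟨u, hu, v, hv, e, -⟩ := mem_graph.1 hp
    exact ⟨u, v, hu, hv, e⟩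
  · obtain ⟨v, hv, h⟩ := hex u hu
    exact ⟨v, opair_mem_graph.2 ⟨hu, hv, h⟩,
      fun w hw => huniq u w v hu (opair_mem_graph.1 hw).2.2 h⟩

/-- A bounded relation that is functional and injective from `a` to `b` yields an injection. -/
theorem cardLe_of_rel {a b : M} (R : M → M → Prop) [BddRel₂ M R]
    (hex : ∀ u, u ε a → ∃ v, v ε b ∧ R u v)
    (huniq : ∀ u v w, u ε a → R u v → R u w → v = w)
    (hinj : ∀ u u' v, u ε a → u' ε a → R u v → R u' v → u = u') : CardLe a b := by
  refine ⟨graph a b R, isFun_graph hex huniq, fun u u' v h h' => ?_⟩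
  rw [opair_mem_graph] at h h'
  exact hinj u u' v h.1 h'.1 h.2.2 h'.2.2

/-- A bounded function that is injective from `a` to `b` yields an injection. -/
theorem cardLe_of_fun {a b : M} (F : M → M) [BddRel₂ M fun u v => v = F u]
    (hmaps : ∀ u, u ε a → F u ε b)
    (hinj : ∀ u u', u ε a → u' ε a → F u = F u' → u = u') : CardLe a b :=
  cardLe_of_rel (fun u v => v = F u) (fun u hu => ⟨F u, hmaps u hu, rfl⟩)
    (fun _ _ _ _ h h' => h.trans h'.symm) fun u u' _ hu hu' h h' => hinj u u' hu hu' (h ▸ h')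

theorem cardLe_of_sub {a b : M} (h : Sub a b) : CardLe a b :=
  cardLe_of_fun (fun u => u) h fun _ _ _ _ h => h

theorem CardLe.trans {a b c : M} (h : CardLe a b) (h' : CardLe b c) : CardLe a c := by
  obtain ⟨f, hf, hf1⟩ := h
  obtain ⟨k, hk, hk1⟩ := h'
  refine cardLe_of_rel (fun u w => ∃ v, v ε b ∧ opair u v ε f ∧ opair v w ε k) ?_ ?_ ?_
  · intro u hu
    obtain ⟨v, hv, -⟩ := hf.2 u hu
    obtain ⟨w, hw, -⟩ := hk.2 v (hf.mem hv).2
    exact ⟨w, (hk.mem hw).2, v, (hf.mem hv).2, hv, hw⟩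
  · rintro u w w' - ⟨v, -, h1, h2⟩ ⟨v', -, h1', h2'⟩
    obtain rfl := hf.unique h1 h1'
    exact hk.unique h2 h2'
  · rintro u u' w - - ⟨v, -, h1, h2⟩ ⟨v', -, h1', h2'⟩
    obtain rfl := hk1 _ _ _ h2 h2'
    exact hf1 _ _ _ h1 h1'

theorem CardEq.refl (a : M) : CardEq a a := ⟨cardLe_of_sub (Sub.refl a), cardLe_of_sub (Sub.refl a)⟩

theorem CardEq.symm {M : Type*} [setLang.Structure M] {a b : M} (h : CardEq a b) :
    CardEq b a := ⟨h.2, h.1⟩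

theorem CardEq.trans {a b c : M} (h : CardEq a b) (h' : CardEq b c) : CardEq a c :=
  ⟨h.1.trans h'.1, h'.2.trans h.2⟩

/-- A bounded form of the definition of cardinal comparison. -/
theorem cardLe_iff {a b : M} : CardLe a b ↔ ∃ k, k ε pow (pow (pow (un a b))) ∧
    IsFun k a b ∧ ∀ u, u ε a → ∀ u', u' ε a → ∀ v, v ε b →
      opair u v ε k → opair u' v ε k → u = u' := by
  constructor
  · rintro ⟨k, hk, h1⟩
    exact ⟨k, hk.mem_pow, hk, fun u _ u' _ v _ => h1 u u' v⟩
  · rintro ⟨k, -, hk, h1⟩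
    exact ⟨k, hk, fun u u' v h h' => h1 u (hk.mem h).1 u' (hk.mem h').1 v (hk.mem h).2 h h'⟩

instance BddRel.cardLe [BddFun f] [BddFun h] : BddRel M (fun g => CardLe (f g) (h g)) :=
  (inferInstance : BddRel M fun g => ∃ k, k ε pow (pow (pow (un (f g) (h g)))) ∧
    IsFun k (f g) (h g) ∧ ∀ u, u ε f g → ∀ u', u' ε f g → ∀ v, v ε h g →
      opair u v ε k → opair u' v ε k → u = u').congr fun _ => cardLe_iff

instance BddRel.cardEq [BddFun f] [BddFun h] : BddRel M (fun g => CardEq (f g) (h g)) :=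
  inferInstanceAs (BddRel M fun g => CardLe (f g) (h g) ∧ CardLe (h g) (f g))

/-- No set has an injection into a proper subset. -/
theorem not_cardLe_of_ssub {a b x : M} (hab : Sub b a) (hx : x ε a) (hxb : ¬ x ε b) :
    ¬ CardLe a b := by
  rintro ⟨f, hf, h1⟩
  have hf' : IsFun f a a :=
    ⟨fun p hp => let ⟨u, v, hu, hv, e⟩ := hf.1 p hp; ⟨u, v, hu, hab v hv, e⟩, hf.2⟩
  obtain ⟨u, hu⟩ := dedekind hf' h1 x hx
  exact hxb (hf.mem hu).2

theorem cardLe_emp {a : M} (h : CardLe a (emp M)) : a = emp M := by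
  by_contra hne
  obtain ⟨x, hx⟩ := ne_emp_iff.1 hne
  exact not_cardLe_of_ssub (emp_sub a) hx (not_mem_emp x) h

theorem CardLe.adj {a b x y : M} (h : CardLe a b) (hx : ¬ x ε a) (hy : ¬ y ε b) :
    CardLe (adj a x) (adj b y) := by
  obtain ⟨f, hf, h1⟩ := h
  refine cardLe_of_rel (fun u v => opair u v ε f ∨ (u = x ∧ v = y)) ?_ ?_ ?_
  · intro u hu
    rcases mem_adj.1 hu with hu | rfl
    · obtain ⟨v, hv, -⟩ := hf.2 u hu
      exact ⟨v, mem_adj.2 (Or.inl (hf.mem hv).2), Or.inl hv⟩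
    · exact ⟨y, mem_adj.2 (Or.inr rfl), Or.inr ⟨rfl, rfl⟩⟩
  · rintro u v w - (h | ⟨rfl, rfl⟩) (h' | ⟨h2, rfl⟩)
    · exact hf.unique h h'
    · exact (hx (h2 ▸ (hf.mem h).1)).elim
    · exact (hx (hf.mem h').1).elim
    · rfl
  · rintro u u' v - - (h | ⟨rfl, rfl⟩) (h' | ⟨h2, h3⟩)
    · exact h1 _ _ _ h h'
    · exact (hy (h3 ▸ (hf.mem h).2)).elim
    · exact (hy (hf.mem h').2).elim
    · exact h2.symm

theorem CardLe.of_adj {a b x y : M} (h : CardLe (BoundedTheories.adj a x) (BoundedTheories.adj b y))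
    (hx : ¬ x ε a) (hy : ¬ y ε b) : CardLe a b := by
  obtain ⟨f, hf, h1⟩ := h
  have hxa : ∀ {u}, u ε a → u ε BoundedTheories.adj a x := fun h => mem_adj.2 (Or.inl h)
  obtain ⟨w, hw, -⟩ := hf.2 x (mem_adj.2 (Or.inr rfl))
  -- the element that `f` sends to `y` is sent to the value at `x` instead
  refine cardLe_of_rel (fun u v => (opair u v ε f ∧ v ≠ y) ∨ (opair u y ε f ∧ v = w)) ?_ ?_ ?_
  · intro u hu
    obtain ⟨v, hv, -⟩ := hf.2 u (hxa hu)
    by_cases hvy : v = y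
    · refine ⟨w, ?_, Or.inr ⟨hvy ▸ hv, rfl⟩⟩
      rcases mem_adj.1 (hf.mem hw).2 with h | h
      · exact h
      · subst hvy
        exact (hx (h1 _ _ _ hv (h ▸ hw) ▸ hu)).elim
    · exact ⟨v, (mem_adj.1 (hf.mem hv).2).resolve_right hvy, Or.inl ⟨hv, hvy⟩⟩
  · rintro u v v' - (⟨h, hne⟩ | ⟨h, rfl⟩) (⟨h', hne'⟩ | ⟨h', rfl⟩)
    · exact hf.unique h h'
    · exact (hne (hf.unique h h')).elim
    · exact (hne' (hf.unique h' h)).elim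
    · rfl
  · rintro u u' v hu hu' (⟨h, hne⟩ | ⟨h, rfl⟩) (⟨h', hne'⟩ | ⟨h', e⟩)
    · exact h1 _ _ _ h h'
    · exact (hx (h1 _ _ _ (e ▸ h) hw ▸ hu)).elim
    · exact (hx (h1 _ _ _ h' hw ▸ hu')).elim
    · exact h1 _ _ _ h h'

end Basics

/-! ### Induction over finite sets -/

section FiniteInduction

variable {M : Type u} [setLang.Structure M] [M ⊨ EAstar]

theorem adj_of_mem {a x : M} (h : x ε a) : adj a x = a :=
  set_ext fun z => by simpa using fun e : z = x => e ▸ h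

/-- The subsets of `X` that belong to every family containing `∅` and closed under adjoining an
element of `X`. -/
noncomputable def inductiveSubsets (X : M) : M :=
  compr (pow X) fun a => ∀ F, F ε pow (pow X) →
    (emp M ε F ∧ ∀ b, b ε F → ∀ x, x ε X → adj b x ε F) → a ε F

theorem emp_mem_inductiveSubsets (X : M) : emp M ε inductiveSubsets X := by
  rw [inductiveSubsets, mem_compr]
  exact ⟨mem_pow.2 (emp_sub X), fun F _ h => h.1⟩

theorem adj_mem_inductiveSubsets {X a x : M} (ha : a ε inductiveSubsets X) (hx : x ε X) :
    adj a x ε inductiveSubsets X := by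
  rw [inductiveSubsets, mem_compr] at ha ⊢
  refine ⟨mem_pow.2 fun z hz => ?_, fun F hF h => h.2 a (ha.2 F hF h) x hx⟩
  rcases mem_adj.1 hz with hz | rfl
  exacts [mem_pow.1 ha.1 z hz, hx]

theorem sub_of_mem_inductiveSubsets {X a : M} (ha : a ε inductiveSubsets X) : Sub a X := by
  rw [inductiveSubsets, mem_compr] at ha
  exact mem_pow.1 ha.1

/-- Every set is an inductive subset of itself. Otherwise adjoining one element to the members of
the equinumerosity classes of inductive subsets would be a one-one map of the set of these classes
to itself that misses the class of `∅`. -/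
theorem self_mem_inductiveSubsets (X : M) : X ε inductiveSubsets X := by
  by_contra hX
  set K := inductiveSubsets X with hK
  -- `cls a` is the equinumerosity class of `a`, and `Q` is the set of these classes
  set cls : M → M := fun a => compr K fun b => CardEq a b with hcls
  have mem_cls : ∀ {a b}, b ε cls a ↔ b ε K ∧ CardEq a b := by
    intro a b
    simp [hcls]
  have cls_eq : ∀ {a b}, CardEq a b → cls a = cls b := fun h => set_ext fun z => by
    rw [mem_cls, mem_cls]
    exact and_congr_right fun _ => ⟨fun h' => h.symm.trans h', fun h' => h.trans h'⟩
  set Q : M := compr (pow K) fun q => ∃ a, a ε K ∧ q = cls a with hQ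
  have mem_Q : ∀ {q}, q ε Q ↔ ∃ a, a ε K ∧ q = cls a := by
    intro q
    simp only [hQ, mem_compr, and_iff_right_iff_imp]
    rintro ⟨a, -, rfl⟩
    exact mem_pow.2 fun z hz => (mem_cls.1 hz).1
  have self : ∀ {a}, a ε K → a ε cls a := fun ha => mem_cls.2 ⟨ha, CardEq.refl _⟩
  -- the map that adjoins one new element to the members of a class
  set R : M → M → Prop := fun q r =>
    r ε Q ∧ ∃ a, a ε q ∧ ∃ x, x ε X ∧ ¬ x ε a ∧ adj a x ε r with hR
  have hfun : IsFun (graph Q Q R) Q Q := by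
    refine isFun_graph (fun q hq => ?_) ?_
    · obtain ⟨a, ha, rfl⟩ := mem_Q.1 hq
      obtain ⟨x, hx, hxa⟩ : ∃ x, x ε X ∧ ¬ x ε a := by
        by_contra! h
        exact hX (Sub.antisymm h (sub_of_mem_inductiveSubsets ha) ▸ ha)
      have := adj_mem_inductiveSubsets ha hx
      have hQ' := mem_Q.2 ⟨_, this, rfl⟩
      exact ⟨cls (adj a x), hQ', hQ', a, self ha, x, hx, hxa, self this⟩
    · rintro q r r' hq ⟨hr, b, hb, x, -, hxb, h⟩ ⟨hr', b', hb', x', -, hxb', h'⟩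
      obtain ⟨a, -, rfl⟩ := mem_Q.1 hq
      obtain ⟨c, -, rfl⟩ := mem_Q.1 hr
      obtain ⟨c', -, rfl⟩ := mem_Q.1 hr'
      have hbb' : CardEq b b' := (mem_cls.1 hb).2.symm.trans (mem_cls.1 hb').2
      exact cls_eq ((mem_cls.1 h).2.trans
        (CardEq.trans ⟨hbb'.1.adj hxb hxb', hbb'.2.adj hxb' hxb⟩ (mem_cls.1 h').2.symm))
  have hone : IsOneOne (graph Q Q R) := by
    intro q q' r h h'
    obtain ⟨hq, hr, -, b, hb, x, -, hxb, k⟩ := opair_mem_graph.1 h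
    obtain ⟨hq', -, -, b', hb', x', -, hxb', k'⟩ := opair_mem_graph.1 h'
    obtain ⟨a, -, rfl⟩ := mem_Q.1 hq
    obtain ⟨a', -, rfl⟩ := mem_Q.1 hq'
    obtain ⟨c, -, rfl⟩ := mem_Q.1 hr
    have hadj : CardEq (adj b x) (adj b' x') := (mem_cls.1 k).2.symm.trans (mem_cls.1 k').2
    exact cls_eq ((mem_cls.1 hb).2.trans
      (CardEq.trans ⟨hadj.1.of_adj hxb hxb', hadj.2.of_adj hxb' hxb⟩ (mem_cls.1 hb').2.symm))
  obtain ⟨q, hq⟩ := dedekind hfun hone (cls (emp M))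
    (mem_Q.2 ⟨_, emp_mem_inductiveSubsets X, rfl⟩)
  obtain ⟨-, -, -, b, -, x, -, -, h⟩ := opair_mem_graph.1 hq
  exact ne_emp_iff.2 ⟨x, mem_adj.2 (Or.inr rfl)⟩ (cardLe_emp (mem_cls.1 h).2.2)

/-- Induction over finite sets for bounded relations: every set is obtained from `∅` by adjoining its
elements one at a time. -/
theorem fin_induction {P : M → Prop} [BddRel₁ M P] (X : M) (h0 : P (emp M))
    (hs : ∀ a x, Sub a X → P a → x ε X → ¬ x ε a → P (adj a x)) : P X := by
  have h := self_mem_inductiveSubsets X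
  rw [inductiveSubsets, mem_compr] at h
  have := h.2 (compr (pow X) P) (mem_pow.2 fun z hz => (mem_compr.1 hz).1) ⟨?_, ?_⟩
  · exact (mem_compr.1 this).2
  · exact mem_compr.2 ⟨mem_pow.2 (emp_sub X), h0⟩
  · intro b hb x hx
    by_cases hxb : x ε b
    · rwa [adj_of_mem hxb]
    · rw [mem_compr] at hb ⊢
      refine ⟨mem_pow.2 fun z hz => ?_, hs b x (mem_pow.1 hb.1) hb.2 hx hxb⟩
      rcases mem_adj.1 hz with hz | rfl
      exacts [mem_pow.1 hb.1 z hz, hx]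

/-- A nonempty subset of a set on which a bounded relation is transitive and total has a greatest
element, by induction over finite sets. -/
theorem exists_greatest (R : M → M → Prop) [BddRel₂ M R] {X : M}
    (htrans : ∀ a b c, a ε X → b ε X → c ε X → R a b → R b c → R a c)
    (htotal : ∀ a b, a ε X → b ε X → R a b ∨ R b a) {a : M} (ha : Sub a X) (hne : ∃ z, z ε a) :
    ∃ m, m ε a ∧ ∀ c, c ε a → R c m := by
  have := fin_induction (P := fun b => b ≠ emp M → ∃ m, m ε b ∧ ∀ c, c ε b → R c m) a
    (fun h => (h rfl).elim) ?_
  · exact this (ne_emp_iff.2 hne)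
  intro b x hb IH hx hxb _
  have hX : ∀ {c}, c ε b → c ε X := fun h => ha _ (hb _ h)
  have hrefl : R x x := (htotal x x (ha x hx) (ha x hx)).elim id id
  by_cases hbe : b = emp M
  · refine ⟨x, mem_adj.2 (Or.inr rfl), fun c hc => ?_⟩
    rcases mem_adj.1 hc with h | rfl
    · exact (not_mem_emp c (hbe ▸ h)).elim
    · exact hrefl
  · obtain ⟨m, hm, hmax⟩ := IH hbe
    rcases htotal m x (hX hm) (ha x hx) with h | h
    · refine ⟨x, mem_adj.2 (Or.inr rfl), fun c hc => ?_⟩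
      rcases mem_adj.1 hc with hc | rfl
      exacts [htrans _ _ _ (hX hc) (hX hm) (ha x hx) (hmax c hc) h, hrefl]
    · refine ⟨m, mem_adj.2 (Or.inl hm), fun c hc => ?_⟩
      rcases mem_adj.1 hc with hc | rfl
      exacts [hmax c hc, h]

end FiniteInduction

/-! ### Linear orderings and levels -/

section Levels

variable {M : Type u} [setLang.Structure M] [M ⊨ EAstar]

theorem not_mem_self (x : M) : ¬ x ε x := by
  intro h
  obtain ⟨y, hy, h'⟩ := foundation (x := upair x x) ⟨x, mem_upair.2 (Or.inl rfl)⟩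
  obtain rfl : y = x := by simpa using hy
  exact h' y h hy

/-- The field of the reflexive relation `l`. -/
noncomputable def fieldSet (l : M) : M := compr (sUn (sUn l)) fun a => InField l a

theorem Le.mem_sUn {l a b : M} (h : Le l a b) : a ε sUn (sUn l) ∧ b ε sUn (sUn l) := by
  simp only [BoundedTheories.mem_sUn]
  exact ⟨⟨_, ⟨_, h, mem_upair.2 (Or.inr rfl)⟩, mem_upair.2 (Or.inl rfl)⟩,
    ⟨_, ⟨_, h, mem_upair.2 (Or.inr rfl)⟩, mem_upair.2 (Or.inr rfl)⟩⟩

@[simp]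
theorem mem_fieldSet {l a : M} : a ε fieldSet l ↔ InField l a := by
  rw [fieldSet, mem_compr]
  exact and_iff_right_of_imp fun h => (Le.mem_sUn h).1

theorem le_graph {a u v : M} {R : M → M → Prop} [BddRel₂ M R] :
    Le (graph a a R) u v ↔ u ε a ∧ v ε a ∧ R u v := opair_mem_graph

theorem inField_graph {a u : M} {R : M → M → Prop} [BddRel₂ M R] :
    InField (graph a a R) u ↔ u ε a ∧ R u u :=
  le_graph.trans ⟨fun h => h.2, fun h => ⟨h.1, h⟩⟩

section Instances

variable {Γ : Type u} [Ctx M Γ] {f : Γ → M}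

instance BddRel.isLinOrd [BddFun f] : BddRel M (fun g => IsLinOrd (f g)) := by
  refine (inferInstance : BddRel M fun g =>
    (∀ p, p ε f g → ∃ a, a ε sUn (sUn (f g)) ∧ ∃ b, b ε sUn (sUn (f g)) ∧ p = opair a b) ∧
    (∀ a, a ε sUn (sUn (f g)) → ∀ b, b ε sUn (sUn (f g)) →
      ((Le (f g) a b → InField (f g) a ∧ InField (f g) b) ∧
      (Le (f g) a b → Le (f g) b a → a = b) ∧
      (InField (f g) a → InField (f g) b → Le (f g) a b ∨ Le (f g) b a))) ∧
    (∀ a, a ε sUn (sUn (f g)) → ∀ b, b ε sUn (sUn (f g)) → ∀ c, c ε sUn (sUn (f g)) →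
      Le (f g) a b → Le (f g) b c → Le (f g) a c)).congr fun g => ?_
  constructor
  · rintro ⟨h1, h2, h3, h4, h5⟩
    refine ⟨fun p hp => ?_, fun a _ b _ => ⟨h2 a b, h3 a b, h5 a b⟩,
      fun a _ b _ c _ => h4 a b c⟩
    obtain ⟨a, b, rfl⟩ := h1 p hp
    exact ⟨a, (Le.mem_sUn hp).1, b, (Le.mem_sUn hp).2, rfl⟩
  · rintro ⟨h1, h2, h3⟩
    refine ⟨fun p hp => ?_, fun a b hab => ?_, fun a b hab => ?_, fun a b c hab hbc => ?_,
      fun a b ha hb => ?_⟩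
    · obtain ⟨a, -, b, -, e⟩ := h1 p hp
      exact ⟨a, b, e⟩
    · exact (h2 a hab.mem_sUn.1 b hab.mem_sUn.2).1 hab
    · exact (h2 a hab.mem_sUn.1 b hab.mem_sUn.2).2.1 hab
    · exact h3 a hab.mem_sUn.1 b hab.mem_sUn.2 c hbc.mem_sUn.2 hab hbc
    · exact (h2 a (Le.mem_sUn ha).1 b (Le.mem_sUn hb).1).2.2 ha hb

end Instances

theorem IsLinOrd.exists_greatest {l : M} (hl : IsLinOrd l) {a : M}
    (ha : ∀ z, z ε a → InField l z) (hne : ∃ z, z ε a) : ∃ m, m ε a ∧ ∀ c, c ε a → Le l c m :=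
  BoundedTheories.exists_greatest (fun u v => Le l u v) (X := fieldSet l)
    (fun a b c _ _ _ => hl.trans a b c)
    (fun a b ha hb => hl.total a b (mem_fieldSet.1 ha) (mem_fieldSet.1 hb))
    (fun z hz => mem_fieldSet.2 (ha z hz)) hne

theorem IsLinOrd.exists_least {l : M} (hl : IsLinOrd l) {a : M}
    (ha : ∀ z, z ε a → InField l z) (hne : ∃ z, z ε a) : ∃ m, m ε a ∧ ∀ c, c ε a → Le l m c :=
  BoundedTheories.exists_greatest (fun u v => Le l v u) (X := fieldSet l)
    (fun a b c _ _ _ h h' => hl.trans c b a h' h)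
    (fun a b ha hb => hl.total b a (mem_fieldSet.1 hb) (mem_fieldSet.1 ha))
    (fun z hz => mem_fieldSet.2 (ha z hz)) hne

theorem IsLinOrd.exists_pred {l : M} (hl : IsLinOrd l) {u v : M} (h : Le l u v) (hne : u ≠ v) :
    ∃ w, Next l w v := by
  obtain ⟨m, hm, hmax⟩ := hl.exists_greatest
    (a := compr (fieldSet l) fun w => Le l w v ∧ w ≠ v)
    (fun z hz => by simp at hz; exact hz.1) ⟨u, by simp; exact ⟨(hl.field _ _ h).1, h, hne⟩⟩
  simp only [mem_compr, mem_fieldSet] at hm hmax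
  refine ⟨m, hm.2.1, hm.2.2, fun c hmc hcv => ?_⟩
  by_cases e : c = v
  · exact Or.inr e
  · exact Or.inl (hl.antisymm _ _ (hmax c ⟨(hl.field _ _ hcv).1, hcv, e⟩) hmc)

theorem IsLinOrd.exists_next {l : M} (hl : IsLinOrd l) {u v : M} (h : Le l u v) (hne : u ≠ v) :
    ∃ w, Next l u w := by
  obtain ⟨m, hm, hmin⟩ := hl.exists_least
    (a := compr (fieldSet l) fun w => Le l u w ∧ u ≠ w)
    (fun z hz => by simp at hz; exact hz.1) ⟨v, by simp; exact ⟨(hl.field _ _ h).2, h, hne⟩⟩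
  simp only [mem_compr, mem_fieldSet] at hm hmin
  refine ⟨m, hm.2.1, hm.2.2, fun c huc hcm => ?_⟩
  by_cases e : u = c
  · exact Or.inl e.symm
  · exact Or.inr (hl.antisymm _ _ hcm (hmin c ⟨(hl.field _ _ huc).2, huc, e⟩))

namespace IsLevelChain

variable {c s : M} (h : IsLevelChain c s)
include h

/-- Induction along a chain of levels: the least failure is neither `∅` nor the power set of its
predecessor. -/
theorem chain_induction {P : M → Prop} [BddRel₁ M P] (h0 : P (emp M))
    (hs : ∀ V, InField c V → Next c V (pow V) → P V → P (pow V)) {V : M} (hV : InField c V) :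
    P V := by
  by_contra hP
  obtain ⟨W, hW, hmin⟩ := h.linOrd.exists_least (a := compr (fieldSet c) fun V => ¬ P V)
    (fun z hz => by simp at hz; exact hz.1) ⟨V, by simp; exact ⟨hV, hP⟩⟩
  simp only [mem_compr, mem_fieldSet] at hW hmin
  by_cases e : emp M = W
  · exact hW.2 (e ▸ h0)
  · obtain ⟨U, hU⟩ := h.linOrd.exists_pred (h.first.2 W hW.1) e
    have hUf := (h.linOrd.field _ _ hU.1).1
    obtain rfl := h.next _ _ hU
    refine hW.2 (hs U hUf hU ?_)
    by_contra hPU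
    exact hU.2.1 (h.linOrd.antisymm _ _ hU.1 (hmin U ⟨hUf, hPU⟩))

theorem transitive {V : M} (hV : InField c V) : ∀ x, x ε V → Sub x V := by
  refine h.chain_induction (P := fun V => ∀ x, x ε V → Sub x V) ?_ ?_ hV
  · intro x hx
    exact (not_mem_emp x hx).elim
  · intro V _ _ IH x hx z hz
    exact BoundedTheories.mem_pow.2 (IH z (BoundedTheories.mem_pow.1 hx z hz))

/-- Along a chain the ordering is inclusion, and membership between different elements. -/
theorem mono {a b : M} (hab : Le c a b) : Sub a b ∧ (a = b ∨ a ε b) := by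
  have hf := h.linOrd.field a b hab
  refine h.chain_induction
    (P := fun b => ∀ a, a ε fieldSet c → Le c a b → Sub a b ∧ (a = b ∨ a ε b)) ?_ ?_ hf.2 a
    (mem_fieldSet.2 hf.1) hab
  · intro a ha hle
    rw [h.linOrd.antisymm _ _ hle (h.first.2 a (mem_fieldSet.1 ha))]
    exact ⟨Sub.refl _, Or.inl rfl⟩
  · intro V hV hn IH a ha hle
    by_cases e : a = pow V
    · exact e ▸ ⟨Sub.refl _, Or.inl rfl⟩
    · have haV : Le c a V := by
        rcases h.linOrd.total a V (mem_fieldSet.1 ha) hV with h' | h'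
        · exact h'
        · exact (hn.2.2 a h' hle).resolve_right e ▸ hV
      have := (IH a ha haV).1
      exact ⟨fun z hz => BoundedTheories.mem_pow.2 (h.transitive hV z (this z hz)),
        Or.inr (BoundedTheories.mem_pow.2 this)⟩

/-- The part of the chain up to `V` is a chain of `V`. -/
theorem isLevel {V : M} (hV : InField c V) : IsLevel V := by
  refine ⟨graph (fieldSet c) (fieldSet c) fun a b => Le c a b ∧ Le c b V, ⟨?_, ?_, ?_, ?_, ?_⟩, ?_,
    ?_, ?_, ?_⟩
  · intro p hp
    obtain ⟨a, -, b, -, e, -⟩ := mem_graph.1 hp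
    exact ⟨a, b, e⟩
  all_goals simp only [le_graph, inField_graph, mem_fieldSet, Next]
  · rintro a b ⟨ha, hb, hab, hbV⟩
    exact ⟨⟨ha, ha, h.linOrd.trans _ _ _ hab hbV⟩, hb, hb, hbV⟩
  · rintro a b ⟨-, -, hab, -⟩ ⟨-, -, hba, -⟩
    exact h.linOrd.antisymm _ _ hab hba
  · rintro a b d ⟨ha, -, hab, -⟩ ⟨-, hd, hbd, hdV⟩
    exact ⟨ha, hd, h.linOrd.trans _ _ _ hab hbd, hdV⟩
  · rintro a b ⟨ha, -, haV⟩ ⟨hb, -, hbV⟩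
    rcases h.linOrd.total a b ha hb with h' | h'
    exacts [Or.inl ⟨ha, hb, h', hbV⟩, Or.inr ⟨hb, ha, h', haV⟩]
  · rintro a ⟨-, -, haV⟩
    exact (h.mono haV).1
  · exact ⟨⟨h.first.1, h.first.1, h.first.2 V hV⟩,
      fun a ⟨ha, _, haV⟩ => ⟨h.first.1, ha, h.first.2 a ha, haV⟩⟩
  · exact ⟨⟨hV, hV, hV⟩, fun a ⟨ha, _, haV⟩ => ⟨ha, hV, haV, hV⟩⟩
  · rintro a b ⟨⟨ha, hb, hab, hbV⟩, hne, hn⟩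
    exact h.next a b ⟨hab, hne, fun d had hdb => hn d
      ⟨ha, (h.linOrd.field _ _ had).2, had, h.linOrd.trans _ _ _ hdb hbV⟩
      ⟨(h.linOrd.field _ _ had).2, hb, hdb, hbV⟩⟩

theorem not_inField_pow : ¬ InField c (pow s) := fun hf =>
  not_mem_self (pow s) (BoundedTheories.mem_pow.2 (h.sub _ hf))

/-- The chain of `s`, continued by `P(s)`, is a chain of `P(s)`. -/
theorem isLevel_pow : IsLevel (pow s) := by
  have hns := h.not_inField_pow
  have hnle : ∀ {a}, ¬ Le c (pow s) a := fun hle => hns (h.linOrd.field _ _ hle).1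
  have hnle' : ∀ {a}, ¬ Le c a (pow s) := fun hle => hns (h.linOrd.field _ _ hle).2
  have hbound : ∀ {a b}, Le c a b → a ε adj (fieldSet c) (pow s) ∧ b ε adj (fieldSet c) (pow s) :=
    fun hab => ⟨mem_adj.2 (Or.inl (mem_fieldSet.2 (h.linOrd.field _ _ hab).1)),
      mem_adj.2 (Or.inl (mem_fieldSet.2 (h.linOrd.field _ _ hab).2))⟩
  set d := graph (adj (fieldSet c) (pow s)) (adj (fieldSet c) (pow s))
    (fun a b => Le c a b ∨ b = pow s) with hd
  have le_d : ∀ {a b}, Le d a b ↔ Le c a b ∨ b = pow s ∧ (InField c a ∨ a = pow s) := by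
    intro a b
    rw [hd, le_graph]
    constructor
    · rintro ⟨ha, -, h | h⟩
      · exact Or.inl h
      · exact Or.inr ⟨h, by simpa using ha⟩
    · rintro (h | ⟨h, h'⟩)
      · exact ⟨(hbound h).1, (hbound h).2, Or.inl h⟩
      · exact ⟨by simpa using h', by simp [h], Or.inr h⟩
  have field_d : ∀ {a}, InField d a ↔ InField c a ∨ a = pow s := by
    intro a
    rw [InField, le_d]
    exact or_congr_right ⟨fun h => h.1, fun h => ⟨h, Or.inr h⟩⟩
  have hsub : ∀ {a}, InField d a → Sub a (pow s) := by
    intro a ha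
    rcases field_d.1 ha with ha | rfl
    · exact fun z hz => BoundedTheories.mem_pow.2 (h.transitive h.last.1 z (h.sub a ha z hz))
    · exact Sub.refl _
  refine ⟨d, ⟨?_, ?_, ?_, ?_, ?_⟩, fun a => hsub, ?_, ?_, ?_⟩
  · intro p hp
    obtain ⟨a, -, b, -, e, -⟩ := mem_graph.1 hp
    exact ⟨a, b, e⟩
  · intro a b hab
    rw [field_d, field_d]
    rcases le_d.1 hab with h' | ⟨h', h''⟩
    · exact ⟨Or.inl (h.linOrd.field _ _ h').1, Or.inl (h.linOrd.field _ _ h').2⟩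
    · exact ⟨h'', Or.inr h'⟩
  · intro a b hab hba
    rcases le_d.1 hab with h1 | ⟨rfl, h1⟩
    · rcases le_d.1 hba with h2 | ⟨rfl, h2⟩
      · exact h.linOrd.antisymm _ _ h1 h2
      · exact (hnle h1).elim
    · rcases le_d.1 hba with h2 | ⟨rfl, h2⟩
      · exact (hnle h2).elim
      · rfl
  · intro a b e hab hbe
    rw [le_d]
    rcases le_d.1 hbe with h2 | ⟨rfl, h2⟩
    · rcases le_d.1 hab with h1 | ⟨rfl, h1⟩
      · exact Or.inl (h.linOrd.trans _ _ _ h1 h2)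
      · exact (hnle h2).elim
    · refine Or.inr ⟨rfl, ?_⟩
      rcases le_d.1 hab with h1 | ⟨-, h1⟩
      exacts [Or.inl (h.linOrd.field _ _ h1).1, h1]
  · intro a b ha hb
    rw [field_d] at ha hb
    rw [le_d, le_d]
    rcases hb with hb | rfl
    · rcases ha with ha | rfl
      · rcases h.linOrd.total a b ha hb with h' | h'
        exacts [Or.inl (Or.inl h'), Or.inr (Or.inl h')]
      · exact Or.inr (Or.inr ⟨rfl, Or.inl hb⟩)
    · exact Or.inl (Or.inr ⟨rfl, ha⟩)
  · refine ⟨field_d.2 (Or.inl h.first.1), fun a ha => le_d.2 ?_⟩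
    rcases field_d.1 ha with ha | ha
    exacts [Or.inl (h.first.2 a ha), Or.inr ⟨ha, Or.inl h.first.1⟩]
  · exact ⟨field_d.2 (Or.inr rfl), fun a ha => le_d.2 (Or.inr ⟨rfl, field_d.1 ha⟩)⟩
  · rintro a b ⟨hab, hne, hn⟩
    rcases le_d.1 hab with h1 | ⟨rfl, h1⟩
    · exact h.next a b ⟨h1, hne, fun e hae heb => hn e (le_d.2 (Or.inl hae)) (le_d.2 (Or.inl heb))⟩
    · have ha := h1.resolve_right hne
      rcases hn s (le_d.2 (Or.inl (h.last.2 a ha))) (le_d.2 (Or.inr ⟨rfl, Or.inl h.last.1⟩)) with e | e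
      · rw [e]
      · exact (hns (e ▸ h.last.1)).elim

end IsLevelChain

theorem IsLevel.pow {s : M} (h : IsLevel s) : IsLevel (pow s) := h.choose_spec.isLevel_pow

theorem IsLevel.transitive {s x : M} (h : IsLevel s) (hx : x ε s) : Sub x s :=
  h.choose_spec.transitive h.choose_spec.last.1 x hx

theorem IsLevel.level_induction {P : M → Prop} [BddRel₁ M P] {s : M} (h : IsLevel s)
    (h0 : P (emp M)) (hs : ∀ V, IsLevel V → P V → P (BoundedTheories.pow V)) : P s := by
  obtain ⟨c, hc⟩ := h
  exact hc.chain_induction h0 (fun V hV _ => hs V (hc.isLevel hV)) hc.last.1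

/-- Two levels are comparable, because the chain of one of them extends the chain of the other. -/
theorem IsLevel.trichotomy {s t : M} (hs : IsLevel s) (ht : IsLevel t) :
    s ε t ∨ s = t ∨ t ε s := by
  obtain ⟨c, hc⟩ := hs
  obtain ⟨d, hd⟩ := ht
  have key : InField d s ∨ InField c t := by
    by_contra! hne
    refine hne.1 (hc.chain_induction (P := fun V => InField d V) hd.first.1 ?_ hc.last.1)
    intro V hV _ hVd
    have hVt : V ≠ t := by rintro rfl; exact hne.2 hV
    obtain ⟨W, hW⟩ := hd.linOrd.exists_next (hd.last.2 V hVd) hVt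
    rw [← hd.next _ _ hW]
    exact (hd.linOrd.field _ _ hW.1).2
  rcases key with h | h
  · rcases (hd.mono (hd.last.2 s h)).2 with h | h
    exacts [Or.inr (Or.inl h), Or.inl h]
  · rcases (hc.mono (hc.last.2 t h)).2 with h | h
    exacts [Or.inr (Or.inl h.symm), Or.inr (Or.inr h)]

theorem IsLevel.sub_total {s t : M} (hs : IsLevel s) (ht : IsLevel t) : Sub s t ∨ Sub t s := by
  rcases hs.trichotomy ht with h | rfl | h
  exacts [Or.inl (ht.transitive h), Or.inl (Sub.refl _), Or.inr (hs.transitive h)]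

end Levels

/-! ### The Ackermann ordering -/

section Ackermann

variable {M : Type u} [setLang.Structure M]

/-- `X` comes before or equals `Y` in the ordering `Lex(l)`. -/
def LexLe (l X Y : M) : Prop :=
  X = Y ∨ ∃ m, m ε Y ∧ ¬ m ε X ∧ ∀ c, c ε un X Y → ¬ (c ε X ↔ c ε Y) → Le l c m

/-- `l` is an ordering of `s` that agrees on `s` with its own lexicographical ordering. On a
level `s` this fixed point property characterizes `Ack(s)`, without reference to a chain. -/
def IsAckOrd (s l : M) : Prop :=
  (∀ p, p ε l → ∃ X, X ε s ∧ ∃ Y, Y ε s ∧ p = opair X Y) ∧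
    ∀ X, X ε s → ∀ Y, Y ε s → (Le l X Y ↔ LexLe l X Y)

/-- The Ackermann ordering of the universe, read off from the level `R({x, y})`. -/
def LeA (x y : M) : Prop :=
  ∃ l, l ε pow (pow (pow (rk (upair x y)))) ∧ IsAckOrd (rk (upair x y)) l ∧ Le l x y

variable [M ⊨ EAstar]

section Instances

variable {Γ : Type u} [Ctx M Γ] {f h k : Γ → M} [BddFun f] [BddFun h] [BddFun k]

instance : BddRel M (fun g => LexLe (f g) (h g) (k g)) :=
  inferInstanceAs (BddRel M fun g => h g = k g ∨ ∃ m, m ε k g ∧ ¬ m ε h g ∧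
    ∀ c, c ε un (h g) (k g) → ¬ (c ε h g ↔ c ε k g) → Le (f g) c m)

instance : BddRel M (fun g => IsAckOrd (f g) (h g)) :=
  inferInstanceAs (BddRel M fun g =>
    (∀ p, p ε h g → ∃ X, X ε f g ∧ ∃ Y, Y ε f g ∧ p = opair X Y) ∧
    ∀ X, X ε f g → ∀ Y, Y ε f g → (Le (h g) X Y ↔ LexLe (h g) X Y))

instance : BddRel M (fun g => LeA (f g) (h g)) :=
  inferInstanceAs (BddRel M fun g => ∃ l, l ε pow (pow (pow (rk (upair (f g) (h g))))) ∧
    IsAckOrd (rk (upair (f g) (h g))) l ∧ Le l (f g) (h g))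

end Instances

theorem lexLe_iff {l X Y : M} : LexLe l X Y ↔
    X = Y ∨ ∃ m, m ε Y ∧ ¬ m ε X ∧ ∀ c, ¬ (c ε X ↔ c ε Y) → Le l c m := by
  refine or_congr_right (exists_congr fun m => and_congr_right fun _ => and_congr_right fun _ =>
    forall_congr' fun c => ⟨fun h hc => h ?_ hc, fun h _ => h⟩)
  rw [mem_un]
  tauto

theorem LexLe.congr {l l' s X Y : M} (hX : Sub X s) (hY : Sub Y s)
    (h : ∀ a b, a ε s → b ε s → (Le l a b ↔ Le l' a b)) : LexLe l X Y ↔ LexLe l' X Y := by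
  refine or_congr_right (exists_congr fun m => and_congr_right fun hm => and_congr_right fun _ =>
    forall_congr' fun c => imp_congr_right fun hc => imp_congr_right fun _ => h c m ?_ (hY m hm))
  rcases mem_un.1 hc with hc | hc
  exacts [hX c hc, hY c hc]

theorem isLex_iff {l l' : M} : IsLex l l' ↔ (∀ p, p ε l' → ∃ X Y, p = opair X Y) ∧
    ∀ X Y, Le l' X Y ↔ Sub X (fieldSet l) ∧ Sub Y (fieldSet l) ∧ LexLe l X Y := by
  simp only [IsLex, lexLe_iff, Sub, mem_fieldSet]

namespace LexLe

variable {l X Y Z : M}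

theorem antisymm (hl : IsLinOrd l) (h : LexLe l X Y) (h' : LexLe l Y X) : X = Y := by
  rw [lexLe_iff] at h h'
  rcases h with h | ⟨m, hm, hm', hmax⟩
  · exact h
  rcases h' with h' | ⟨n, hn, hn', hmax'⟩
  · exact h'.symm
  have e : m = n := hl.antisymm _ _ (hmax' m (by tauto)) (hmax n (by tauto))
  exact (hm' (e ▸ hn)).elim

theorem trans (hl : IsLinOrd l) (h : LexLe l X Y) (h' : LexLe l Y Z) : LexLe l X Z := by
  rw [lexLe_iff] at h h' ⊢
  rcases h with rfl | ⟨m, hm, hm', hmax⟩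
  · exact h'
  rcases h' with rfl | ⟨n, hn, hn', hmax'⟩
  · exact Or.inr ⟨m, hm, hm', hmax⟩
  have hne : m ≠ n := by rintro rfl; exact hn' hm
  have hmf := (hl.field _ _ (hmax m (by tauto))).1
  have hnf := (hl.field _ _ (hmax' n (by tauto))).1
  right
  rcases hl.total m n hmf hnf with hmn | hnm
  · refine ⟨n, hn, fun hnX => hne (hl.antisymm _ _ hmn (hmax n (by tauto))), fun c hc => ?_⟩
    by_cases hc' : c ε X ↔ c ε Y
    · exact hmax' c (by tauto)
    · exact hl.trans _ _ _ (hmax c hc') hmn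
  · refine ⟨m, ?_, hm', fun c hc => ?_⟩
    · by_contra hmZ
      exact hne (hl.antisymm _ _ (hmax' m (by tauto)) hnm)
    · by_cases hc' : c ε X ↔ c ε Y
      · exact hl.trans _ _ _ (hmax' c (by tauto)) hnm
      · exact hmax c hc'

theorem total (hl : IsLinOrd l) (hX : ∀ z, z ε X → InField l z) (hY : ∀ z, z ε Y → InField l z) :
    LexLe l X Y ∨ LexLe l Y X := by
  by_cases e : X = Y
  · exact Or.inl (Or.inl e)
  obtain ⟨m, hm, hmax⟩ := hl.exists_greatest (a := compr (un X Y) fun c => ¬ (c ε X ↔ c ε Y))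
    (fun z hz => by
      simp only [mem_compr, mem_un] at hz
      exact hz.1.elim (hX z) (hY z)) (by
      by_contra! h
      refine e (set_ext fun z => ?_)
      have := h z
      simp only [mem_compr, mem_un] at this
      tauto)
  simp only [mem_compr, mem_un] at hm hmax
  rw [lexLe_iff, lexLe_iff]
  by_cases hmY : m ε Y
  · exact Or.inl (Or.inr ⟨m, hmY, by tauto, fun c hc => hmax c (by tauto)⟩)
  · exact Or.inr (Or.inr ⟨m, by tauto, by tauto, fun c hc => hmax c (by tauto)⟩)

end LexLe

namespace IsAckOrd

variable {s t l l' a b : M}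

theorem mem_of_le (h : IsAckOrd s l) (hab : Le l a b) : a ε s ∧ b ε s := by
  obtain ⟨X, hX, Y, hY, e⟩ := h.1 _ hab
  obtain ⟨rfl, rfl⟩ := opair_inj.1 e
  exact ⟨hX, hY⟩

theorem inField_iff (h : IsAckOrd s l) : InField l a ↔ a ε s :=
  ⟨fun ha => (h.mem_of_le ha).1, fun ha => (h.2 a ha a ha).2 (Or.inl rfl)⟩

theorem fieldSet_eq (h : IsAckOrd s l) : fieldSet l = s :=
  set_ext fun z => by rw [mem_fieldSet, h.inField_iff]

theorem ext (h : IsAckOrd s l) (h' : IsAckOrd s l')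
    (H : ∀ a b, a ε s → b ε s → (Le l a b ↔ Le l' a b)) : l = l' := by
  refine set_ext fun p => ⟨fun hp => ?_, fun hp => ?_⟩
  · obtain ⟨X, hX, Y, hY, rfl⟩ := h.1 p hp
    exact (H X Y hX hY).1 hp
  · obtain ⟨X, hX, Y, hY, rfl⟩ := h'.1 p hp
    exact (H X Y hX hY).2 hp

theorem mem_pow (h : IsAckOrd s l) : l ε BoundedTheories.pow (pow (pow s)) :=
  BoundedTheories.mem_pow.2 fun p hp => by
    obtain ⟨X, hX, Y, hY, rfl⟩ := h.1 p hp
    exact opair_mem_pow hX hY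

theorem restrict (h : IsAckOrd t l) (hs : IsLevel s) (hst : Sub s t) :
    IsAckOrd s (graph s s (Le l)) := by
  refine ⟨fun p hp => ?_, fun X hX Y hY => ?_⟩
  · obtain ⟨a, ha, b, hb, e, -⟩ := mem_graph.1 hp
    exact ⟨a, ha, b, hb, e⟩
  · rw [le_graph, h.2 X (hst X hX) Y (hst Y hY)]
    refine (and_iff_right hX).trans ((and_iff_right hY).trans
      (LexLe.congr (hs.transitive hX) (hs.transitive hY) fun a b ha hb => ?_))
    simp [le_graph, ha, hb]

theorem isLinOrd_lex (h : IsLinOrd l) (hlex : IsLex l l') : IsLinOrd l' := by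
  rw [isLex_iff] at hlex
  refine ⟨hlex.1, ?_, ?_, ?_, ?_⟩
  all_goals simp only [InField, hlex.2]
  · exact fun a b ⟨h1, h2, _⟩ => ⟨⟨h1, h1, Or.inl rfl⟩, h2, h2, Or.inl rfl⟩
  · exact fun a b ⟨_, _, h1⟩ ⟨_, _, h2⟩ => h1.antisymm h h2
  · exact fun a b c ⟨ha, _, h1⟩ ⟨_, hc, h2⟩ => ⟨ha, hc, h1.trans h h2⟩
  · intro a b ⟨ha, _⟩ ⟨hb, _⟩
    rcases LexLe.total h (fun z hz => mem_fieldSet.1 (ha z hz))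
      (fun z hz => mem_fieldSet.1 (hb z hz)) with h' | h'
    exacts [Or.inl ⟨ha, hb, h'⟩, Or.inr ⟨hb, ha, h'⟩]

/-- `Lex(l)` has the fixed point property on `P(s)` when `l` has it on `s`, because `Lex(l)` then extends
`l`. -/
theorem lex (hs : IsLevel s) (h : IsAckOrd s l) (hlex : IsLex l l') :
    IsAckOrd (pow s) l' := by
  rw [isLex_iff, h.fieldSet_eq] at hlex
  refine ⟨fun p hp => ?_, fun X hX Y hY => ?_⟩
  · obtain ⟨X, Y, rfl⟩ := hlex.1 p hp
    have := (hlex.2 X Y).1 hp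
    exact ⟨X, BoundedTheories.mem_pow.2 this.1, Y, BoundedTheories.mem_pow.2 this.2.1, rfl⟩
  · rw [BoundedTheories.mem_pow] at hX hY
    rw [hlex.2]
    refine (and_iff_right hX).trans ((and_iff_right hY).trans (LexLe.congr hX hY fun a b ha hb => ?_))
    rw [hlex.2, h.2 a ha b hb]
    exact (and_iff_right (hs.transitive ha)).trans (and_iff_right (hs.transitive hb)) |>.symm

theorem isLex_graph (h : IsAckOrd s l) : IsLex l (graph (pow s) (pow s) (LexLe l)) := by
  rw [isLex_iff, h.fieldSet_eq]
  refine ⟨fun p hp => ?_, fun X Y => ?_⟩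
  · obtain ⟨a, -, b, -, e, -⟩ := mem_graph.1 hp
    exact ⟨a, b, e⟩
  · rw [le_graph, BoundedTheories.mem_pow, BoundedTheories.mem_pow]

/-- The fixed point on a level is unique: two of them on `P(V)` restrict to fixed points on `V`, and are
the lexicographical orderings of these restrictions. -/
theorem unique (hs : IsLevel s) (h : IsAckOrd s l) (h' : IsAckOrd s l') : l = l' := by
  refine hs.level_induction (P := fun s => ∀ l, l ε pow (pow (pow s)) →
    ∀ l', l' ε pow (pow (pow s)) → IsAckOrd s l → IsAckOrd s l' → l = l') ?_ ?_
    l h.mem_pow l' h'.mem_pow h h'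
  · intro l _ l' _ h h'
    exact h.ext h' fun a b ha => (not_mem_emp a ha).elim
  · intro V hV IH l _ l' _ h h'
    have hsub : Sub V (BoundedTheories.pow V) := fun x hx =>
      BoundedTheories.mem_pow.2 (hV.transitive hx)
    have hr := h.restrict hV hsub
    have hr' := h'.restrict hV hsub
    have e := IH _ hr.mem_pow _ hr'.mem_pow hr hr'
    have hle : ∀ a b, a ε V → b ε V → (Le l a b ↔ Le l' a b) := fun a b ha hb => by
      have : Le (graph V V (Le l)) a b ↔ Le (graph V V (Le l')) a b := by rw [e]
      simpa [le_graph, ha, hb] using this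
    refine h.ext h' fun a b ha hb => ?_
    rw [h.2 a ha b hb, h'.2 a ha b hb]
    exact LexLe.congr (BoundedTheories.mem_pow.1 ha) (BoundedTheories.mem_pow.1 hb) hle

theorem exists_isLinOrd (hs : IsLevel s) : ∃ l, IsAckOrd s l ∧ IsLinOrd l := by
  suffices h : ∃ l, l ε pow (pow (pow s)) ∧ IsAckOrd s l ∧ IsLinOrd l by
    obtain ⟨l, -, h⟩ := h
    exact ⟨l, h⟩
  refine hs.level_induction
    (P := fun s => ∃ l, l ε pow (pow (pow s)) ∧ IsAckOrd s l ∧ IsLinOrd l) ?_ ?_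
  · have hle : ∀ a b : M, ¬ Le (emp M) a b := fun a b => not_mem_emp _
    have hpair : ∀ p, ¬ p ε emp M := not_mem_emp
    refine ⟨emp M, BoundedTheories.mem_pow.2 (emp_sub _),
      ⟨fun p hp => (hpair p hp).elim, fun X hX => (hpair X hX).elim⟩,
      ⟨fun p hp => (hpair p hp).elim, ?_, ?_, ?_, ?_⟩⟩
    all_goals simp [InField, hle]
  · rintro V hV ⟨l, -, h, hlin⟩
    have := h.lex hV h.isLex_graph
    exact ⟨_, this.mem_pow, this, isLinOrd_lex hlin h.isLex_graph⟩

theorem isLinOrd (hs : IsLevel s) (h : IsAckOrd s l) : IsLinOrd l := by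
  obtain ⟨l', h', hl⟩ := exists_isLinOrd hs
  rwa [h.unique hs h']

theorem isLex (hs : IsLevel s) (h : IsAckOrd s l) (h' : IsAckOrd (pow s) l') : IsLex l l' := by
  rw [h'.unique hs.pow (h.lex hs h.isLex_graph)]
  exact h.isLex_graph

end IsAckOrd

/-! #### The ordering of the universe -/

theorem mem_rk_upair (x y : M) : x ε rk (upair x y) ∧ y ε rk (upair x y) := by
  have h := (isLevel_rk (upair x y)).transitive (mem_rk _)
  exact ⟨h x (by simp), h y (by simp)⟩

/-- The ordering of a level agrees with the ordering of the universe, since one of the levels `s` and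
`R({x, y})` contains the other. -/
theorem IsAckOrd.le_iff {s l x y : M} (hs : IsLevel s) (h : IsAckOrd s l) (hx : x ε s)
    (hy : y ε s) : Le l x y ↔ LeA x y := by
  set r := rk (upair x y) with hr
  have hrl : IsLevel r := isLevel_rk _
  obtain ⟨hxr, hyr⟩ : x ε r ∧ y ε r := mem_rk_upair x y
  obtain ⟨k, hk, -⟩ := IsAckOrd.exists_isLinOrd hrl
  have h1 : LeA x y ↔ Le k x y :=
    ⟨fun ⟨l', _, hl', hle⟩ => hl'.unique hrl hk ▸ hle, fun hle => ⟨k, hk.mem_pow, hk, hle⟩⟩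
  rw [h1]
  rcases hs.sub_total hrl with hsr | hrs
  · rw [h.unique hs (hk.restrict hs hsr)]
    simp [le_graph, hx, hy]
  · rw [hk.unique hrl (h.restrict hrl hrs)]
    simp [le_graph, hxr, hyr]

/-- Any three sets occur together in a level. -/
theorem exists_level (x y z : M) : ∃ s, IsLevel s ∧ x ε s ∧ y ε s ∧ z ε s := by
  obtain ⟨h1, h2⟩ := mem_rk_upair x (upair y z)
  have h := (isLevel_rk (upair x (upair y z))).transitive h2
  exact ⟨_, isLevel_rk _, h1, h y (by simp), h z (by simp)⟩

namespace LeA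

variable {x y z : M}

theorem refl (x : M) : LeA x x := by
  obtain ⟨l, h, hl⟩ := IsAckOrd.exists_isLinOrd (isLevel_rk x)
  exact (h.le_iff (isLevel_rk x) (mem_rk x) (mem_rk x)).1 (h.inField_iff.2 (mem_rk x))

theorem antisymm (h : LeA x y) (h' : LeA y x) : x = y := by
  obtain ⟨s, hs, hx, hy, -⟩ := exists_level x y y
  obtain ⟨l, hl, hlin⟩ := IsAckOrd.exists_isLinOrd hs
  exact hlin.antisymm _ _ ((hl.le_iff hs hx hy).2 h) ((hl.le_iff hs hy hx).2 h')

theorem trans (h : LeA x y) (h' : LeA y z) : LeA x z := by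
  obtain ⟨s, hs, hx, hy, hz⟩ := exists_level x y z
  obtain ⟨l, hl, hlin⟩ := IsAckOrd.exists_isLinOrd hs
  exact (hl.le_iff hs hx hz).1
    (hlin.trans _ _ _ ((hl.le_iff hs hx hy).2 h) ((hl.le_iff hs hy hz).2 h'))

theorem total (x y : M) : LeA x y ∨ LeA y x := by
  obtain ⟨s, hs, hx, hy, -⟩ := exists_level x y y
  obtain ⟨l, hl, hlin⟩ := IsAckOrd.exists_isLinOrd hs
  rw [← hl.le_iff hs hx hy, ← hl.le_iff hs hy hx]
  exact hlin.total _ _ (hl.inField_iff.2 hx) (hl.inField_iff.2 hy)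

theorem lex_iff : LeA x y ↔
    x = y ∨ ∃ m, m ε y ∧ ¬ m ε x ∧ ∀ c, ¬ (c ε x ↔ c ε y) → LeA c m := by
  obtain ⟨s, hs, hx, hy, -⟩ := exists_level x y y
  obtain ⟨l, hl, -⟩ := IsAckOrd.exists_isLinOrd hs
  rw [← hl.le_iff hs hx hy, hl.2 x hx y hy, lexLe_iff]
  refine or_congr_right (exists_congr fun m => and_congr_right fun hm => and_congr_right fun _ =>
    forall_congr' fun c => imp_congr_right fun hc => hl.le_iff hs ?_ (hs.transitive hy m hm))
  by_cases hcx : c ε x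
  · exact hs.transitive hx c hcx
  · exact hs.transitive hy c (by tauto)

theorem emp (x : M) : LeA (emp M) x := by
  by_contra h
  have h' := (total (BoundedTheories.emp M) x).resolve_left h
  rcases lex_iff.1 h' with rfl | ⟨m, hm, -⟩
  · exact h h'
  · exact not_mem_emp m hm

/-- The ordering of a level is an initial segment of the ordering of the universe. -/
theorem mem_level {s : M} (hs : IsLevel s) (hy : y ε s) (h : LeA x y) : x ε s := by
  obtain ⟨t, ht, hx, -⟩ := exists_level x y y
  refine hs.level_induction (P := fun s => ∀ y, y ε s → ∀ x, x ε t → LeA x y → x ε s) ?_ ?_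
    y hy x hx h
  · intro y hy
    exact (not_mem_emp y hy).elim
  · intro V _ IH Y hY X hX hle
    rw [mem_pow] at hY ⊢
    rcases lex_iff.1 hle with rfl | ⟨m, hm, -, hmax⟩
    · exact hY
    -- an element of `X` outside `V` would come before `m ∈ V`
    intro w hw
    by_contra hwV
    have hwY : ¬ w ε Y := fun h => hwV (hY w h)
    exact hwV (IH m (hY m hm) w (ht.transitive hX w hw) (hmax w (by tauto)))

end LeA

theorem isAckOrd_graph {s : M} (hs : IsLevel s) : IsAckOrd s (graph s s LeA) := by
  obtain ⟨l, h, -⟩ := IsAckOrd.exists_isLinOrd hs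
  convert h using 1
  refine set_ext fun p => ⟨fun hp => ?_, fun hp => ?_⟩
  · obtain ⟨a, ha, b, hb, rfl, hab⟩ := mem_graph.1 hp
    exact (h.le_iff hs ha hb).2 hab
  · obtain ⟨a, ha, b, hb, rfl⟩ := h.1 p hp
    exact opair_mem_graph.2 ⟨ha, hb, (h.le_iff hs ha hb).1 hp⟩

theorem isAckOrd_iff {s l : M} (hs : IsLevel s) : IsAckOrd s l ↔ l = graph s s LeA :=
  ⟨fun h => h.unique hs (isAckOrd_graph hs), fun h => h ▸ isAckOrd_graph hs⟩

/-! #### Comparison with the recursive definition -/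

/-- Every value of the recursion has the fixed point property, by induction along the chain. -/
theorem IsAckFun.isAckOrd {c s A V l : M} (hc : IsLevelChain c s) (hA : IsAckFun c s A)
    (h : opair V l ε A) : IsAckOrd V l := by
  have hV := (hA.dom V).2 ⟨l, h⟩
  refine hc.chain_induction
    (P := fun V => ∀ l, l ε sUn (sUn A) → opair V l ε A → IsAckOrd V l) ?_ ?_ hV l
    (Le.mem_sUn (l := A) h).2 h
  · intro l _ hl
    rw [hA.unique _ _ _ hl hA.zero]
    exact ⟨fun p hp => (not_mem_emp p hp).elim, fun X hX => (not_mem_emp X hX).elim⟩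
  · intro V hV hn IH l' _ hl'
    obtain ⟨l, hl⟩ := (hA.dom V).1 hV
    exact (IH l (Le.mem_sUn (l := A) hl).2 hl).lex (hc.isLevel hV) (hA.succ _ _ _ _ hn hl hl')

/-- The map that sends `V` to the ordering characterized by the fixed point property satisfies the
recursion for `Ack`. -/
theorem isAckFun_graph {c s : M} (hc : IsLevelChain c s) :
    IsAckFun c s (graph (pow s) (pow (pow (pow s))) fun V l => InField c V ∧ IsAckOrd V l) := by
  have hbound : ∀ {V l}, InField c V → IsAckOrd V l → V ε pow s ∧ l ε pow (pow (pow s)) := by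
    intro V l hV hl
    refine ⟨mem_pow.2 (hc.sub V hV), mem_pow.2 fun p hp => ?_⟩
    obtain ⟨X, hX, Y, hY, rfl⟩ := hl.1 p hp
    exact opair_mem_pow (hc.sub V hV X hX) (hc.sub V hV Y hY)
  have hmem : ∀ {V l}, opair V l ε (graph (pow s) (pow (pow (pow s))) fun V l =>
      InField c V ∧ IsAckOrd V l) ↔ InField c V ∧ IsAckOrd V l := by
    intro V l
    rw [opair_mem_graph]
    exact ⟨fun h => h.2.2, fun h => ⟨(hbound h.1 h.2).1, (hbound h.1 h.2).2, h⟩⟩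
  refine ⟨fun p hp => ?_, fun V => ⟨fun hV => ?_, ?_⟩, ?_, ?_, ?_, ?_⟩
  · obtain ⟨a, -, b, -, e, -⟩ := mem_graph.1 hp
    exact ⟨a, b, e⟩
  · exact ⟨_, hmem.2 ⟨hV, isAckOrd_graph (hc.isLevel hV)⟩⟩
  · rintro ⟨l, hl⟩
    exact (hmem.1 hl).1
  · intro V l l' hl hl'
    rw [hmem] at hl hl'
    exact hl.2.unique (hc.isLevel hl.1) hl'.2
  · intro V l hl
    rw [hmem] at hl
    exact ⟨hl.2.isLinOrd (hc.isLevel hl.1), fun a ha => hc.sub V hl.1 a (hl.2.inField_iff.1 ha)⟩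
  · exact hmem.2 ⟨hc.first.1, fun p hp => (not_mem_emp p hp).elim,
      fun X hX => (not_mem_emp X hX).elim⟩
  · intro V W l l' hn hl hl'
    rw [hmem] at hl hl'
    obtain rfl := hc.next V W hn
    exact hl.2.isLex (hc.isLevel hl.1) hl'.2

theorem isAck_iff {s l : M} (hs : IsLevel s) : IsAck s l ↔ l = graph s s LeA := by
  constructor
  · rintro ⟨c, A, hc, hA, h⟩
    exact (isAckOrd_iff hs).1 (hA.isAckOrd hc h)
  · rintro rfl
    obtain ⟨c, hc⟩ := hs
    refine ⟨c, _, hc, isAckFun_graph hc, ?_⟩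
    have h := isAckOrd_graph (hc.isLevel hc.last.1)
    exact opair_mem_graph.2 ⟨mem_pow.2 (Sub.refl s), h.mem_pow, hc.last.1, h⟩

theorem isAck_existsUnique {s : M} (hs : IsLevel s) : (∃! l, IsAck s l) ∧
    ∀ l, IsAck s l → IsLinOrd l ∧ ∀ a, InField l a ↔ a ε s := by
  refine ⟨⟨graph s s LeA, (isAck_iff hs).2 rfl, fun l hl => (isAck_iff hs).1 hl⟩, fun l hl => ?_⟩
  have := (isAckOrd_iff hs).2 ((isAck_iff hs).1 hl)
  exact ⟨this.isLinOrd hs, fun a => this.inField_iff⟩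

theorem ltA_iff {x y : M} : LtA x y ↔ LeA x y ∧ x ≠ y := by
  have hy := isLevel_rk y
  constructor
  · rintro ⟨-, l, hl, hle, hne⟩
    rw [isAck_iff hy] at hl
    exact ⟨(opair_mem_graph.1 (hl ▸ hle)).2.2, hne⟩
  · rintro ⟨hle, hne⟩
    have hx := hle.mem_level hy (mem_rk y)
    exact ⟨rk_sub hx hy, _, (isAck_iff hy).2 rfl, opair_mem_graph.2 ⟨hx, mem_rk y, hle⟩, hne⟩

instance BddRel.ltA {Γ : Type u} [Ctx M Γ] {f h : Γ → M} [BddFun f] [BddFun h] :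
    BddRel M (fun g => LtA (f g) (h g)) :=
  (inferInstance : BddRel M fun g => LeA (f g) (h g) ∧ f g ≠ h g).congr fun _ => ltA_iff

theorem leA_iff {x y : M} : LeA x y ↔ LtA x y ∨ x = y := by
  rw [ltA_iff]
  refine ⟨fun h => ?_, ?_⟩
  · by_cases e : x = y
    exacts [Or.inr e, Or.inl ⟨h, e⟩]
  · rintro (h | rfl)
    exacts [h.1, LeA.refl x]

theorem not_leA {x y : M} : ¬ LeA x y ↔ LtA y x := by
  rw [ltA_iff]
  constructor
  · intro h
    exact ⟨(LeA.total x y).resolve_left h, by rintro rfl; exact h (LeA.refl y)⟩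
  · rintro ⟨h, hne⟩ h'
    exact hne (h.antisymm h')

theorem isStrictTotalOrder_ltA : IsStrictTotalOrder M LtA where
  irrefl x h := (ltA_iff.1 h).2 rfl
  trans x y z h h' := by
    rw [ltA_iff] at *
    refine ⟨h.1.trans h'.1, ?_⟩
    rintro rfl
    exact h.2 (h.1.antisymm h'.1)
  trichotomous x y h h' := by
    rw [← not_leA, not_not] at h h'
    exact h'.antisymm h

/-! #### The successor -/

/-- `z` is the immediate successor of `x` in the ordering of the universe. -/
def NextA (x z : M) : Prop :=
  LeA x z ∧ x ≠ z ∧ ∀ c, c ε rk z → LeA x c → LeA c z → c = x ∨ c = z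

instance {Γ : Type u} [Ctx M Γ] {f h : Γ → M} [BddFun f] [BddFun h] :
    BddRel M (fun g => NextA (f g) (h g)) :=
  inferInstanceAs (BddRel M fun g => LeA (f g) (h g) ∧ f g ≠ h g ∧
    ∀ c, c ε rk (h g) → LeA (f g) c → LeA c (h g) → c = f g ∨ c = h g)

theorem NextA.leA_iff_ltA {x z c : M} (h : NextA x z) : LeA c x ↔ LtA c z := by
  rw [ltA_iff]
  constructor
  · intro hc
    refine ⟨hc.trans h.1, ?_⟩
    rintro rfl
    exact h.2.1 (h.1.antisymm hc)
  · rintro ⟨hc, hne⟩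
    rcases LeA.total c x with h' | h'
    · exact h'
    · rw [(h.2.2 c (hc.mem_level (isLevel_rk z) (mem_rk z)) h' hc).resolve_right hne]
      exact LeA.refl x

theorem isSuccA_iff {x z : M} : IsSuccA x z ↔ NextA x z := by
  have hp := (isLevel_rk x).pow
  have hx : x ε pow (rk x) := mem_pow.2 ((isLevel_rk x).transitive (mem_rk x))
  constructor
  · rintro ⟨l, hl, hn⟩
    rw [isAck_iff hp] at hl
    subst hl
    simp only [Next, le_graph] at hn
    exact ⟨hn.1.2.2, hn.2.1, fun c _ h h' =>
      have hc := h'.mem_level hp hn.1.2.1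
      hn.2.2 c ⟨hx, hc, h⟩ ⟨hc, hn.1.2.1, h'⟩⟩
  · intro h
    have hz : z ε pow (rk x) := by
      have hr : rk x ε pow (rk x) := mem_pow.2 (Sub.refl _)
      by_contra hz
      have h1 : LeA (rk x) z := by
        by_contra h'
        exact hz (((LeA.total _ _).resolve_left h').mem_level hp hr)
      have h2 : LtA (rk x) z := ltA_iff.2 ⟨h1, by rintro rfl; exact hz hr⟩
      exact not_mem_self _ ((h.leA_iff_ltA.2 h2).mem_level (isLevel_rk x) (mem_rk x))
    refine ⟨_, (isAck_iff hp).2 rfl, ?_⟩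
    simp only [Next, le_graph]
    exact ⟨⟨hx, hz, h.1⟩, h.2.1, fun c h1 h2 =>
      h.2.2 c (h2.2.2.mem_level (isLevel_rk z) (mem_rk z)) h1.2.2 h2.2.2⟩

theorem isSuccA_existsUnique (x : M) : ∃! z, IsSuccA x z := by
  have hp := (isLevel_rk x).pow
  have hx : x ε pow (rk x) := mem_pow.2 ((isLevel_rk x).transitive (mem_rk x))
  have hr : rk x ε pow (rk x) := mem_pow.2 (Sub.refl _)
  have hA := isAckOrd_graph hp
  have hlin := hA.isLinOrd hp
  have hle : LeA x (rk x) := by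
    by_contra h
    exact not_mem_self _ (((LeA.total _ _).resolve_left h).mem_level (isLevel_rk x) (mem_rk x))
  have hne : x ≠ rk x := fun e => by
    have h := mem_rk x
    rw [← e] at h
    exact not_mem_self x h
  obtain ⟨z, hz⟩ := hlin.exists_next (le_graph.2 ⟨hx, hr, hle⟩) hne
  refine ⟨z, ⟨_, (isAck_iff hp).2 rfl, hz⟩, fun z' hz' => ?_⟩
  have h1 := isSuccA_iff.1 ⟨_, (isAck_iff hp).2 rfl, hz⟩
  have h2 := isSuccA_iff.1 hz'
  refine LeA.antisymm ?_ ?_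
  · by_contra h
    have h3 := h2.leA_iff_ltA.2 (not_leA.1 h)
    exact h1.2.1 (h1.1.antisymm h3)
  · by_contra h
    have h3 := h1.leA_iff_ltA.2 (not_leA.1 h)
    exact h2.2.1 (h2.1.antisymm h3)

end Ackermann

/-! ### Cardinal arithmetic -/

section Cardinals

variable {M : Type u} [setLang.Structure M]

/-- The set `{∅}`. -/
def one : M := upair (emp M) (emp M)

/-- The disjoint union `(a × {∅}) ∪ (b × {{∅}})`. -/
noncomputable def csum (a b : M) : M :=
  compr (pow (pow (un (un a b) (upair (emp M) one)))) fun p =>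
    (∃ u, u ε a ∧ p = opair u (emp M)) ∨ ∃ u, u ε b ∧ p = opair u one

/-- The product `a × b`. -/
noncomputable def cprod (a b : M) : M :=
  compr (pow (pow (un a b))) fun p => ∃ u, u ε a ∧ ∃ v, v ε b ∧ p = opair u v

/-- The set of functions from `b` to `a`. -/
noncomputable def cexp (a b : M) : M :=
  compr (pow (pow (pow (un b a)))) fun f => IsFun f b a

/-- The nonempty sets that come before or equal `x` in the ordering of the universe. -/
noncomputable def seg (x : M) : M := compr (rk x) fun w => w ≠ emp M ∧ LeA w x

variable [M ⊨ EAstar]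

section Instances

variable {Γ : Type u} [Ctx M Γ] {f h : Γ → M} [BddFun f] [BddFun h]

instance : BddFun (fun g => csum (f g) (h g)) :=
  inferInstanceAs (BddFun fun g =>
    compr (pow (pow (un (un (f g) (h g)) (upair (emp M) one)))) fun p =>
    (∃ u, u ε f g ∧ p = opair u (emp M)) ∨ ∃ u, u ε h g ∧ p = opair u one)

instance : BddFun (fun g => cprod (f g) (h g)) :=
  inferInstanceAs (BddFun fun g =>
    compr (pow (pow (un (f g) (h g)))) fun p => ∃ u, u ε f g ∧ ∃ v, v ε h g ∧ p = opair u v)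

instance : BddFun (fun g => cexp (f g) (h g)) :=
  inferInstanceAs (BddFun fun g =>
    compr (pow (pow (pow (un (h g) (f g))))) fun k => IsFun k (h g) (f g))

instance : BddFun (fun g => seg (f g)) :=
  inferInstanceAs (BddFun fun g => compr (rk (f g)) fun w => w ≠ emp M ∧ LeA w (f g))

end Instances

@[simp] theorem mem_one {z : M} : z ε (one : M) ↔ z = emp M := by simp [one]

theorem one_ne_emp : (one : M) ≠ emp M := ne_emp_iff.2 ⟨emp M, by simp⟩

@[simp] theorem mem_csum {a b p : M} : p ε csum a b ↔
    (∃ u, u ε a ∧ p = opair u (emp M)) ∨ ∃ u, u ε b ∧ p = opair u one := by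
  rw [csum, mem_compr, and_iff_right_of_imp]
  rintro (⟨u, hu, rfl⟩ | ⟨u, hu, rfl⟩) <;> exact opair_mem_pow (by simp [hu]) (by simp)

@[simp] theorem mem_cprod {a b p : M} : p ε cprod a b ↔
    ∃ u, u ε a ∧ ∃ v, v ε b ∧ p = opair u v := by
  rw [cprod, mem_compr, and_iff_right_of_imp]
  rintro ⟨u, hu, v, hv, rfl⟩
  exact opair_mem_pow (by simp [hu]) (by simp [hv])

@[simp] theorem mem_cexp {a b f : M} : f ε cexp a b ↔ IsFun f b a := by
  rw [cexp, mem_compr, and_iff_right_of_imp]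
  exact fun h => h.mem_pow

theorem isCardSum_iff {a b d : M} : IsCardSum a b d ↔ d = csum a b := by
  rw [IsCardSum]
  refine ⟨fun h => set_ext fun p => by rw [h p, mem_csum, one], ?_⟩
  rintro rfl p
  rw [mem_csum, one]

theorem isCardProd_iff {a b d : M} : IsCardProd a b d ↔ d = cprod a b := by
  have key : ∀ p, p ε cprod a b ↔ ∃ u v, u ε a ∧ v ε b ∧ p = opair u v := fun p => by
    simp only [mem_cprod, ← exists_and_left]
  rw [IsCardProd]
  refine ⟨fun h => set_ext fun p => by rw [h p, key], ?_⟩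
  rintro rfl p
  exact key p

theorem isCardExp_iff {a b d : M} : IsCardExp a b d ↔ d = cexp a b := by
  refine ⟨fun h => set_ext fun p => by rw [h p, mem_cexp], ?_⟩
  rintro rfl p
  exact mem_cexp

/-- A bounded relation that is a one-to-one correspondence between `a` and `b` shows that they
have the same cardinality. -/
theorem cardEq_of_rel {a b : M} (R : M → M → Prop) [BddRel₂ M R]
    (hex : ∀ u, u ε a → ∃ v, v ε b ∧ R u v) (hex' : ∀ v, v ε b → ∃ u, u ε a ∧ R u v)
    (huniq : ∀ u v w, R u v → R u w → v = w) (hinj : ∀ u u' v, R u v → R u' v → u = u') :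
    CardEq a b :=
  ⟨cardLe_of_rel R hex (fun u v w _ => huniq u v w) fun u u' v _ _ => hinj u u' v,
    cardLe_of_rel (fun v u => R u v) hex' (fun v u u' _ => hinj u u' v)
      fun v v' u _ _ => huniq u v v'⟩

theorem csum_emp (a : M) : CardEq (csum a (emp M)) a := by
  refine cardEq_of_rel (fun p u => p = opair u (emp M)) ?_ ?_ ?_ ?_
  · intro p hp
    simpa using hp
  · intro u hu
    exact ⟨_, by simp [hu], rfl⟩
  · rintro p u v rfl h
    simpa using h
  · rintro p q v rfl rfl
    rfl

theorem csum_adj (a b y : M) : csum a (adj b y) = adj (csum a b) (opair y one) := by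
  refine set_ext fun p => ?_
  simp only [mem_csum, mem_adj, or_assoc]
  refine or_congr_right ⟨?_, ?_⟩
  · rintro ⟨u, hu | rfl, rfl⟩
    exacts [Or.inl ⟨u, hu, rfl⟩, Or.inr rfl]
  · rintro (⟨u, hu, rfl⟩ | rfl)
    exacts [⟨u, Or.inl hu, rfl⟩, ⟨y, Or.inr rfl, rfl⟩]

theorem CardLe.csum_left {a a' : M} (h : CardLe a a') (b : M) :
    CardLe (csum a b) (csum a' b) := by
  obtain ⟨f, hf, h1⟩ := h
  have hne := one_ne_emp (M := M)
  refine cardLe_of_rel (fun p q =>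
    (∃ u, u ε a ∧ ∃ v, v ε a' ∧ p = opair u (emp M) ∧ q = opair v (emp M) ∧ opair u v ε f) ∨
      ∃ u, u ε b ∧ p = opair u one ∧ q = opair u one) ?_ ?_ ?_
  · intro p hp
    rcases mem_csum.1 hp with ⟨u, hu, rfl⟩ | ⟨u, hu, rfl⟩
    · obtain ⟨v, hv, -⟩ := hf.2 u hu
      have := (hf.mem hv).2
      exact ⟨opair v (emp M), by simp [this], Or.inl ⟨u, hu, v, this, rfl, rfl, hv⟩⟩
    · exact ⟨opair u one, by simp [hu], Or.inr ⟨u, hu, rfl, rfl⟩⟩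
  · rintro p q q' - (⟨u, -, v, -, rfl, rfl, h⟩ | ⟨u, -, rfl, rfl⟩)
      (⟨u', -, v', -, e, rfl, h'⟩ | ⟨u', -, e, rfl⟩) <;> simp only [opair_inj] at e
    · obtain ⟨rfl, -⟩ := e
      rw [hf.unique h h']
    · exact (hne e.2.symm).elim
    · exact (hne e.2).elim
    · rw [e.1]
  · rintro p p' q - - (⟨u, -, v, -, rfl, rfl, h⟩ | ⟨u, -, rfl, rfl⟩)
      (⟨u', -, v', -, rfl, e, h'⟩ | ⟨u', -, rfl, e⟩) <;> simp only [opair_inj] at e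
    · obtain ⟨rfl, -⟩ := e
      rw [h1 _ _ _ h h']
    · exact (hne e.2.symm).elim
    · exact (hne e.2).elim
    · rw [e.1]

theorem cprod_emp (a : M) : cprod a (emp M) = emp M :=
  set_ext fun p => by simp

theorem cprod_adj {a b y : M} (hy : ¬ y ε b) :
    CardEq (cprod a (adj b y)) (csum (cprod a b) a) := by
  have hne := one_ne_emp (M := M)
  refine cardEq_of_rel (fun p q => ∃ u, u ε a ∧
    ((∃ v, v ε b ∧ p = opair u v ∧ q = opair p (emp M)) ∨ (p = opair u y ∧ q = opair u one)))
    ?_ ?_ ?_ ?_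
  · intro p hp
    obtain ⟨u, hu, v, hv, rfl⟩ := mem_cprod.1 hp
    rcases mem_adj.1 hv with hv | rfl
    · exact ⟨opair (opair u v) (emp M), by simp [hu, hv], u, hu, Or.inl ⟨v, hv, rfl, rfl⟩⟩
    · exact ⟨opair u one, by simp [hu], u, hu, Or.inr ⟨rfl, rfl⟩⟩
  · intro q hq
    rcases mem_csum.1 hq with ⟨p, hp, rfl⟩ | ⟨u, hu, rfl⟩
    · obtain ⟨u, hu, v, hv, rfl⟩ := mem_cprod.1 hp
      exact ⟨opair u v, mem_cprod.2 ⟨u, hu, v, mem_adj.2 (Or.inl hv), rfl⟩, u, hu,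
        Or.inl ⟨v, hv, rfl, rfl⟩⟩
    · exact ⟨opair u y, mem_cprod.2 ⟨u, hu, y, mem_adj.2 (Or.inr rfl), rfl⟩, u, hu,
        Or.inr ⟨rfl, rfl⟩⟩
  · rintro p q q' ⟨u, -, ⟨v, hv, rfl, rfl⟩ | ⟨rfl, rfl⟩⟩
      ⟨u', -, ⟨v', hv', e, rfl⟩ | ⟨e, rfl⟩⟩ <;> simp only [opair_inj] at e
    · rfl
    · exact (hy (e.2 ▸ hv)).elim
    · exact (hy (e.2 ▸ hv')).elim
    · rw [e.1]
  · rintro p p' q ⟨u, -, ⟨v, hv, rfl, rfl⟩ | ⟨rfl, rfl⟩⟩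
      ⟨u', -, ⟨v', hv', rfl, e⟩ | ⟨rfl, e⟩⟩ <;> simp only [opair_inj] at e
    · rw [e.1.1, e.1.2]
    · exact (hne e.2.symm).elim
    · exact (hne e.2).elim
    · rw [e.1]

theorem CardLe.cprod_left {a a' : M} (h : CardLe a a') (b : M) :
    CardLe (cprod a b) (cprod a' b) := by
  obtain ⟨f, hf, h1⟩ := h
  refine cardLe_of_rel (fun p q => ∃ u, u ε a ∧ ∃ v, v ε b ∧ ∃ w, w ε a' ∧
    p = opair u v ∧ q = opair w v ∧ opair u w ε f) ?_ ?_ ?_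
  · intro p hp
    obtain ⟨u, hu, v, hv, rfl⟩ := mem_cprod.1 hp
    obtain ⟨w, hw, -⟩ := hf.2 u hu
    have := (hf.mem hw).2
    exact ⟨opair w v, by simp [hv, this], u, hu, v, hv, w, this, rfl, rfl, hw⟩
  · rintro p q q' - ⟨u, -, v, -, w, -, rfl, rfl, h⟩ ⟨u', -, v', -, w', -, e, rfl, h'⟩
    obtain ⟨rfl, rfl⟩ := opair_inj.1 e
    rw [hf.unique h h']
  · rintro p p' q - - ⟨u, -, v, -, w, -, rfl, rfl, h⟩ ⟨u', -, v', -, w', -, rfl, e, h'⟩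
    obtain ⟨rfl, rfl⟩ := opair_inj.1 e
    rw [h1 _ _ _ h h']

theorem cexp_emp (a : M) : cexp a (emp M) = adj (emp M) (emp M) := by
  refine set_ext fun f => ?_
  rw [mem_cexp, mem_adj]
  constructor
  · rintro ⟨h, -⟩
    refine Or.inr ?_
    by_contra hne
    obtain ⟨p, hp⟩ := ne_emp_iff.1 hne
    obtain ⟨u, v, hu, -⟩ := h p hp
    exact not_mem_emp u hu
  · rintro (h | rfl)
    · exact (not_mem_emp f h).elim
    · exact ⟨fun p hp => (not_mem_emp p hp).elim, fun u hu => (not_mem_emp u hu).elim⟩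

theorem IsFun.adj {g a b y v : M} (hg : IsFun g b a) (hy : ¬ y ε b) (hv : v ε a) :
    IsFun (BoundedTheories.adj g (opair y v)) (BoundedTheories.adj b y) a := by
  refine ⟨fun p hp => ?_, fun u hu => ?_⟩
  · rcases mem_adj.1 hp with hp | rfl
    · obtain ⟨u, w, hu, hw, rfl⟩ := hg.1 p hp
      exact ⟨u, w, mem_adj.2 (Or.inl hu), hw, rfl⟩
    · exact ⟨y, v, mem_adj.2 (Or.inr rfl), hv, rfl⟩
  · simp only [mem_adj, opair_inj] at hu ⊢
    rcases hu with hu | rfl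
    · obtain ⟨w, hw, -⟩ := hg.2 u hu
      refine ⟨w, Or.inl hw, ?_⟩
      rintro w' (h | ⟨rfl, -⟩)
      exacts [hg.unique h hw, (hy hu).elim]
    · refine ⟨v, Or.inr ⟨rfl, rfl⟩, ?_⟩
      rintro w (h | h)
      exacts [(hy (hg.mem h).1).elim, h.2]

theorem cexp_adj {a b y : M} (hy : ¬ y ε b) :
    CardEq (cexp a (adj b y)) (cprod (cexp a b) a) := by
  refine cardEq_of_rel (fun f q => ∃ g, g ε cexp a b ∧ ∃ v, v ε a ∧ q = opair g v ∧
    f = adj g (opair y v)) ?_ ?_ ?_ ?_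
  · intro f hf
    rw [mem_cexp] at hf
    obtain ⟨v, hv, -⟩ := hf.2 y (mem_adj.2 (Or.inr rfl))
    have hva := (hf.mem hv).2
    set g := compr f fun p => ∃ u, u ε b ∧ ∃ v, v ε a ∧ p = opair u v with hg
    have mem_g : ∀ {u w}, opair u w ε g ↔ opair u w ε f ∧ u ε b := by
      intro u w
      rw [hg, mem_compr]
      refine and_congr_right fun h => ⟨?_, fun hu => ⟨u, hu, w, (hf.mem h).2, rfl⟩⟩
      rintro ⟨u', hu', v', -, e⟩
      rwa [(opair_inj.1 e).1]
    have hgf : IsFun g b a := by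
      refine ⟨fun p hp => ?_, fun u hu => ?_⟩
      · obtain ⟨-, u, hu, v, hv, e⟩ := mem_compr.1 hp
        exact ⟨u, v, hu, hv, e⟩
      · obtain ⟨w, hw, -⟩ := hf.2 u (mem_adj.2 (Or.inl hu))
        exact ⟨w, mem_g.2 ⟨hw, hu⟩, fun w' hw' => hf.unique (mem_g.1 hw').1 hw⟩
    refine ⟨opair g v, by simp [hgf, hva], g, mem_cexp.2 hgf, v, hva, rfl, ?_⟩
    refine hf.ext (hgf.adj hy hva) fun u w h => mem_adj.2 ?_
    rcases mem_adj.1 (hf.mem h).1 with hu | rfl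
    · exact Or.inl (mem_g.2 ⟨h, hu⟩)
    · exact Or.inr (by rw [hf.unique h hv])
  · intro q hq
    obtain ⟨g, hg, v, hv, rfl⟩ := mem_cprod.1 hq
    exact ⟨_, mem_cexp.2 ((mem_cexp.1 hg).adj hy hv), g, hg, v, hv, rfl, rfl⟩
  · rintro f q q' ⟨g, hg, v, hv, rfl, rfl⟩ ⟨g', hg', v', hv', rfl, e⟩
    rw [mem_cexp] at hg hg'
    have hf := hg.adj hy hv
    have hf' := hg'.adj hy hv'
    have hvv : v = v' := hf.unique (mem_adj.2 (Or.inr rfl)) (e ▸ mem_adj.2 (Or.inr rfl))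
    subst hvv
    rw [opair_inj]
    refine ⟨hg.ext hg' fun u w h => ?_, rfl⟩
    have : opair u w ε adj g' (opair y v) := e ▸ mem_adj.2 (Or.inl h)
    refine (mem_adj.1 this).resolve_right fun e => hy ?_
    rw [← (opair_inj.1 e).1]
    exact (hg.mem h).1
  · rintro f f' q ⟨g, -, v, -, rfl, rfl⟩ ⟨g', -, v', -, e, rfl⟩
    obtain ⟨rfl, rfl⟩ := opair_inj.1 e
    rfl

/-! ### Segments of the Ackermann ordering as cardinals -/

theorem one_leA_iff {w : M} : LeA one w ↔ w ≠ emp M := by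
  constructor
  · rintro h rfl
    exact one_ne_emp (h.antisymm (LeA.emp _))
  · intro hw
    by_contra h
    obtain ⟨hle, hne⟩ := ltA_iff.1 (not_leA.1 h)
    obtain ⟨m, hm, hm', hmax⟩ := (LeA.lex_iff.1 hle).resolve_left hne
    obtain ⟨z, hz⟩ := ne_emp_iff.1 hw
    rw [mem_one] at hm
    subst hm
    have hz' : z ≠ emp M := by rintro rfl; exact hm' hz
    exact hz' ((hmax z (by simp [hz, hz'])).antisymm (LeA.emp z))

@[simp] theorem mem_seg {w x : M} : w ε seg x ↔ w ≠ emp M ∧ LeA w x := by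
  rw [seg, mem_compr, and_iff_right_of_imp]
  exact fun h => h.2.mem_level (isLevel_rk x) (mem_rk x)

theorem isSegment_iff {t x s : M} (hx : x ε t) (ht : IsLevel t) :
    IsSegment (graph t t LeA) x s ↔ s = seg x := by
  have key : ∀ w, (Le (graph t t LeA) one w ∧ Le (graph t t LeA) w x) ↔ w ε seg x := by
    intro w
    rw [le_graph, le_graph, mem_seg, one_leA_iff]
    refine ⟨fun h => ⟨h.1.2.2, h.2.2.2⟩, fun h => ?_⟩
    have hw := h.2.mem_level ht hx
    exact ⟨⟨(one_leA_iff.2 h.1).mem_level ht hw, hw, h.1⟩, hw, hx, h.2⟩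
  refine ⟨fun h => set_ext fun w => (h w).trans (key w), ?_⟩
  rintro rfl w
  exact (key w).symm

theorem seg_emp : seg (emp M) = emp M :=
  set_ext fun w => by
    simp only [mem_seg, not_mem_emp, iff_false, not_and]
    exact fun hw h => hw (h.antisymm (LeA.emp w))

theorem NextA.seg_eq {x z : M} (h : NextA x z) : seg z = adj (seg x) z := by
  have hz : z ≠ emp M := by
    rintro rfl
    exact h.2.1 (h.1.antisymm (LeA.emp x))
  refine set_ext fun w => ?_
  rw [mem_adj, mem_seg, mem_seg, h.leA_iff_ltA, leA_iff]
  constructor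
  · rintro ⟨hw, h | h⟩
    exacts [Or.inl ⟨hw, h⟩, Or.inr h]
  · rintro (h | rfl)
    exacts [⟨h.1, Or.inl h.2⟩, ⟨hz, Or.inr rfl⟩]

theorem NextA.not_mem_seg {x z : M} (h : NextA x z) : ¬ z ε seg x := fun hz =>
  h.2.1 (h.1.antisymm (mem_seg.1 hz).2)

theorem not_cardLe_seg {x y : M} (h : LtA x y) : ¬ CardLe (seg y) (seg x) := by
  rw [ltA_iff] at h
  refine not_cardLe_of_ssub (x := y) (fun w hw => ?_) ?_ fun hy => ?_
  · rw [mem_seg] at hw ⊢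
    exact ⟨hw.1, hw.2.trans h.1⟩
  · rw [mem_seg]
    refine ⟨?_, LeA.refl y⟩
    rintro rfl
    exact h.2 (h.1.antisymm (LeA.emp x))
  · exact h.2 (h.1.antisymm (mem_seg.1 hy).2)

theorem seg_inj {x y : M} (h : CardEq (seg x) (seg y)) : x = y := by
  by_contra hne
  rcases LeA.total x y with h' | h'
  · exact not_cardLe_seg (ltA_iff.2 ⟨h', hne⟩) h.2
  · exact not_cardLe_seg (ltA_iff.2 ⟨h', Ne.symm hne⟩) h.1

/-- A set that injects into the nonempty elements of a level has the cardinality of a segment. -/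
theorem exists_cardEq_seg {s d : M} (hs : IsLevel s) (hne : emp M ε s)
    (h : CardLe d (compr s fun w => w ≠ emp M)) : ∃ z, z ε s ∧ CardEq d (seg z) := by
  obtain ⟨E, hE⟩ : ∃ E, E = compr s fun w => w ≠ emp M := ⟨_, rfl⟩
  have memE : ∀ {w}, w ε E ↔ w ε s ∧ w ≠ emp M := fun {w} => by rw [hE, mem_compr]
  rw [← hE] at h
  refine fin_induction
    (P := fun a => CardLe a E → ∃ z, z ε s ∧ CardEq a (seg z)) d ?_ ?_ h
  · intro _
    exact ⟨emp M, hne, by rw [seg_emp]; exact CardEq.refl _⟩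
  · intro a x had IH hx hxa hle
    have ha : Sub a (adj a x) := fun z hz => mem_adj.2 (Or.inl hz)
    obtain ⟨z, hz, hza⟩ := IH ((cardLe_of_sub ha).trans hle)
    obtain ⟨z', hz', -⟩ := isSuccA_existsUnique z
    rw [isSuccA_iff] at hz'
    by_cases hzs : z' ε s
    · refine ⟨z', hzs, ?_⟩
      rw [hz'.seg_eq]
      exact ⟨hza.1.adj hxa hz'.not_mem_seg, hza.2.adj hz'.not_mem_seg hxa⟩
    · -- `z` is the last element of `s`, and `d` has too few elements to exhaust `s`
      have hsub : Sub E (seg z) := fun w hw => by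
        rw [memE] at hw
        refine mem_seg.2 ⟨hw.2, hz'.leA_iff_ltA.2 (not_leA.1 fun h => hzs ?_)⟩
        exact h.mem_level hs hw.1
      exact (not_cardLe_of_ssub ha (mem_adj.2 (Or.inr rfl)) hxa
        ((hle.trans (cardLe_of_sub hsub)).trans hza.2)).elim

/-! ### The arithmetical operations -/

theorem exists_isMaxA (x y : M) : ∃ m, IsMaxA x y m := by
  by_cases h : LeA x y
  · exact ⟨y, Or.inl ⟨rfl, leA_iff.1 h⟩⟩
  · exact ⟨x, Or.inr ⟨rfl, not_leA.1 h⟩⟩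

theorem IsMaxA.le {x y m : M} (h : IsMaxA x y m) : LeA x m ∧ LeA y m := by
  rcases h with ⟨rfl, h⟩ | ⟨rfl, h⟩
  · exact ⟨leA_iff.2 h, LeA.refl _⟩
  · exact ⟨LeA.refl _, leA_iff.2 (Or.inl h)⟩

theorem IsMaxA.unique {x y m m' : M} (h : IsMaxA x y m) (h' : IsMaxA x y m') : m = m' := by
  have e : ∀ {m}, IsMaxA x y m → m = x ∨ m = y := by
    rintro m (⟨rfl, -⟩ | ⟨rfl, -⟩)
    exacts [Or.inr rfl, Or.inl rfl]
  refine LeA.antisymm ?_ ?_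
  · rcases e h with rfl | rfl
    exacts [h'.le.1, h'.le.2]
  · rcases e h' with rfl | rfl
    exacts [h.le.1, h.le.2]

/-- When the cardinal operation `op` takes the value `d` on `|x|` and `|y|`, and `d` injects into the
nonempty elements of the level `s`, then `z` is the value of the induced operation on the ordering
of `s` iff `|z|` has the cardinality of `d`. -/
theorem isCardOpA_iff {op : M → M → M → Prop} {s x y d z : M} (hs : IsLevel s) (hx : x ε s)
    (hy : y ε s) (hop : ∀ d', op (seg x) (seg y) d' ↔ d' = d)
    (h : CardLe d (compr s fun w => w ≠ emp M)) :
    IsCardOpA op s x y z ↔ CardEq d (seg z) := by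
  constructor
  · rintro ⟨l, hl, hz, sx, sy, sz, d', h1, h2, h3, h4, h5⟩
    rw [isAck_iff hs] at hl
    subst hl
    rw [inField_graph] at hz
    rw [isSegment_iff hx hs] at h1
    rw [isSegment_iff hy hs] at h2
    rw [isSegment_iff hz.1 hs] at h3
    subst h1 h2 h3
    rwa [(hop _).1 h4] at h5
  · intro hz
    obtain ⟨z', hz', h'⟩ := exists_cardEq_seg hs ((LeA.emp x).mem_level hs hx) h
    obtain rfl := seg_inj (hz.symm.trans h')
    exact ⟨_, (isAck_iff hs).2 rfl, inField_graph.2 ⟨hz', LeA.refl z⟩, _, _, _, d,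
      (isSegment_iff hx hs).2 rfl, (isSegment_iff hy hs).2 rfl, (isSegment_iff hz' hs).2 rfl,
      (hop _).2 rfl, hz⟩

theorem IsMaxA.mem {x y m : M} (h : IsMaxA x y m) : x ε rk m ∧ y ε rk m :=
  ⟨h.le.1.mem_level (isLevel_rk m) (mem_rk m), h.le.2.mem_level (isLevel_rk m) (mem_rk m)⟩

theorem IsLevel.sub_pow {V : M} (hV : IsLevel V) : Sub V (BoundedTheories.pow V) :=
  fun _ hx => mem_pow.2 (hV.transitive hx)

theorem mem_of_mem_seg {V x u : M} (hV : IsLevel V) (hx : x ε V) (hu : u ε seg x) : u ε V :=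
  (mem_seg.1 hu).2.mem_level hV hx

/-- The sum of two segments of a level injects into the nonempty elements of the next level, by
`u ↦ {u}` and `u ↦ {u, ∅}`. -/
theorem csum_cardLe {V x y : M} (hV : IsLevel V) (hx : x ε V) (hy : y ε V) :
    CardLe (csum (seg x) (seg y)) (compr (pow V) fun w => w ≠ emp M) := by
  have hne := one_ne_emp (M := M)
  have hV' : emp M ε V := (LeA.emp x).mem_level hV hx
  have hpair : ∀ {u v : M}, u ε V → v ε V → upair u v ε compr (pow V) fun w => w ≠ emp M := by
    intro u v hu hv
    refine mem_compr.2 ⟨?_, ne_emp_iff.2 ⟨u, mem_upair.2 (Or.inl rfl)⟩⟩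
    simp only [mem_pow, Sub, mem_upair]
    rintro w (rfl | rfl) <;> assumption
  refine cardLe_of_rel (fun p w => (∃ u, u ε seg x ∧ p = opair u (emp M) ∧ w = upair u u) ∨
    ∃ u, u ε seg y ∧ p = opair u one ∧ w = upair u (emp M)) ?_ ?_ ?_
  · intro p hp
    rcases mem_csum.1 hp with ⟨u, hu, rfl⟩ | ⟨u, hu, rfl⟩
    · have huV := mem_of_mem_seg hV hx hu
      exact ⟨_, hpair huV huV, Or.inl ⟨u, hu, rfl, rfl⟩⟩
    · exact ⟨_, hpair (mem_of_mem_seg hV hy hu) hV', Or.inr ⟨u, hu, rfl, rfl⟩⟩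
  · rintro p q q' - (⟨u, -, rfl, rfl⟩ | ⟨u, -, rfl, rfl⟩) (⟨u', -, e, rfl⟩ | ⟨u', -, e, rfl⟩) <;>
      simp only [opair_inj] at e
    · rw [e.1]
    · exact (hne e.2.symm).elim
    · exact (hne e.2).elim
    · rw [e.1]
  · have hnot : ∀ {u v : M}, u ≠ emp M → upair u u ≠ upair v (emp M) := by
      intro u v hu e
      have : emp M ε upair u u := e ▸ mem_upair.2 (Or.inr rfl)
      rw [mem_upair] at this
      exact hu (this.elim Eq.symm Eq.symm)
    rintro p p' q - - (⟨u, hu, rfl, rfl⟩ | ⟨u, hu, rfl, rfl⟩) (⟨u', hu', rfl, e⟩ | ⟨u', hu', rfl, e⟩)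
    · rw [upair_self_inj.1 e]
    · exact (hnot (mem_seg.1 hu).1 e).elim
    · exact (hnot (mem_seg.1 hu').1 e.symm).elim
    · have : u ε upair u' (emp M) := e ▸ mem_upair.2 (Or.inl rfl)
      rw [(mem_upair.1 this).resolve_right (mem_seg.1 hu).1]

/-- `w` codes the pair of `u` and `v`, where the presence of `∅` in `w` tells the order of `u`
and `v`. -/
def PairCode (u v w : M) : Prop :=
  (LeA u v ∧ w = upair u v) ∨ (¬ LeA u v ∧ w = adj (upair u v) (emp M))

instance {Γ : Type u} [Ctx M Γ] {f h k : Γ → M} [BddFun f] [BddFun h] [BddFun k] :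
    BddRel M (fun g => PairCode (f g) (h g) (k g)) :=
  inferInstanceAs (BddRel M fun g => (LeA (f g) (h g) ∧ k g = upair (f g) (h g)) ∨
    (¬ LeA (f g) (h g) ∧ k g = adj (upair (f g) (h g)) (emp M)))

theorem exists_pairCode {V u v : M} (hV : emp M ε V) (hu : u ε V) (hv : v ε V) :
    ∃ w, w ε pow V ∧ w ≠ emp M ∧ PairCode u v w := by
  by_cases h : LeA u v
  · refine ⟨upair u v, ?_, ne_emp_iff.2 ⟨u, by simp⟩, Or.inl ⟨h, rfl⟩⟩
    simp only [mem_pow, Sub, mem_upair]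
    rintro w (rfl | rfl) <;> assumption
  · refine ⟨adj (upair u v) (emp M), ?_, ne_emp_iff.2 ⟨u, by simp⟩, Or.inr ⟨h, rfl⟩⟩
    simp only [mem_pow, Sub, mem_adj, mem_upair]
    rintro w ((rfl | rfl) | rfl) <;> assumption

theorem PairCode.unique {M : Type u} [setLang.Structure M] {u v w w' : M} (h : PairCode u v w) (h' : PairCode u v w') : w = w' := by
  rcases h with ⟨h1, rfl⟩ | ⟨h1, rfl⟩ <;> rcases h' with ⟨h2, rfl⟩ | ⟨h2, rfl⟩
  exacts [rfl, (h2 h1).elim, (h1 h2).elim, rfl]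

theorem PairCode.inj {u v u' v' w : M} (hu : u ≠ emp M) (hv : v ≠ emp M) (hu' : u' ≠ emp M)
    (hv' : v' ≠ emp M) (h : PairCode u v w) (h' : PairCode u' v' w) : u = u' ∧ v = v' := by
  have hmem : ∀ z, z ≠ emp M → ((z = u ∨ z = v) ↔ (z = u' ∨ z = v')) := by
    have key : ∀ {u v}, PairCode u v w → ∀ z, z ≠ emp M → ((z = u ∨ z = v) ↔ z ε w) := by
      rintro u v (⟨-, rfl⟩ | ⟨-, rfl⟩) z hz <;> simp [hz]
    exact fun z hz => (key h z hz).trans (key h' z hz).symm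
  have hemp : ∀ {u v}, u ≠ emp M → v ≠ emp M → PairCode u v w → (LeA u v ↔ ¬ emp M ε w) := by
    rintro u v hu hv (⟨h1, rfl⟩ | ⟨h1, rfl⟩)
    · simp [h1, Ne.symm hu, Ne.symm hv]
    · simp [h1]
  have hle : LeA u v ↔ LeA u' v' := (hemp hu hv h).trans (hemp hu' hv' h').symm
  rcases (hmem u hu).1 (Or.inl rfl) with rfl | rfl
  · refine ⟨rfl, ?_⟩
    rcases (hmem v hv).1 (Or.inr rfl) with rfl | rfl
    · rcases (hmem v' hv').2 (Or.inr rfl) with e | e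
      exacts [e.symm, e.symm]
    · rfl
  · rcases (hmem v hv).1 (Or.inr rfl) with rfl | rfl
    · have e : u = v := by
        rcases LeA.total u v with h1 | h1
        · exact h1.antisymm (hle.1 h1)
        · exact LeA.antisymm (hle.2 h1) h1
      exact ⟨e, e.symm⟩
    · rcases (hmem u' hu').2 (Or.inl rfl) with e | e
      exacts [⟨e.symm, rfl⟩, ⟨e.symm, rfl⟩]

theorem cprod_cardLe {V x y : M} (hV : IsLevel V) (hx : x ε V) (hy : y ε V) :
    CardLe (cprod (seg x) (seg y)) (compr (pow V) fun w => w ≠ emp M) := by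
  have hV' : emp M ε V := (LeA.emp x).mem_level hV hx
  refine cardLe_of_rel (fun p w => ∃ u, u ε seg x ∧ ∃ v, v ε seg y ∧ p = opair u v ∧
    PairCode u v w) ?_ ?_ ?_
  · intro p hp
    obtain ⟨u, hu, v, hv, rfl⟩ := mem_cprod.1 hp
    obtain ⟨w, hw, hne, h⟩ :=
      exists_pairCode hV' (mem_of_mem_seg hV hx hu) (mem_of_mem_seg hV hy hv)
    exact ⟨w, mem_compr.2 ⟨hw, hne⟩, u, hu, v, hv, rfl, h⟩
  · rintro p w w' - ⟨u, -, v, -, rfl, h⟩ ⟨u', -, v', -, e, h'⟩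
    obtain ⟨rfl, rfl⟩ := opair_inj.1 e
    exact h.unique h'
  · rintro p p' w - - ⟨u, hu, v, hv, rfl, h⟩ ⟨u', hu', v', hv', rfl, h'⟩
    rw [mem_seg] at hu hv hu' hv'
    exact opair_inj.2 (h.inj hu.1 hv.1 hu'.1 hv'.1 h')

/-- The functions between segments of a level inject into the nonempty elements of the second next
level: a function is coded by the set of the codes of its pairs, to which `∅` is adjoined to make
it nonempty. -/
theorem cexp_cardLe {V x y : M} (hV : IsLevel V) (hx : x ε V) (hy : y ε V) :
    CardLe (cexp (seg x) (seg y)) (compr (pow (pow V)) fun w => w ≠ emp M) := by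
  have hV' : emp M ε V := (LeA.emp x).mem_level hV hx
  refine cardLe_of_fun (fun f => adj (compr (pow V) fun w => ∃ u, u ε seg y ∧ ∃ v, v ε seg x ∧
    opair u v ε f ∧ PairCode u v w) (emp M)) ?_ ?_
  · intro f _
    rw [mem_compr, mem_pow]
    refine ⟨fun w hw => ?_, ne_emp_iff.2 ⟨emp M, mem_adj.2 (Or.inr rfl)⟩⟩
    rcases mem_adj.1 hw with hw | rfl
    · exact (mem_compr.1 hw).1
    · exact mem_pow.2 (emp_sub V)
  · intro f f' hf hf' e
    rw [mem_cexp] at hf hf'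
    refine hf.ext hf' fun u v h => ?_
    obtain ⟨hu, hv⟩ := hf.mem h
    obtain ⟨w, hw, hne, hc⟩ :=
      exists_pairCode hV' (mem_of_mem_seg hV hy hu) (mem_of_mem_seg hV hx hv)
    have hmem : w ε adj (compr (pow V) fun w => ∃ u, u ε seg y ∧ ∃ v, v ε seg x ∧
        opair u v ε f ∧ PairCode u v w) (emp M) :=
      mem_adj.2 (Or.inl (mem_compr.2 ⟨hw, u, hu, v, hv, h, hc⟩))
    rw [e] at hmem
    obtain ⟨-, u', hu', v', hv', h', hc'⟩ := mem_compr.1 ((mem_adj.1 hmem).resolve_right hne)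
    rw [mem_seg] at hu hv hu' hv'
    obtain ⟨rfl, rfl⟩ := hc.inj hu.1 hv.1 hu'.1 hv'.1 hc'
    exact h'

theorem isAddA_iff {x y z : M} : IsAddA x y z ↔ CardEq (csum (seg x) (seg y)) (seg z) := by
  obtain ⟨m, hm⟩ := exists_isMaxA x y
  have hV := isLevel_rk m
  have key := isCardOpA_iff (op := IsCardSum) (z := z) hV.pow (hV.sub_pow x hm.mem.1)
    (hV.sub_pow y hm.mem.2) (fun _ => isCardSum_iff) (csum_cardLe hV hm.mem.1 hm.mem.2)
  exact ⟨fun ⟨m', hm', h⟩ => key.1 (hm.unique hm' ▸ h), fun h => ⟨m, hm, key.2 h⟩⟩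

theorem isMulA_iff {x y z : M} : IsMulA x y z ↔ CardEq (cprod (seg x) (seg y)) (seg z) := by
  obtain ⟨m, hm⟩ := exists_isMaxA x y
  have hV := isLevel_rk m
  have key := isCardOpA_iff (op := IsCardProd) (z := z) hV.pow (hV.sub_pow x hm.mem.1)
    (hV.sub_pow y hm.mem.2) (fun _ => isCardProd_iff) (cprod_cardLe hV hm.mem.1 hm.mem.2)
  exact ⟨fun ⟨m', hm', h⟩ => key.1 (hm.unique hm' ▸ h), fun h => ⟨m, hm, key.2 h⟩⟩

theorem isExpA_iff {x y z : M} : IsExpA x y z ↔ CardEq (cexp (seg x) (seg y)) (seg z) := by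
  obtain ⟨m, hm⟩ := exists_isMaxA x y
  have hV := isLevel_rk m
  have key := isCardOpA_iff (op := IsCardExp) (z := z) hV.pow.pow
    (hV.pow.sub_pow x (hV.sub_pow x hm.mem.1)) (hV.pow.sub_pow y (hV.sub_pow y hm.mem.2))
    (fun _ => isCardExp_iff) (cexp_cardLe hV hm.mem.1 hm.mem.2)
  exact ⟨fun ⟨m', hm', h⟩ => key.1 (hm.unique hm' ▸ h), fun h => ⟨m, hm, key.2 h⟩⟩

theorem existsUnique_of_cardLe {s d : M} (hs : IsLevel s) (hne : emp M ε s)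
    (h : CardLe d (compr s fun w => w ≠ emp M)) : ∃! z, CardEq d (seg z) := by
  obtain ⟨z, -, hz⟩ := exists_cardEq_seg hs hne h
  exact ⟨z, hz, fun z' hz' => seg_inj (hz'.symm.trans hz)⟩

theorem emp_mem_pow (a : M) : emp M ε pow a := mem_pow.2 (emp_sub a)

theorem isAddA_existsUnique (x y : M) : ∃! z, IsAddA x y z := by
  obtain ⟨s, hs, hx, hy, -⟩ := exists_level x y y
  simp only [isAddA_iff]
  exact existsUnique_of_cardLe hs.pow (emp_mem_pow s) (csum_cardLe hs hx hy)

theorem isMulA_existsUnique (x y : M) : ∃! z, IsMulA x y z := by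
  obtain ⟨s, hs, hx, hy, -⟩ := exists_level x y y
  simp only [isMulA_iff]
  exact existsUnique_of_cardLe hs.pow (emp_mem_pow s) (cprod_cardLe hs hx hy)

theorem isExpA_existsUnique (x y : M) : ∃! z, IsExpA x y z := by
  obtain ⟨s, hs, hx, hy, -⟩ := exists_level x y y
  simp only [isExpA_iff]
  exact existsUnique_of_cardLe hs.pow.pow (emp_mem_pow _) (cexp_cardLe hs hx hy)

end Cardinals

/-! ### The structure of arithmetic -/

section Arithmetic

variable {M : Type u} [setLang.Structure M]

/-- The successor of `x` in the ordering of the universe, as the value of a term. -/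
noncomputable def sucA (x : M) : M := sUn (compr (pow (rk x)) fun z => NextA x z)

/-- The sum of `x` and `y`, as the value of a term. -/
noncomputable def addA (x y : M) : M :=
  sUn (compr (pow (un (rk x) (rk y))) fun z => CardEq (csum (seg x) (seg y)) (seg z))

/-- The product of `x` and `y`, as the value of a term. -/
noncomputable def mulA (x y : M) : M :=
  sUn (compr (pow (un (rk x) (rk y))) fun z => CardEq (cprod (seg x) (seg y)) (seg z))

/-- The power of `x` with exponent `y`, as the value of a term. -/
noncomputable def expA (x y : M) : M :=
  sUn (compr (pow (pow (un (rk x) (rk y)))) fun z => CardEq (cexp (seg x) (seg y)) (seg z))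

variable [M ⊨ EAstar]

section Instances

variable {Γ : Type u} [Ctx M Γ] {f h : Γ → M} [BddFun f] [BddFun h]

instance : BddFun (fun g => sucA (f g)) :=
  inferInstanceAs (BddFun fun g => sUn (compr (pow (rk (f g))) fun z => NextA (f g) z))

instance : BddFun (fun g => addA (f g) (h g)) :=
  inferInstanceAs (BddFun fun g => sUn (compr (pow (un (rk (f g)) (rk (h g))))
    fun z => CardEq (csum (seg (f g)) (seg (h g))) (seg z)))

instance : BddFun (fun g => mulA (f g) (h g)) :=
  inferInstanceAs (BddFun fun g => sUn (compr (pow (un (rk (f g)) (rk (h g))))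
    fun z => CardEq (cprod (seg (f g)) (seg (h g))) (seg z)))

instance : BddFun (fun g => expA (f g) (h g)) :=
  inferInstanceAs (BddFun fun g => sUn (compr (pow (pow (un (rk (f g)) (rk (h g)))))
    fun z => CardEq (cexp (seg (f g)) (seg (h g))) (seg z)))

end Instances

/-- If a bounded relation determines a unique element, and this element belongs to `b`, then it is
`⋃ {z ∈ b : P z}`, the sum set of a singleton. -/
theorem sUn_compr_spec {P Q : M → Prop} [BddRel₁ M P] {b : M} (hPQ : ∀ z, Q z ↔ P z)
    (h : ∃! z, Q z) (hb : ∀ z, Q z → z ε b) : Q (sUn (compr b P)) := by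
  obtain ⟨z, hz, huniq⟩ := h
  convert hz
  refine set_ext fun w => ?_
  simp only [mem_sUn, mem_compr]
  constructor
  · rintro ⟨y, ⟨-, hy⟩, hw⟩
    rwa [← huniq y ((hPQ y).2 hy)]
  · exact fun hw => ⟨z, ⟨hb z hz, (hPQ z).1 hz⟩, hw⟩

theorem isSuccA_sucA (x : M) : IsSuccA x (sucA x) := by
  refine sUn_compr_spec (fun z => isSuccA_iff) (isSuccA_existsUnique x) ?_
  rintro z ⟨l, hl, hn⟩
  rw [isAck_iff (isLevel_rk x).pow] at hl
  subst hl
  exact (le_graph.1 hn.1).2.1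

theorem IsCardOpA.mem {op : M → M → M → Prop} {s x y z : M} (hs : IsLevel s)
    (h : IsCardOpA op s x y z) : z ε s := by
  obtain ⟨l, hl, hz, -⟩ := h
  rw [isAck_iff hs] at hl
  subst hl
  exact (inField_graph.1 hz).1

theorem Sub.pow_mono {a b : M} (h : Sub a b) : Sub (pow a) (pow b) := fun _ hz =>
  mem_pow.2 ((mem_pow.1 hz).trans h)

theorem IsMaxA.rk_sub {x y m : M} (h : IsMaxA x y m) : Sub (rk m) (un (rk x) (rk y)) := by
  intro z hz
  rcases h with ⟨rfl, -⟩ | ⟨rfl, -⟩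
  exacts [mem_un.2 (Or.inr hz), mem_un.2 (Or.inl hz)]

theorem isAddA_addA (x y : M) : IsAddA x y (addA x y) := by
  refine sUn_compr_spec (fun z => isAddA_iff) (isAddA_existsUnique x y) ?_
  rintro z ⟨m, hm, h⟩
  exact hm.rk_sub.pow_mono z (h.mem (isLevel_rk m).pow)

theorem isMulA_mulA (x y : M) : IsMulA x y (mulA x y) := by
  refine sUn_compr_spec (fun z => isMulA_iff) (isMulA_existsUnique x y) ?_
  rintro z ⟨m, hm, h⟩
  exact hm.rk_sub.pow_mono z (h.mem (isLevel_rk m).pow)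

theorem isExpA_expA (x y : M) : IsExpA x y (expA x y) := by
  refine sUn_compr_spec (fun z => isExpA_iff) (isExpA_existsUnique x y) ?_
  rintro z ⟨m, hm, h⟩
  exact hm.rk_sub.pow_mono.pow_mono z (h.mem (isLevel_rk m).pow.pow)

theorem the_eq {M : Type u} [setLang.Structure M] {p : M → Prop} (h : ∃! z, p z) {z : M}
    (hz : p z) : the p = z :=
  h.unique (Classical.epsilon_spec h.exists) hz

theorem the_isSuccA (x : M) : the (IsSuccA x) = sucA x :=
  the_eq (isSuccA_existsUnique x) (isSuccA_sucA x)
theorem the_isAddA (x y : M) : the (IsAddA x y) = addA x y :=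
  the_eq (isAddA_existsUnique x y) (isAddA_addA x y)
theorem the_isMulA (x y : M) : the (IsMulA x y) = mulA x y :=
  the_eq (isMulA_existsUnique x y) (isMulA_mulA x y)
theorem the_isExpA (x y : M) : the (IsExpA x y) = expA x y :=
  the_eq (isExpA_existsUnique x y) (isExpA_expA x y)

/-! #### The axioms for the operations and the order -/

theorem nextA_sucA (x : M) : NextA x (sucA x) := isSuccA_iff.1 (isSuccA_sucA x)

theorem ltA_sucA {x y : M} : LtA x (sucA y) ↔ LtA x y ∨ x = y := by
  rw [← (nextA_sucA y).leA_iff_ltA, leA_iff]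

theorem not_ltA_emp (x : M) : ¬ LtA x (emp M) := by
  rw [← not_leA, not_not]
  exact LeA.emp x

theorem sucA_ne_emp (x : M) : sucA x ≠ emp M := by
  intro h
  exact not_ltA_emp x (h ▸ ltA_sucA.2 (Or.inr rfl))

theorem sucA_inj {x y : M} (h : sucA x = sucA y) : x = y := by
  refine LeA.antisymm ?_ ?_
  · rw [leA_iff, ← ltA_sucA, ← h]
    exact ltA_sucA.2 (Or.inr rfl)
  · rw [leA_iff, ← ltA_sucA, h]
    exact ltA_sucA.2 (Or.inr rfl)

theorem NextA.eq_sucA {x z : M} (h : NextA x z) : z = sucA x :=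
  (isSuccA_existsUnique x).unique (isSuccA_iff.2 h) (isSuccA_sucA x)

theorem cardEq_addA (x y : M) : CardEq (csum (seg x) (seg y)) (seg (addA x y)) :=
  isAddA_iff.1 (isAddA_addA x y)
theorem cardEq_mulA (x y : M) : CardEq (cprod (seg x) (seg y)) (seg (mulA x y)) :=
  isMulA_iff.1 (isMulA_mulA x y)
theorem cardEq_expA (x y : M) : CardEq (cexp (seg x) (seg y)) (seg (expA x y)) :=
  isExpA_iff.1 (isExpA_expA x y)

theorem addA_emp (x : M) : addA x (emp M) = x := by
  refine seg_inj ((cardEq_addA x (emp M)).symm.trans ?_)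
  rw [seg_emp]
  exact csum_emp _

theorem addA_sucA (x y : M) : addA x (sucA y) = sucA (addA x y) := by
  refine seg_inj ((cardEq_addA x (sucA y)).symm.trans ?_)
  have hxy := nextA_sucA (addA x y)
  have h := cardEq_addA x y
  have hy := nextA_sucA y
  rw [hy.seg_eq, hxy.seg_eq, csum_adj]
  have hnot : ¬ opair (sucA y) one ε csum (seg x) (seg y) := by
    rw [mem_csum]
    rintro (⟨u, -, e⟩ | ⟨u, hu, e⟩)
    · exact one_ne_emp (opair_inj.1 e).2
    · exact hy.not_mem_seg ((opair_inj.1 e).1 ▸ hu)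
  exact ⟨h.1.adj hnot hxy.not_mem_seg, h.2.adj hxy.not_mem_seg hnot⟩

theorem mulA_emp (x : M) : mulA x (emp M) = emp M := by
  refine seg_inj ((cardEq_mulA x (emp M)).symm.trans ?_)
  rw [seg_emp, cprod_emp]
  exact CardEq.refl _

theorem mulA_sucA (x y : M) : mulA x (sucA y) = addA (mulA x y) x := by
  refine seg_inj (((cardEq_mulA x (sucA y)).symm.trans ?_).trans (cardEq_addA (mulA x y) x))
  have hy := nextA_sucA y
  have h := cardEq_mulA x y
  rw [hy.seg_eq]
  exact (cprod_adj hy.not_mem_seg).trans ⟨h.1.csum_left _, h.2.csum_left _⟩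

theorem expA_emp (x : M) : expA x (emp M) = sucA (emp M) := by
  refine seg_inj ((cardEq_expA x (emp M)).symm.trans ?_)
  have h := nextA_sucA (emp M)
  have hn := h.not_mem_seg
  rw [h.seg_eq]
  rw [seg_emp] at hn ⊢
  rw [cexp_emp]
  have := cardLe_of_sub (Sub.refl (emp M))
  exact ⟨this.adj (not_mem_emp _) hn, this.adj hn (not_mem_emp _)⟩

theorem expA_sucA (x y : M) : expA x (sucA y) = mulA (expA x y) x := by
  refine seg_inj (((cardEq_expA x (sucA y)).symm.trans ?_).trans (cardEq_mulA (expA x y) x))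
  have hy := nextA_sucA y
  have h := cardEq_expA x y
  rw [hy.seg_eq]
  exact (cexp_adj hy.not_mem_seg).trans ⟨h.1.cprod_left _, h.2.cprod_left _⟩

/-! #### Induction for bounded quantifier formulas -/

/-- Induction along the Ackermann ordering for bounded relations: a failure of the conclusion has a
least one below it, by finiteness, which is either `∅` or a successor. -/
theorem ack_induction {P : M → Prop} [BddRel₁ M P] (h0 : P (emp M))
    (hs : ∀ y, P y → P (sucA y)) (b : M) : P b := by
  by_contra hb
  have hmem : ∀ {y w : M}, y ε rk b → LeA w y → w ε rk b := fun hy h =>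
    h.mem_level (isLevel_rk b) hy
  obtain ⟨y, hy, hmin⟩ := exists_greatest (fun u v => LeA v u) (X := rk b)
    (a := compr (rk b) fun y => ¬ P y) (fun _ _ _ _ _ _ h h' => h'.trans h)
    (fun u v _ _ => LeA.total v u) (fun z hz => (mem_compr.1 hz).1)
    ⟨b, mem_compr.2 ⟨mem_rk b, hb⟩⟩
  rw [mem_compr] at hy
  have hye : emp M ≠ y := by rintro rfl; exact hy.2 h0
  obtain ⟨x, hx, hmax⟩ := exists_greatest LeA (X := rk b)
    (a := compr (rk b) fun w => LtA w y) (fun _ _ _ _ _ _ h h' => h.trans h')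
    (fun u v _ _ => LeA.total u v) (fun z hz => (mem_compr.1 hz).1)
    ⟨emp M, mem_compr.2 ⟨hmem hy.1 (LeA.emp y), ltA_iff.2 ⟨LeA.emp y, hye⟩⟩⟩
  rw [mem_compr, ltA_iff] at hx
  have hn : NextA x y := by
    refine ⟨hx.2.1, hx.2.2, fun c _ hxc hcy => ?_⟩
    by_cases e : c = y
    · exact Or.inr e
    · exact Or.inl ((hmax c (mem_compr.2 ⟨hmem hy.1 hcy, ltA_iff.2 ⟨hcy, e⟩⟩)).antisymm hxc)
  refine hy.2 (hn.eq_sucA ▸ hs x ?_)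
  by_contra hPx
  exact hx.2.2 (hx.2.1.antisymm (hmin x (mem_compr.2 ⟨hx.1, hPx⟩)))

attribute [local instance] ackStructure

section Realize

variable {α : Type} (w : α → M) {n : ℕ}

@[simp] theorem realize_zeroT {M : Type u} [setLang.Structure M] (w : α → M) :
    (zeroT : arithLang.Term α).realize w = emp M := rfl
@[simp] theorem realize_succT (t : arithLang.Term α) :
    (succT t).realize w = sucA (t.realize w) := the_isSuccA _
@[simp] theorem realize_addT (t s : arithLang.Term α) :
    (addT t s).realize w = addA (t.realize w) (s.realize w) := the_isAddA _ _
@[simp] theorem realize_mulT (t s : arithLang.Term α) :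
    (mulT t s).realize w = mulA (t.realize w) (s.realize w) := the_isMulA _ _
@[simp] theorem realize_expT (t s : arithLang.Term α) :
    (expT t s).realize w = expA (t.realize w) (s.realize w) := the_isExpA _ _
@[simp] theorem realize_ltF {M : Type u} [setLang.Structure M]
    (t s : arithLang.Term (α ⊕ Fin n)) (v : α → M) (xs : Fin n → M) :
    (ltF t s).Realize v xs ↔
      LtA (t.realize (Sum.elim v xs)) (s.realize (Sum.elim v xs)) := Iff.rfl

end Realize

theorem bddFun_realize {Γ : Type u} [Ctx M Γ] {β : Type} {v : Γ → β → M}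
    (hv : ∀ b, BddFun fun g => v g b) :
    ∀ t : arithLang.Term β, BddFun fun g => t.realize (v g)
  | Term.var b => hv b
  | Term.func f ts => by
      have ih := fun i => bddFun_realize hv (ts i)
      cases f with
      | zero => exact BddFun.const (emp M)
      | succ =>
        have := ih 0
        exact (funext fun g => the_isSuccA _ : (fun g => the (IsSuccA ((ts 0).realize (v g)))) = _) ▸
          (inferInstance : BddFun fun g => sucA ((ts 0).realize (v g)))
      | add =>
        have := ih 0
        have := ih 1
        exact (funext fun g => the_isAddA _ _ :
            (fun g => the (IsAddA ((ts 0).realize (v g)) ((ts 1).realize (v g)))) = _) ▸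
          (inferInstance : BddFun fun g => addA ((ts 0).realize (v g)) ((ts 1).realize (v g)))
      | mul =>
        have := ih 0
        have := ih 1
        exact (funext fun g => the_isMulA _ _ :
            (fun g => the (IsMulA ((ts 0).realize (v g)) ((ts 1).realize (v g)))) = _) ▸
          (inferInstance : BddFun fun g => mulA ((ts 0).realize (v g)) ((ts 1).realize (v g)))
      | exp =>
        have := ih 0
        have := ih 1
        exact (funext fun g => the_isExpA _ _ :
            (fun g => the (IsExpA ((ts 0).realize (v g)) ((ts 1).realize (v g)))) = _) ▸
          (inferInstance : BddFun fun g => expA ((ts 0).realize (v g)) ((ts 1).realize (v g)))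

theorem bddFun_sumElim {Γ : Type u} [Ctx M Γ] {α : Type} {n : ℕ} {v : Γ → α → M}
    {xs : Γ → Fin n → M} (hv : ∀ a, BddFun fun g => v g a) (hxs : ∀ i, BddFun fun g => xs g i)
    (t : arithLang.Term (α ⊕ Fin n)) : BddFun fun g => t.realize (Sum.elim (v g) (xs g)) :=
  bddFun_realize (v := fun g => Sum.elim (v g) (xs g))
    (fun b => by rcases b with b | b; exacts [hv b, hxs b]) t

theorem relMap_dom (w : Fin 1 → M) : Structure.RelMap (L := setLang) SetRel.dom w := by
  convert dom_all (w 0) using 1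
  funext i
  fin_cases i
  rfl

section LtQuantifiers

variable {Γ : Type u} [Ctx M Γ] {f : Γ → M} {R : Γ → M → Prop}

theorem mem_rk_of_ltA {x y : M} (h : LtA x y) : x ε rk y :=
  (ltA_iff.1 h).1.mem_level (isLevel_rk _) (mem_rk _)

theorem BddRel.ball_ltA (hf : BddFun f) (hR : BddRel M fun p : Γ × M => R p.1 p.2) :
    BddRel M fun g => ∀ y, LtA y (f g) → R g y :=
  (inferInstance : BddRel M fun g => ∀ y, y ε rk (f g) → LtA y (f g) → R g y).congr
    fun _ => forall_congr' fun _ => ⟨fun h _ => h, fun h hy => h (mem_rk_of_ltA hy) hy⟩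

theorem BddRel.bex_ltA (hf : BddFun f) (hR : BddRel M fun p : Γ × M => R p.1 p.2) :
    BddRel M fun g => ∃ y, LtA y (f g) ∧ R g y :=
  (inferInstance : BddRel M fun g => ∃ y, y ε rk (f g) ∧ LtA y (f g) ∧ R g y).congr
    fun _ => exists_congr fun _ => ⟨fun h => ⟨mem_rk_of_ltA h.1, h⟩, fun h => h.2⟩

end LtQuantifiers

/-- In the Ackermann interpretation a bounded quantifier formula of arithmetic defines a bounded
relation, because every set below `t` is an element of `R(t)`. -/
theorem IsDelta0.bddRel {α : Type} {n : ℕ} {φ : arithLang.BoundedFormula α n} (hφ : IsDelta0 φ) :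
    ∀ {Γ : Type u} [Ctx M Γ] {v : Γ → α → M} {xs : Γ → Fin n → M},
      (∀ a, BddFun fun g => v g a) → (∀ i, BddFun fun g => xs g i) →
      BddRel M fun g => φ.Realize (v g) (xs g) := by
  have hsnoc : ∀ {Γ : Type u} [Ctx M Γ] {m : ℕ} {xs : Γ → Fin m → M},
      (∀ i, BddFun fun g => xs g i) → ∀ i : Fin (m + 1),
        BddFun fun p : Γ × M => (Fin.snoc (xs p.1) p.2 : Fin (m + 1) → M) i := by
    intro Γ _ m xs hxs i
    refine Fin.lastCases ?_ (fun i => ?_) i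
    · simp only [Fin.snoc_last]
      infer_instance
    · simp only [Fin.snoc_castSucc]
      exact (hxs i).weaken
  induction hφ with
  | falsum => intros; exact BddRel.const False
  | equal t s =>
    intro Γ _ v xs hv hxs
    have := bddFun_sumElim hv hxs t
    have := bddFun_sumElim hv hxs s
    exact (inferInstance : BddRel M fun g =>
      t.realize (Sum.elim (v g) (xs g)) = s.realize (Sum.elim (v g) (xs g)))
  | rel R ts =>
    intro Γ _ v xs hv hxs
    have h := fun i => bddFun_sumElim hv hxs (ts i)
    cases R with
    | dom =>
      refine (BddRel.const True).congr fun g => iff_true_intro ?_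
      exact relMap_dom fun i => (ts i).realize (Sum.elim (v g) (xs g))
    | lt =>
      have := h 0
      have := h 1
      exact (inferInstance : BddRel M fun g =>
        LtA ((ts 0).realize (Sum.elim (v g) (xs g))) ((ts 1).realize (Sum.elim (v g) (xs g))))
  | imp _ _ ih ih' =>
    intro Γ _ v xs hv hxs
    have := ih hv hxs
    have := ih' hv hxs
    exact BddRel.imp
  | @ball _ t φ _ ih =>
    intro Γ _ v xs hv hxs
    refine (BddRel.ball_ltA (R := fun g y => φ.Realize (v g) (Fin.snoc (xs g) y))
      (bddFun_sumElim hv hxs t) (ih (Γ := Γ × M) (v := fun p => v p.1)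
        (xs := fun p => Fin.snoc (xs p.1) p.2) (fun a => (hv a).weaken) (hsnoc hxs))).congr
        fun g => ?_
    simp only [BoundedFormula.realize_all, BoundedFormula.realize_imp, realize_ltF,
      realize_newest, realize_up]
  | @bex _ t φ _ ih =>
    intro Γ _ v xs hv hxs
    refine (BddRel.bex_ltA (R := fun g y => φ.Realize (v g) (Fin.snoc (xs g) y))
      (bddFun_sumElim hv hxs t) (ih (Γ := Γ × M) (v := fun p => v p.1)
        (xs := fun p => Fin.snoc (xs p.1) p.2) (fun a => (hv a).weaken) (hsnoc hxs))).congr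
        fun g => ?_
    simp only [BoundedFormula.realize_ex, BoundedFormula.realize_inf, realize_ltF,
      realize_newest, realize_up]

theorem realize_inductionAxiom {k : ℕ} (φ : arithLang.Formula (Fin (k + 1))) (hφ : IsDelta0 φ) :
    M ⊨ inductionAxiom φ := by
  refine BoundedFormula.realize_alls.2 fun xs => ?_
  have key : ∀ y : M, (φ.Realize fun i => (Term.var (Sum.inr i) :
      arithLang.Term (Empty ⊕ Fin (k + 1))).realize
        (Sum.elim (default : Empty → M) (Fin.snoc xs y : Fin (k + 1) → M))) ↔
      φ.Realize (Fin.snoc xs y : Fin (k + 1) → M) := fun y => Iff.rfl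
  have hsnoc : ∀ (i : Fin (k + 1)), BddFun fun p : PUnit.{u + 1} × M =>
      (Fin.snoc xs p.2 : Fin (k + 1) → M) i := by
    intro i
    refine Fin.lastCases ?_ (fun i => ?_) i
    · simp only [Fin.snoc_last]
      infer_instance
    · simp only [Fin.snoc_castSucc]
      infer_instance
  have hbdd : BddRel₁ M fun y : M => φ.Realize (Fin.snoc xs y : Fin (k + 1) → M) :=
    hφ.bddRel (v := fun p : PUnit.{u + 1} × M => (Fin.snoc xs p.2 : Fin (k + 1) → M)) hsnoc
      (xs := fun _ => default) fun i => i.elim0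
  simp only [BoundedFormula.realize_imp, BoundedFormula.realize_inf, BoundedFormula.realize_all,
    realize_inst]
  rintro ⟨h0, hs⟩ y
  refine (key y).2 (ack_induction (P := fun y => φ.Realize (Fin.snoc xs y : Fin (k + 1) → M))
    ?_ (fun y hy => ?_) y)
  · convert h0 using 1
    funext i
    refine Fin.lastCases ?_ (fun i => ?_) i <;> simp
  · convert hs y ((key y).2 hy) using 1
    funext i
    refine Fin.lastCases ?_ (fun i => ?_) i <;> simp

theorem model_ackStructure : M ⊨ IDelta0Exp := by
  refine ⟨fun σ hσ => ?_⟩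
  cases hσ with
  | dom =>
    intro x
    exact BoundedFormula.realize_rel₁.2 (relMap_dom _)
  | induction φ hφ => exact realize_inductionAxiom φ hφ
  | succ_ne_zero =>
    simpa [Sentence.Realize, Formula.Realize, Fin.snoc] using sucA_ne_emp
  | succ_inj =>
    simpa [Sentence.Realize, Formula.Realize, Fin.snoc] using fun x y => sucA_inj (x := x) (y := y)
  | add_zero => simpa [Sentence.Realize, Formula.Realize, Fin.snoc] using addA_emp
  | add_succ => simpa [Sentence.Realize, Formula.Realize, Fin.snoc] using addA_sucA
  | mul_zero => simpa [Sentence.Realize, Formula.Realize, Fin.snoc] using mulA_emp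
  | mul_succ => simpa [Sentence.Realize, Formula.Realize, Fin.snoc] using mulA_sucA
  | exp_zero => simpa [Sentence.Realize, Formula.Realize, Fin.snoc] using expA_emp
  | exp_succ => simpa [Sentence.Realize, Formula.Realize, Fin.snoc] using expA_sucA
  | not_lt_zero => simpa [Sentence.Realize, Formula.Realize, Fin.snoc] using not_ltA_emp
  | lt_succ =>
    simpa [Sentence.Realize, Formula.Realize, Fin.snoc] using
      fun x y => ltA_sucA (x := x) (y := y)

end Arithmetic

/-! ### Terms and formulas for the Ackermann interpretation -/

namespace SetTerm

variable {n : ℕ}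

def empS : SetTerm n := app SetFun.empty ![]
def powS (t : SetTerm n) : SetTerm n := app SetFun.pow ![t]
def sUnS (t : SetTerm n) : SetTerm n := app SetFun.sUnion ![t]
def rkS (t : SetTerm n) : SetTerm n := app SetFun.rank ![t]
def pairS (t s : SetTerm n) : SetTerm n := app SetFun.pair ![t, s]
def opairS (t s : SetTerm n) : SetTerm n := pairS (pairS t t) (pairS t s)
def unS (t s : SetTerm n) : SetTerm n := sUnS (pairS t s)
def oneS : SetTerm n := pairS empS empS

/-- The variable bound by the innermost quantifier. -/
def last : SetTerm (n + 1) := var (Fin.last n)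

end SetTerm

namespace SetForm

open SetTerm

variable {n : ℕ}

def notS (φ : SetForm n) : SetForm n := imp φ falsum
def orS (φ ψ : SetForm n) : SetForm n := imp (notS φ) ψ
def andS (φ ψ : SetForm n) : SetForm n := notS (imp φ (notS ψ))
def iffS (φ ψ : SetForm n) : SetForm n := andS (imp φ ψ) (imp ψ φ)

/-- A formula for `LexLe`. -/
def lexLeS (l X Y : SetTerm n) : SetForm n :=
  orS (equal X Y) (bex Y (andS (notS (mem last X.wk)) (ball (unS X Y).wk
    (imp (notS (iffS (mem last X.wk.wk) (mem last Y.wk.wk))) (mem (opairS last last.wk) l.wk.wk)))))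

/-- A formula for `IsAckOrd`. -/
def isAckOrdS (s l : SetTerm n) : SetForm n :=
  andS (ball l (bex s.wk (bex s.wk.wk (equal last.wk.wk (opairS last.wk last)))))
    (ball s (ball s.wk (iffS (mem (opairS last.wk last) l.wk.wk) (lexLeS l.wk.wk last.wk last))))

/-- A formula for `LeA`. -/
def leAS (x y : SetTerm n) : SetForm n :=
  bex (powS (powS (powS (rkS (pairS x y))))) (andS (isAckOrdS (rkS (pairS x y)).wk last)
    (mem (opairS x.wk y.wk) last))

/-- A formula for `NextA`. -/
def nextAS (x z : SetTerm n) : SetForm n :=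
  andS (leAS x z) (andS (notS (equal x z)) (ball (rkS z) (imp (leAS x.wk last)
    (imp (leAS last z.wk) (orS (equal last x.wk) (equal last z.wk))))))

/-- A formula for `IsFun`. -/
def isFunS (f a b : SetTerm n) : SetForm n :=
  andS (ball f (bex a.wk (bex b.wk.wk (equal last.wk.wk (opairS last.wk last)))))
    (ball a (bex b.wk (andS (mem (opairS last.wk last) f.wk.wk) (ball b.wk.wk
      (imp (mem (opairS last.wk.wk last) f.wk.wk.wk) (equal last last.wk))))))

/-- A formula for `CardLe`. -/
def cardLeS (a b : SetTerm n) : SetForm n :=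
  bex (powS (powS (powS (unS a b)))) (andS (isFunS last a.wk b.wk)
    (ball a.wk (ball a.wk.wk (ball b.wk.wk.wk
      (imp (mem (opairS last.wk.wk last) last.wk.wk.wk)
        (imp (mem (opairS last.wk last) last.wk.wk.wk) (equal last.wk.wk last.wk)))))))

/-- A formula for `CardEq`. -/
def cardEqS (a b : SetTerm n) : SetForm n := andS (cardLeS a b) (cardLeS b a)

end SetForm

namespace SetTerm

open SetForm

variable {n : ℕ}

/-- A term for `seg`. -/
def segS (x : SetTerm n) : SetTerm n :=
  sep (rkS x) (andS (notS (equal last empS)) (leAS last x.wk))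

/-- A term for `csum`. -/
def csumS (a b : SetTerm n) : SetTerm n :=
  sep (powS (powS (unS (unS a b) (pairS empS oneS))))
    (orS (bex a.wk (equal last.wk (opairS last empS))) (bex b.wk (equal last.wk (opairS last oneS))))

/-- A term for `cprod`. -/
def cprodS (a b : SetTerm n) : SetTerm n :=
  sep (powS (powS (unS a b))) (bex a.wk (bex b.wk.wk (equal last.wk.wk (opairS last.wk last))))

/-- A term for `cexp`. -/
def cexpS (a b : SetTerm n) : SetTerm n :=
  sep (powS (powS (powS (unS b a)))) (isFunS last b.wk a.wk)

/-- A term for `sucA`. -/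
def sucS (x : SetTerm n) : SetTerm n := sUnS (sep (powS (rkS x)) (nextAS x.wk last))

/-- A term for `addA`. -/
def addS (x y : SetTerm n) : SetTerm n :=
  sUnS (sep (powS (unS (rkS x) (rkS y))) (cardEqS (csumS (segS x) (segS y)).wk (segS last)))

/-- A term for `mulA`. -/
def mulS (x y : SetTerm n) : SetTerm n :=
  sUnS (sep (powS (unS (rkS x) (rkS y))) (cardEqS (cprodS (segS x) (segS y)).wk (segS last)))

/-- A term for `expA`. -/
def expS (x y : SetTerm n) : SetTerm n :=
  sUnS (sep (powS (powS (unS (rkS x) (rkS y)))) (cardEqS (cexpS (segS x) (segS y)).wk (segS last)))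

end SetTerm

section Semantics

variable {M : Type u} [setLang.Structure M] {n : ℕ} (v : Fin n → M)

namespace SetTerm

@[simp] theorem ev_empS : (empS : SetTerm n).ev v = emp M :=
  congrArg (Structure.funMap (L := setLang) SetFun.empty) (Subsingleton.elim _ _)
@[simp] theorem ev_powS (t : SetTerm n) : (powS t).ev v = pow (t.ev v) :=
  congrArg (Structure.funMap (L := setLang) SetFun.pow) (by funext i; fin_cases i; rfl)
@[simp] theorem ev_sUnS (t : SetTerm n) : (sUnS t).ev v = sUn (t.ev v) :=
  congrArg (Structure.funMap (L := setLang) SetFun.sUnion) (by funext i; fin_cases i; rfl)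
@[simp] theorem ev_rkS (t : SetTerm n) : (rkS t).ev v = rk (t.ev v) :=
  congrArg (Structure.funMap (L := setLang) SetFun.rank) (by funext i; fin_cases i; rfl)
@[simp] theorem ev_pairS (t s : SetTerm n) : (pairS t s).ev v = upair (t.ev v) (s.ev v) :=
  congrArg (Structure.funMap (L := setLang) SetFun.pair) (by funext i; fin_cases i <;> rfl)
@[simp] theorem ev_opairS (t s : SetTerm n) : (opairS t s).ev v = opair (t.ev v) (s.ev v) := by
  simp [opairS, opair]
@[simp] theorem ev_unS (t s : SetTerm n) : (unS t s).ev v = un (t.ev v) (s.ev v) := by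
  simp [unS, un]
@[simp] theorem ev_oneS : (oneS : SetTerm n).ev v = one := by
  simp [oneS, one]
@[simp] theorem ev_last (y : M) :
    (last : SetTerm (n + 1)).ev (Fin.snoc (α := fun _ => M) v y) = y := by
  simp [last, ev]

end SetTerm

namespace SetForm

variable (φ ψ : SetForm n) (a b c : SetTerm n)

@[simp] theorem real_notS : (notS φ).Real v ↔ ¬ φ.Real v := Iff.rfl
@[simp] theorem real_orS : (orS φ ψ).Real v ↔ φ.Real v ∨ ψ.Real v := by
  simp only [orS, Real, real_notS]; tauto
@[simp] theorem real_andS : (andS φ ψ).Real v ↔ φ.Real v ∧ ψ.Real v := by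
  simp only [andS, Real, real_notS]; tauto
@[simp] theorem real_iffS : (iffS φ ψ).Real v ↔ (φ.Real v ↔ ψ.Real v) := by
  simp only [iffS, Real, real_andS]; tauto
@[simp] theorem real_lexLeS :
    (lexLeS a b c).Real v ↔ LexLe (a.ev v) (b.ev v) (c.ev v) := by
  simp [lexLeS, LexLe, Real, Le]
@[simp] theorem real_isAckOrdS : (isAckOrdS a b).Real v ↔ IsAckOrd (a.ev v) (b.ev v) := by
  simp [isAckOrdS, IsAckOrd, Real, Le]
@[simp] theorem real_leAS : (leAS a b).Real v ↔ LeA (a.ev v) (b.ev v) := by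
  simp [leAS, LeA, Real, Le]
@[simp] theorem real_nextAS : (nextAS a b).Real v ↔ NextA (a.ev v) (b.ev v) := by
  simp [nextAS, NextA, Real]

variable [M ⊨ EAstar]

@[simp] theorem real_isFunS :
    (isFunS a b c).Real v ↔ IsFun (a.ev v) (b.ev v) (c.ev v) := by
  simp [isFunS, isFun_iff, Real]
@[simp] theorem real_cardLeS : (cardLeS a b).Real v ↔ CardLe (a.ev v) (b.ev v) := by
  simp [cardLeS, cardLe_iff, Real]
@[simp] theorem real_cardEqS : (cardEqS a b).Real v ↔ CardEq (a.ev v) (b.ev v) := by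
  simp [cardEqS, CardEq]

end SetForm

namespace SetTerm

open SetForm

variable [M ⊨ EAstar] (a b : SetTerm n)

theorem ev_sep_eq (φ : SetForm (n + 1)) (P : M → Prop) [BddRel₁ M P]
    (h : ∀ z, φ.Real (Fin.snoc (α := fun _ => M) v z) ↔ P z) :
    (sep a φ).ev v = compr (a.ev v) P :=
  set_ext fun z => by rw [mem_ev_sep, mem_compr, h]

@[simp] theorem ev_segS : (segS a).ev v = seg (a.ev v) :=
  (ev_sep_eq v _ _ (fun w => w ≠ emp M ∧ LeA w (a.ev v)) fun z => by simp [SetForm.Real]).trans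
    (by rw [ev_rkS]; rfl)
@[simp] theorem ev_csumS : (csumS a b).ev v = csum (a.ev v) (b.ev v) :=
  (ev_sep_eq v _ _ (fun p => (∃ u, u ε a.ev v ∧ p = opair u (emp M)) ∨
    ∃ u, u ε b.ev v ∧ p = opair u one) fun z => by simp [SetForm.Real]).trans (by simp [csum])
@[simp] theorem ev_cprodS : (cprodS a b).ev v = cprod (a.ev v) (b.ev v) :=
  (ev_sep_eq v _ _ (fun p => ∃ u, u ε a.ev v ∧ ∃ w, w ε b.ev v ∧ p = opair u w)
    fun z => by simp [SetForm.Real]).trans (by simp [cprod])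
@[simp] theorem ev_cexpS : (cexpS a b).ev v = cexp (a.ev v) (b.ev v) :=
  (ev_sep_eq v _ _ (fun k => IsFun k (b.ev v) (a.ev v)) fun z => by simp).trans (by simp [cexp])
@[simp] theorem ev_sucS : (sucS a).ev v = sucA (a.ev v) := by
  rw [sucS, ev_sUnS, ev_sep_eq v _ _ (fun z => NextA (a.ev v) z) fun z => by simp]
  simp [sucA]
@[simp] theorem ev_addS : (addS a b).ev v = addA (a.ev v) (b.ev v) := by
  rw [addS, ev_sUnS, ev_sep_eq v _ _
    (fun z => CardEq (csum (seg (a.ev v)) (seg (b.ev v))) (seg z)) fun z => by simp]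
  simp [addA]
@[simp] theorem ev_mulS : (mulS a b).ev v = mulA (a.ev v) (b.ev v) := by
  rw [mulS, ev_sUnS, ev_sep_eq v _ _
    (fun z => CardEq (cprod (seg (a.ev v)) (seg (b.ev v))) (seg z)) fun z => by simp]
  simp [mulA]
@[simp] theorem ev_expS : (expS a b).ev v = expA (a.ev v) (b.ev v) := by
  rw [expS, ev_sUnS, ev_sep_eq v _ _
    (fun z => CardEq (cexp (seg (a.ev v)) (seg (b.ev v))) (seg z)) fun z => by simp]
  simp [expA]

end SetTerm

end Semantics

/-! ### The interpretation -/

section Interpretation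

/-- The term of `setLang` given by a `SetTerm`. -/
def SetTerm.toTerm {n : ℕ} (t : SetTerm n) : setLang.Term (Fin n) := t.subst Term.var

theorem SetTerm.realize_toTerm {M : Type*} [setLang.Structure M] {n : ℕ} (t : SetTerm n)
    (v : Fin n → M) : t.toTerm.realize v = t.ev v := t.realize_subst v _

/-- The interpretation mapping given by the terms `sucS`, `addS`, `mulS`, `expS`. -/
def ackMapping : AtomicInterpretation arithLang setLang where
  func := fun {_} f => match f with
    | ArithFun.zero => emptyT
    | ArithFun.succ => (SetTerm.sucS (SetTerm.var 0)).toTerm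
    | ArithFun.add => (SetTerm.addS (SetTerm.var 0) (SetTerm.var 1)).toTerm
    | ArithFun.mul => (SetTerm.mulS (SetTerm.var 0) (SetTerm.var 1)).toTerm
    | ArithFun.exp => (SetTerm.expS (SetTerm.var 0) (SetTerm.var 1)).toTerm
  rel := fun {_} R => match R with
    | ArithRel.dom => Relations.formula₁ (L := setLang) SetRel.dom (Term.var 0)
    | ArithRel.lt => (SetForm.andS (SetForm.leAS (SetTerm.var 0) (SetTerm.var 1))
        (SetForm.notS (SetForm.equal (SetTerm.var 0) (SetTerm.var 1)))).subst
          fun i => Term.var (Sum.inl i)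
  eq := Term.equal (Term.var 0) (Term.var 1)

theorem isMappingD_ackMapping : IsMappingD ackMapping where
  dom := rfl
  eq := rfl
  zero := rfl
  lt M _ _ x y := by
    rw [ltA_iff]
    refine (SetForm.realize_subst _ _ _ _).trans ?_
    simp [SetForm.Real, SetTerm.ev]
  succ M _ _ x := by
    have : (ackMapping.func ArithFun.succ).realize ![x] = sucA x :=
      (SetTerm.realize_toTerm _ _).trans (SetTerm.ev_sucS _ _)
    exact this ▸ isSuccA_sucA x
  add M _ _ x y := by
    have : (ackMapping.func ArithFun.add).realize ![x, y] = addA x y :=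
      (SetTerm.realize_toTerm _ _).trans (SetTerm.ev_addS _ _ _)
    exact this ▸ isAddA_addA x y
  mul M _ _ x y := by
    have : (ackMapping.func ArithFun.mul).realize ![x, y] = mulA x y :=
      (SetTerm.realize_toTerm _ _).trans (SetTerm.ev_mulS _ _ _)
    exact this ▸ isMulA_mulA x y
  exp M _ _ x y := by
    have : (ackMapping.func ArithFun.exp).realize ![x, y] = expA x y :=
      (SetTerm.realize_toTerm _ _).trans (SetTerm.ev_expS _ _ _)
    exact this ▸ isExpA_expA x y

namespace IsMappingD

variable {𝔡 : AtomicInterpretation arithLang setLang} (h : IsMappingD 𝔡)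
  {M : Type} [setLang.Structure M] [M ⊨ EAstar]
include h

attribute [local instance] ackStructure

theorem realize_dom (w : Fin 1 → M) : (𝔡.rel ArithRel.dom).Realize w := by
  rw [h.dom]
  exact Formula.realize_rel₁.2 (dom_all _)

theorem realize_func {k : ℕ} (f : arithLang.Functions k) (w : Fin k → M) :
    (𝔡.func f).realize w = Structure.funMap f w := by
  have e1 : ∀ w : Fin 1 → M, w = ![w 0] := fun w => by funext i; fin_cases i; rfl
  have e2 : ∀ w : Fin 2 → M, w = ![w 0, w 1] := fun w => by funext i; fin_cases i <;> rfl
  cases f with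
  | zero => exact (congrArg (Term.realize w) h.zero).trans (realize_emptyT w)
  | succ =>
    have := h.succ M (w 0)
    rw [← e1] at this
    exact (the_eq (isSuccA_existsUnique _) this).symm
  | add =>
    have := h.add M (w 0) (w 1)
    rw [← e2] at this
    exact (the_eq (isAddA_existsUnique _ _) this).symm
  | mul =>
    have := h.mul M (w 0) (w 1)
    rw [← e2] at this
    exact (the_eq (isMulA_existsUnique _ _) this).symm
  | exp =>
    have := h.exp M (w 0) (w 1)
    rw [← e2] at this
    exact (the_eq (isExpA_existsUnique _ _) this).symm

theorem realize_rel {k : ℕ} (R : arithLang.Relations k) (w : Fin k → M) :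
    (𝔡.rel R).Realize w ↔ Structure.RelMap R w := by
  cases R with
  | dom => exact iff_of_true (h.realize_dom w) (relMap_dom w)
  | lt =>
    have := h.lt M (w 0) (w 1)
    rw [show ![w 0, w 1] = w by funext i; fin_cases i <;> rfl] at this
    exact this

theorem realize_term {α : Type} (w : α → M) :
    ∀ t : arithLang.Term α, (𝔡.term t).realize w = t.realize w
  | Term.var _ => rfl
  | Term.func f ts => by
      rw [AtomicInterpretation.term, Term.realize_subst, h.realize_func, Term.realize]
      congr 1
      funext i
      exact realize_term w (ts i)

/-- The translation of a formula holds in a model of `EA*` iff the formula holds in the structure of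
arithmetic on its universe. -/
theorem realize_formula {α : Type} {n : ℕ} (φ : arithLang.BoundedFormula α n) (v : α → M)
    (xs : Fin n → M) : (𝔡.formula φ).Realize v xs ↔ φ.Realize v xs := by
  induction φ with
  | falsum => exact Iff.rfl
  | equal t s =>
    rw [AtomicInterpretation.formula, realize_inst, h.eq]
    simp only [Formula.realize_equal, Term.realize_var, Matrix.cons_val_zero, Matrix.cons_val_one,
      h.realize_term]
    rfl
  | rel R ts =>
    rw [AtomicInterpretation.formula, realize_inst, h.realize_rel]
    simp only [h.realize_term]
    rfl
  | imp φ ψ ih ih' =>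
    rw [AtomicInterpretation.formula, BoundedFormula.realize_imp, ih, ih',
      BoundedFormula.realize_imp]
  | all φ ih =>
    rw [AtomicInterpretation.formula, BoundedFormula.realize_all, BoundedFormula.realize_all]
    refine forall_congr' fun y => ?_
    rw [BoundedFormula.realize_imp, realize_inst, ih]
    exact ⟨fun H => H (h.realize_dom _), fun H _ => H⟩

end IsMappingD

theorem IsMappingD.definesInterpretation {𝔡 : AtomicInterpretation arithLang setLang}
    (h : IsMappingD 𝔡) : 𝔡.DefinesInterpretation IDelta0Exp EAstar := by
  constructor
  · intro M v xs
    refine BoundedFormula.realize_ex.2 ⟨emp M, ?_⟩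
    rw [realize_inst]
    exact h.realize_dom _
  · intro σ hσ M v xs
    let _ : arithLang.Structure M := ackStructure M
    rw [h.realize_formula]
    have hM : (M : Type) ⊨ IDelta0Exp := model_ackStructure
    have := Theory.realize_sentence_of_mem (M := M) IDelta0Exp hσ
    rw [Subsingleton.elim v default, Subsingleton.elim xs default]
    exact this

end Interpretation

end BoundedTheories

theorem mainTheorem3 :
    -- In every model of `EA*` ...
    (∀ (M : Type*) [setLang.Structure M] [M ⊨ EAstar],
      -- the recursion defining `Ack` is effective, and `Ack(s)` linearly orders the level `s`,
      (∀ s : M, IsLevel s → (∃! l, IsAck s l) ∧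
        ∀ l, IsAck s l → IsLinOrd l ∧ ∀ a, InField l a ↔ Mem a s) ∧
      -- the relation `<ₐ` orders the universe,
      IsStrictTotalOrder M LtA ∧
      -- the operations are well defined,
      (∀ x : M, ∃! z, IsSuccA x z) ∧
      (∀ x y : M, ∃! z, IsAddA x y z) ∧
      (∀ x y : M, ∃! z, IsMulA x y z) ∧
      (∀ x y : M, ∃! z, IsExpA x y z) ∧
      -- and the resulting structure is a model of `IΔ₀ + exp`.
      @Theory.Model arithLang M (ackStructure M) IDelta0Exp) ∧
    -- The mapping `𝔡` exists and defines an interpretation of `IΔ₀ + exp` in `EA*`.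
    (∃ 𝔡, IsMappingD 𝔡) ∧
    ∀ 𝔡, IsMappingD 𝔡 → 𝔡.DefinesInterpretation IDelta0Exp EAstar :=
  ⟨fun _ _ _ => ⟨fun _ hs => isAck_existsUnique hs, isStrictTotalOrder_ltA,
    isSuccA_existsUnique, isAddA_existsUnique, isMulA_existsUnique, isExpA_existsUnique,
    model_ackStructure⟩, ⟨ackMapping, isMappingD_ackMapping⟩,
    fun _ h => h.definesInterpretation⟩
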